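/- A planar $st$-graph is an acyclic digraph with exactly one source $s$ and exactly one sink $t$ that has a planar embedding with $s$ and $t$ on the boundary of the outer face. An $st$-cutset of a planar $st$-graph $G=(V,E)$ is a set $W\subseteq E$ such that removing $W$ leaves exactly two connected components $C_s\ni s$ and $C_t\ni t$, and every edge of $W$ has its tail in $C_s$ and its head in $C_t$. An upward pointset embedding (UPSE) of $G$ on a set $S\subset\mathbb R^2$ with $|S|=|V|$ is a straight-line drawing of $G$ that maps the vertices to distinct points of $S$, in which no vertex lies in the interior of an edge, no two distinct edges share a point interior to both, and the tail of every edge has a smaller $y$-coordinate than its head. UPSE Testing asks whether $G$ has a UPSE on $S$. Theorem. There are an algorithm on the real RAM and an absolute constant $C$ such that the following holds. Let $G$ be an $n$-vertex planar $st$-graph whose maximum $st$-cutset has size $k$, and let $S$ be a set of $n$ points in the plane, no two with the same $y$-coordinate. On the input $(G,S)$ (a list of the edges of $G$ and a list of the points of $S$, each in any order), the algorithm decides whether $G$ has a UPSE on $S$ and, if so, outputs one, namely the assignment of the vertices to the points of $S$. It takes at most $C\,n^{4k}$ time and $C\,n^{3k}$ space. Here the time is the number of elementary operations (word operations, arithmetic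 operations on and comparisons of real numbers, and memory accesses), the space is the number of memory cells, and the integers stored in cells are at most $C\,n^{4k}$, that is, they have $O(k\log n)$ bits. -/

import Mathlib

namespace UPSE

/-! ### Planar `st`-graphs -/

/-- The points of the plane, as pairs `(x, y)`. -/
abbrev Plane : Type := ℝ × ℝ

/-- A planar drawing (embedding) of a digraph: vertices are distinct points, every edge is a simple
arc joining its end-vertices, an arc contains no vertex other than its end-vertices, and two
distinct arcs meet only in vertices. -/
structure PlanarDrawing {V : Type*} (G : Digraph V) where
  pos : V → Plane
  pos_injective : Function.Injective pos
  arc : ∀ {u v : V}, G.Adj u v → Path (pos u) (pos v)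
  arc_injective : ∀ {u v : V} (h : G.Adj u v), Function.Injective (arc h)
  arc_vertex : ∀ {u v : V} (h : G.Adj u v) (w : V) (x : unitInterval),
    arc h x = pos w → w = u ∨ w = v
  arc_arc : ∀ {u v u' v' : V} (h : G.Adj u v) (h' : G.Adj u' v') (x x' : unitInterval),
    (u, v) ≠ (u', v') → arc h x = arc h' x' → ∃ w, arc h x = pos w

/-- The set of all points covered by a drawing. -/
def PlanarDrawing.carrier {V : Type*} {G : Digraph V} (D : PlanarDrawing G) : Set Plane :=
  {x | (∃ v, D.pos v = x) ∨ ∃ (u v : V) (h : G.Adj u v), x ∈ Set.range (D.arc h)}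

/-- The outer face: the unbounded part of the complement of the drawing. -/
def PlanarDrawing.outerFace {V : Type*} {G : Digraph V} (D : PlanarDrawing G) : Set Plane :=
  {x | x ∈ D.carrierᶜ ∧ ¬ Bornology.IsBounded (connectedComponentIn D.carrierᶜ x)}

/-- `G` is a planar `st`-graph: an acyclic digraph with the single source `s` and the single sink
`t`, which has a planar embedding with `s` and `t` on the boundary of the outer face. -/
structure IsPlanarSTGraph {V : Type*} (G : Digraph V) (s t : V) : Prop where
  acyclic : ∀ v, ¬ Relation.TransGen G.Adj v v
  source : ∀ v, (∀ u, ¬ G.Adj u v) ↔ v = s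
  sink : ∀ v, (∀ u, ¬ G.Adj v u) ↔ v = t
  planar : ∃ D : PlanarDrawing G,
    D.pos s ∈ frontier D.outerFace ∧ D.pos t ∈ frontier D.outerFace

/-- The edge set of a digraph. -/
def edges {V : Type*} (G : Digraph V) : Set (V × V) := {a | G.Adj a.1 a.2}

/-- The underlying undirected graph of what remains of `G` after removing the edges in `W`. -/
def removeEdges {V : Type*} (G : Digraph V) (W : Set (V × V)) : SimpleGraph V :=
  SimpleGraph.fromRel fun u v => G.Adj u v ∧ (u, v) ∉ W

/-- `W` is an `st`-cutset: removing `W` leaves exactly two connected components, one containing `s`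
and one containing `t`, and every edge in `W` has its tail in the component of `s` and its head in
the component of `t`. -/
structure IsSTCutset {V : Type*} (G : Digraph V) (s t : V) (W : Set (V × V)) : Prop where
  subset : W ⊆ edges G
  separates : ¬ (removeEdges G W).Reachable s t
  covers : ∀ v, (removeEdges G W).Reachable s v ∨ (removeEdges G W).Reachable t v
  crosses : ∀ a ∈ W, (removeEdges G W).Reachable s a.1 ∧ (removeEdges G W).Reachable t a.2

/-- The maximum `st`-cutset of `G` has size `k`. -/
def MaxSTCutset {V : Type*} (G : Digraph V) (s t : V) (k : ℕ) : Prop :=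
  IsGreatest {j | ∃ W, IsSTCutset G s t W ∧ W.ncard = j} k

/-! ### Upward pointset embeddings -/

/-- The placement `φ` of the vertices is an upward pointset embedding of `G` on `S`: the
straight-line drawing that it induces maps the vertices to distinct points of `S`, is upward (every
edge goes from its tail strictly up to its head) and is planar (no vertex lies inside an edge, and
two distinct edges share no point that is interior to both). -/
structure IsUPSE {V : Type*} (G : Digraph V) (S : Set Plane) (φ : V → Plane) : Prop where
  injective : Function.Injective φ
  mem : ∀ v, φ v ∈ S
  upward : ∀ u v, G.Adj u v → (φ u).2 < (φ v).2
  vertex_edge : ∀ u v w, G.Adj u v → φ w ∉ openSegment ℝ (φ u) (φ v)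
  edge_edge : ∀ u v u' v', G.Adj u v → G.Adj u' v' → (u, v) ≠ (u', v') →
    Disjoint (openSegment ℝ (φ u) (φ v)) (openSegment ℝ (φ u') (φ v'))

/-! ### The real RAM

A random access machine with a memory of words (natural numbers of bounded size), a memory of real
numbers, and registers for both. There are no real constants, no conversion between words and reals
other than through comparisons, and no rounding of reals. A program mentions only finitely many
registers. -/

/-- Elementary instructions. Numbers are names of registers, except for the literal `c` of
`const`. -/
inductive Instr : Type
  | const (d c : ℕ)
  | copy (d a : ℕ)
  | add (d a b : ℕ)
  | sub (d a b : ℕ)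
  | mul (d a b : ℕ)
  | div (d a b : ℕ)
  | mod (d a b : ℕ)
  | load (d a : ℕ)
  | store (a b : ℕ)
  | rcopy (d a : ℕ)
  | radd (d a b : ℕ)
  | rsub (d a b : ℕ)
  | rmul (d a b : ℕ)
  | rdiv (d a b : ℕ)
  | rload (d a : ℕ)
  | rstore (a b : ℕ)

/-- Elementary tests: comparisons of two word registers or of two real registers. -/
inductive Test : Type
  | eq (a b : ℕ)
  | lt (a b : ℕ)
  | rlt (a b : ℕ)

/-- Programs. -/
inductive Prog : Type
  | skip
  | instr (i : Instr)
  | seq (P Q : Prog)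
  | ite (b : Test) (P Q : Prog)
  | while (b : Test) (P : Prog)

/-- The contents of the word registers, the real registers, the word memory and the real memory. -/
structure State : Type where
  reg : ℕ → ℕ
  rreg : ℕ → ℝ
  mem : ℕ → ℕ
  rmem : ℕ → ℝ

/-- Store the word `x` in the register `d`; a fault if `x` exceeds the largest word `W`. -/
def State.setReg (W : ℕ) (σ : State) (d x : ℕ) : Option State :=
  if x ≤ W then some { σ with reg := Function.update σ.reg d x } else none

/-- Store the real number `x` in the register `d`. -/
def State.setRReg (σ : State) (d : ℕ) (x : ℝ) : State :=
  { σ with rreg := Function.update σ.rreg d x }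

open Classical in
/-- The effect of an instruction on a machine with `L` cells of word memory, `L` cells of real
memory, and words in `{0, …, W}`; `none` is a fault (address or word out of range, division by
zero). Subtraction of words is truncated at zero. -/
noncomputable def Instr.run (L W : ℕ) (σ : State) : Instr → Option State
  | const d c => σ.setReg W d c
  | copy d a => σ.setReg W d (σ.reg a)
  | add d a b => σ.setReg W d (σ.reg a + σ.reg b)
  | sub d a b => σ.setReg W d (σ.reg a - σ.reg b)
  | mul d a b => σ.setReg W d (σ.reg a * σ.reg b)
  | div d a b => if σ.reg b = 0 then none else σ.setReg W d (σ.reg a / σ.reg b)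
  | mod d a b => if σ.reg b = 0 then none else σ.setReg W d (σ.reg a % σ.reg b)
  | load d a => if σ.reg a < L then σ.setReg W d (σ.mem (σ.reg a)) else none
  | store a b => if σ.reg a < L then
      some { σ with mem := Function.update σ.mem (σ.reg a) (σ.reg b) } else none
  | rcopy d a => some (σ.setRReg d (σ.rreg a))
  | radd d a b => some (σ.setRReg d (σ.rreg a + σ.rreg b))
  | rsub d a b => some (σ.setRReg d (σ.rreg a - σ.rreg b))
  | rmul d a b => some (σ.setRReg d (σ.rreg a * σ.rreg b))
  | rdiv d a b => if σ.rreg b = 0 then none else some (σ.setRReg d (σ.rreg a / σ.rreg b))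
  | rload d a => if σ.reg a < L then some (σ.setRReg d (σ.rmem (σ.reg a))) else none
  | rstore a b => if σ.reg a < L then
      some { σ with rmem := Function.update σ.rmem (σ.reg a) (σ.rreg b) } else none

/-- The outcome of a test. -/
def Test.holds (σ : State) : Test → Prop
  | eq a b => σ.reg a = σ.reg b
  | lt a b => σ.reg a < σ.reg b
  | rlt a b => σ.rreg a < σ.rreg b

/-- `Exec L W P σ T σ'`: on a machine with `L` cells of word memory, `L` cells of real memory and
words in `{0, …, W}`, the program `P` started in the state `σ` halts without a fault in the state
`σ'` after exactly `T` steps, where every executed instruction and every evaluated test is one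
step. -/
inductive Exec (L W : ℕ) : Prog → State → ℕ → State → Prop
  | skip (σ : State) : Exec L W .skip σ 0 σ
  | instr {i : Instr} {σ σ' : State} : i.run L W σ = some σ' → Exec L W (.instr i) σ 1 σ'
  | seq {P Q : Prog} {σ₀ σ₁ σ₂ : State} {T₁ T₂ : ℕ} :
      Exec L W P σ₀ T₁ σ₁ → Exec L W Q σ₁ T₂ σ₂ → Exec L W (.seq P Q) σ₀ (T₁ + T₂) σ₂
  | ite_true {b : Test} {P Q : Prog} {σ σ' : State} {T : ℕ} :
      b.holds σ → Exec L W P σ T σ' → Exec L W (.ite b P Q) σ (T + 1) σ'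
  | ite_false {b : Test} {P Q : Prog} {σ σ' : State} {T : ℕ} :
      ¬ b.holds σ → Exec L W Q σ T σ' → Exec L W (.ite b P Q) σ (T + 1) σ'
  | while_false {b : Test} {P : Prog} {σ : State} :
      ¬ b.holds σ → Exec L W (.while b P) σ 1 σ
  | while_true {b : Test} {P : Prog} {σ₀ σ₁ σ₂ : State} {T₁ T₂ : ℕ} :
      b.holds σ₀ → Exec L W P σ₀ T₁ σ₁ → Exec L W (.while b P) σ₁ T₂ σ₂ →
      Exec L W (.while b P) σ₀ (T₁ + T₂ + 1) σ₂

/-! ### Instances and their encoding -/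

/-- An instance of UPSE Testing on the vertex set `{0, …, n-1}`: the list `e` of the `m` edges, in
any order, and the list `p` of the `n` points, in any order. -/
structure PointsetInstance (n m : ℕ) : Type where
  e : Fin m → Fin n × Fin n
  p : Fin n → Plane

/-- The list of edges of `I` lists every edge of `G` exactly once. -/
def PointsetInstance.Lists {n m : ℕ} (I : PointsetInstance n m) (G : Digraph (Fin n)) : Prop :=
  Function.Injective I.e ∧ Set.range I.e = edges G

/-- The pointset of an instance. -/
def PointsetInstance.pointset {n m : ℕ} (I : PointsetInstance n m) : Set Plane := Set.range I.p

/-- The initial state of the machine: the word registers 0 and 1 hold `n` and `m`, the cells `2 j`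
and `2 j + 1` of the word memory hold the tail and the head of the `j`-th edge, the cells `2 i` and
`2 i + 1` of the real memory hold the coordinates of the `i`-th point, everything else is zero. -/
noncomputable def PointsetInstance.initial {n m : ℕ} (I : PointsetInstance n m) : State where
  reg r := if r = 0 then n else if r = 1 then m else 0
  rreg _ := 0
  mem a := if h : a / 2 < m then
      (if a % 2 = 0 then ((I.e ⟨a / 2, h⟩).1 : ℕ) else ((I.e ⟨a / 2, h⟩).2 : ℕ)) else 0
  rmem a := if h : a / 2 < n then
      (if a % 2 = 0 then (I.p ⟨a / 2, h⟩).1 else (I.p ⟨a / 2, h⟩).2) else 0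

end UPSE

namespace UPSE

/-! ### A structured language that compiles to programs of the machine -/

/-! Sweep the points from bottom to top. As their heights are distinct, an embedding is an
assignment of the ranks 1, …, n to the vertices (`PointsetInstance.solution_iff`), and for each
level the vertices of smaller rank form a down-closed set. The edges leaving a down-closed set that
contains the source but not the sink form a cutset (`IsPlanarSTGraph.isSTCutset`), so at most k
edges cross any level. A partial placement therefore remembers little: the ranks of the tails of
these cut edges and ranks promised to their heads. Everything else is forgotten.

Locality of planarity. Two edges that overlap vertically are both in the cut when the level reaches
the lower of their heads. A vertex is placed only when all heads of the cut have been promised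
ranks, so testing the pairs inside each cut suffices (`Problem.completes_place`). The test takes the
horizontal distance of the two edges, an affine function of the height up to a positive factor, and
compares its signs at the two ends of the common range of heights (`Problem.Ok`). A vertex in the
interior of an edge is caught as a degenerate crossing with an edge incident to that vertex.

Correctness. The program explores the graph of partial placements from `Problem.start`. A solution
guides the search to an accepting step (`Problem.Reach.exists_accept`). Conversely, the ranks
forgotten on the way to an accepting step are recovered by following predecessor links back to the
start (`Problem.Reach.completes`).

Counting (`Problem.bounded`). Since every vertex reaches the sink, the tails of the cut edges
determine the set of placed vertices, hence the level: at most n^k possibilities. With i placed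
vertices, the tails have ranks in 1, …, i, and one of them has rank i because the vertex placed last
has an edge to an unplaced vertex. The heads have ranks above i or none, and one of them has rank i
+ 1 or none, since otherwise the next point could never be used. This leaves k i^(k-1) times 2k
(n+1-i)^(k-1) choices. As i (n+1-i) is at most n²/2, the exponential gain absorbs k², and there are
O(n^(3k-2)) placements in all.

Cost. Visited placements are stored in a trie, with at most n new nodes of n + 2 cells for each:
O(n^(3k)) cells. Each placement has n candidate steps, each tested in O((m+n)²) time. Since m ≤ k n
(`PointsetInstance.card_edges_le`), the resulting cubic factor in k is absorbed by n^(k-1), and the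
time is O(n^(4k)).

The program is written in a small language of nested counting loops with a weakest-precondition
calculus; `Cmd.exec` transfers specifications, fault freedom and time bounds to the machine. -/

/-- The variables of the structured language; they live in the first registers of the machine. -/
inductive Var
  | n | m | n1 | A | X | Bs | S | zero | i | j | j2 | v | p | r | lvl | w | flag | g
  | a | b | c | d | z1 | z2 | node | ch | ad | cnt | q | qc | found
  deriving DecidableEq

/-- The register of a variable. -/
def Var.idx : Var → ℕ
  | n => 0 | m => 1 | n1 => 2 | A => 3 | X => 4 | Bs => 5 | S => 6 | zero => 7 | i => 8 | j => 9
  | j2 => 10 | v => 11 | p => 12 | r => 13 | lvl => 14 | w => 15 | flag => 16 | g => 17 | a => 18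
  | b => 19 | c => 20 | d => 21 | z1 => 22 | z2 => 23 | node => 24 | ch => 25 | ad => 26 | cnt => 27
  | q => 28 | qc => 29 | found => 30

/-- The variable of a register. -/
def Var.ofIdx : ℕ → Var
  | 0 => n | 1 => m | 2 => n1 | 3 => A | 4 => X | 5 => Bs | 6 => S | 7 => zero | 8 => i | 9 => j
  | 10 => j2 | 11 => v | 12 => p | 13 => r | 14 => lvl | 15 => w | 16 => flag | 17 => g | 18 => a
  | 19 => b | 20 => c | 21 => d | 22 => z1 | 23 => z2 | 24 => node | 25 => ch | 26 => ad | 27 => cnt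
  | 28 => q | 29 => qc | _ => found

theorem Var.ofIdx_idx (x : Var) : Var.ofIdx x.idx = x := by cases x <;> rfl

theorem Var.idx_inj {x y : Var} : x.idx = y.idx ↔ x = y :=
  ⟨fun h => by rw [← ofIdx_idx x, h, ofIdx_idx], fun h => h ▸ rfl⟩

theorem Var.idx_lt (x : Var) : x.idx < 40 := by cases x <;> decide

/-- The state of the structured language: variables and the two memories. -/
structure HS : Type where
  v : Var → ℕ
  mem : ℕ → ℕ
  rmem : ℕ → ℝ

namespace HS

/-- Assign a variable. -/
def set (s : HS) (x : Var) (k : ℕ) : HS := { s with v := Function.update s.v x k }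

/-- Store a word. -/
def setMem (s : HS) (a k : ℕ) : HS := { s with mem := Function.update s.mem a k }

/-- Store a real number. -/
def setRMem (s : HS) (a : ℕ) (k : ℝ) : HS := { s with rmem := Function.update s.rmem a k }

@[simp] theorem set_v (s : HS) (x : Var) (k : ℕ) (y : Var) :
    (s.set x k).v y = if y = x then k else s.v y := by simp [set, Function.update_apply]
@[simp] theorem set_mem (s : HS) (x : Var) (k : ℕ) : (s.set x k).mem = s.mem := rfl
@[simp] theorem set_rmem (s : HS) (x : Var) (k : ℕ) : (s.set x k).rmem = s.rmem := rfl
@[simp] theorem setMem_v (s : HS) (a k : ℕ) : (s.setMem a k).v = s.v := rfl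
@[simp] theorem setMem_mem (s : HS) (a k b : ℕ) :
    (s.setMem a k).mem b = if b = a then k else s.mem b := by simp [setMem, Function.update_apply]
@[simp] theorem setMem_rmem (s : HS) (a k : ℕ) : (s.setMem a k).rmem = s.rmem := rfl
@[simp] theorem setRMem_v (s : HS) (a : ℕ) (k : ℝ) : (s.setRMem a k).v = s.v := rfl
@[simp] theorem setRMem_mem (s : HS) (a : ℕ) (k : ℝ) : (s.setRMem a k).mem = s.mem := rfl
@[simp] theorem setRMem_rmem (s : HS) (a : ℕ) (k : ℝ) (b : ℕ) :
    (s.setRMem a k).rmem b = if b = a then k else s.rmem b := by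
  simp [setRMem, Function.update_apply]

end HS

/-! ### Representation of states and evaluation of expressions -/

/-- The machine state `σ` represents the state `s`. -/
structure Rep (W : ℕ) (σ : State) (s : HS) : Prop where
  reg : ∀ x : Var, σ.reg x.idx = s.v x
  mem : σ.mem = s.mem
  rmem : σ.rmem = s.rmem
  regLe : ∀ r, σ.reg r ≤ W
  memLe : ∀ a, σ.mem a ≤ W

/-- Word expressions. -/
inductive Ex
  | var (x : Var)
  | lit (c : ℕ)
  | add (e f : Ex)
  | sub (e f : Ex)
  | mul (e f : Ex)
  | get (e : Ex)

namespace Ex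

/-- The value of an expression. -/
@[simp] def val (s : HS) : Ex → ℕ
  | var x => s.v x
  | lit c => c
  | add e f => e.val s + f.val s
  | sub e f => e.val s - f.val s
  | mul e f => e.val s * f.val s
  | get e => s.mem (e.val s)

/-- The evaluation of an expression causes no fault. -/
@[simp] def Safe (L W : ℕ) (s : HS) : Ex → Prop
  | var _ => True
  | lit c => c ≤ W
  | add e f => e.Safe L W s ∧ f.Safe L W s ∧ e.val s + f.val s ≤ W
  | sub e f => e.Safe L W s ∧ f.Safe L W s
  | mul e f => e.Safe L W s ∧ f.Safe L W s ∧ e.val s * f.val s ≤ W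
  | get e => e.Safe L W s ∧ e.val s < L

/-- The number of steps that the evaluation takes. -/
def size : Ex → ℕ
  | var _ => 1
  | lit _ => 1
  | add e f => e.size + f.size + 1
  | sub e f => e.size + f.size + 1
  | mul e f => e.size + f.size + 1
  | get e => e.size + 1

/-- Evaluate an expression into the register `d`. -/
def code (d : ℕ) : Ex → Prog
  | var x => .instr (.copy d x.idx)
  | lit c => .instr (.const d c)
  | add e f => .seq (.seq (e.code d) (f.code (d + 1))) (.instr (.add d d (d + 1)))
  | sub e f => .seq (.seq (e.code d) (f.code (d + 1))) (.instr (.sub d d (d + 1)))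
  | mul e f => .seq (.seq (e.code d) (f.code (d + 1))) (.instr (.mul d d (d + 1)))
  | get e => .seq (e.code d) (.instr (.load d d))

end Ex

/-- All variables live in registers below 40 (`Var.idx_lt`), so the registers from 40 on are scratch
space that the representation does not see. -/
theorem Rep.setReg {W : ℕ} {σ : State} {s : HS} (h : Rep W σ s) {d k : ℕ} (hd : 40 ≤ d)
    (hk : k ≤ W) : Rep W { σ with reg := Function.update σ.reg d k } s where
  reg x := by
    have := x.idx_lt
    simp [h.reg, show x.idx ≠ d by omega]
  mem := h.mem
  rmem := h.rmem
  regLe r := by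
    simp only [Function.update_apply]
    split_ifs
    exacts [hk, h.regLe r]
  memLe := h.memLe

theorem Rep.setVar {W : ℕ} {σ : State} {s : HS} (h : Rep W σ s) {x : Var} {k : ℕ} 
    (hk : k ≤ W) : Rep W { σ with reg := Function.update σ.reg x.idx k } (s.set x k) where
  reg y := by simp [Function.update_apply, h.reg, Var.idx_inj]
  mem := h.mem
  rmem := h.rmem
  regLe r := by
    simp only [Function.update_apply]
    split_ifs
    exacts [hk, h.regLe r]
  memLe := h.memLe

theorem exec_setReg {L W : ℕ} {σ : State} {s : HS} (hr : Rep W σ s) {d k : ℕ} (hd : 40 ≤ d)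
    {i : Instr} (hi : i.run L W σ = σ.setReg W d k) (hk : k ≤ W) :
    ∃ σ', Exec L W (.instr i) σ 1 σ' ∧ Rep W σ' s ∧ σ'.reg d = k ∧
      (∀ r < d, σ'.reg r = σ.reg r) ∧ σ'.rreg = σ.rreg := by
  refine ⟨{ σ with reg := Function.update σ.reg d k }, .instr ?_, hr.setReg hd hk, by simp, ?_, rfl⟩
  · rw [hi, State.setReg, if_pos hk]
  · intro r h
    simp [h.ne]

/-- Registers serve as a stack with top `d`: the second operand is evaluated one register higher,
and since registers below the top survive, the first operand is still there when the operation is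
applied. -/
theorem Ex.exec {L W : ℕ} {s : HS} (e : Ex) : ∀ {σ : State} {d : ℕ}, Rep W σ s → 40 ≤ d →
    e.Safe L W s → ∃ σ', Exec L W (e.code d) σ e.size σ' ∧ Rep W σ' s ∧ σ'.reg d = e.val s ∧
      (∀ r < d, σ'.reg r = σ.reg r) ∧ σ'.rreg = σ.rreg := by
  have binary : ∀ (e f : Ex) (I : Instr) {σ : State} {d k : ℕ}, 40 ≤ d → k ≤ W →
      (∃ σ', Exec L W (e.code d) σ e.size σ' ∧ Rep W σ' s ∧ σ'.reg d = e.val s ∧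
        (∀ r < d, σ'.reg r = σ.reg r) ∧ σ'.rreg = σ.rreg) →
      (∀ {σ : State}, Rep W σ s →
        ∃ σ', Exec L W (f.code (d + 1)) σ f.size σ' ∧ Rep W σ' s ∧ σ'.reg (d + 1) = f.val s ∧
        (∀ r < d + 1, σ'.reg r = σ.reg r) ∧ σ'.rreg = σ.rreg) →
      (∀ σ', σ'.reg d = e.val s → σ'.reg (d + 1) = f.val s → I.run L W σ' = σ'.setReg W d k) →
      ∃ σ', Exec L W (.seq (.seq (e.code d) (f.code (d + 1))) (.instr I)) σ
        (e.size + f.size + 1) σ' ∧ Rep W σ' s ∧ σ'.reg d = k ∧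
        (∀ r < d, σ'.reg r = σ.reg r) ∧ σ'.rreg = σ.rreg := by
    rintro e f I σ d k hd hk ⟨σ₁, x₁, r₁, v₁, f₁, g₁⟩ hf hI
    obtain ⟨σ₂, x₂, r₂, v₂, f₂, g₂⟩ := hf r₁
    obtain ⟨σ₃, x₃, r₃, v₃, f₃, g₃⟩ := exec_setReg r₂ hd
      (hI σ₂ ((f₂ d (by omega)).trans v₁) v₂) hk
    exact ⟨σ₃, .seq (.seq x₁ x₂) x₃, r₃, v₃,
      fun r h => by rw [f₃ r h, f₂ r (by omega), f₁ r h], by rw [g₃, g₂, g₁]⟩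
  -- `Safe` imposes no size condition on variables, differences and memory reads; their bounds come
  -- from the words already held by the machine.
  have le : ∀ e : Ex, e.Safe L W s → ∀ σ, Rep W σ s → e.val s ≤ W := by
    intro e
    induction e with
    | var x => intro _ σ hr; rw [val, ← hr.reg]; exact hr.regLe _
    | lit c => exact fun h _ _ => h
    | add e f ihe ihf => exact fun h _ _ => h.2.2
    | sub e f ihe ihf => exact fun h σ hr => (Nat.sub_le _ _).trans (ihe h.1 σ hr)
    | mul e f ihe ihf => exact fun h _ _ => h.2.2
    | get e ih => intro _ σ hr; rw [val, ← hr.mem]; exact hr.memLe _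
  induction e with
  | var x =>
    intro σ d hr hd _
    exact exec_setReg hr hd (by simp only [Instr.run]; rw [hr.reg]; rfl) (by rw [val, ← hr.reg]; exact hr.regLe _)
  | lit c =>
    intro σ d hr hd h
    exact exec_setReg hr hd rfl h
  | add e f ihe ihf =>
    intro σ d hr hd h
    exact binary e f _ hd h.2.2 (ihe hr hd h.1) (fun hr => ihf hr (by omega) h.2.1)
      (fun σ' h₁ h₂ => by simp [Instr.run, h₁, h₂])
  | sub e f ihe ihf =>
    intro σ d hr hd h
    exact binary e f _ hd (le (sub e f) h σ hr) (ihe hr hd h.1) (fun hr => ihf hr (by omega) h.2)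
      (fun σ' h₁ h₂ => by simp [Instr.run, h₁, h₂])
  | mul e f ihe ihf =>
    intro σ d hr hd h
    exact binary e f _ hd h.2.2 (ihe hr hd h.1) (fun hr => ihf hr (by omega) h.2.1)
      (fun σ' h₁ h₂ => by simp [Instr.run, h₁, h₂])
  | get e ih =>
    intro σ d hr hd h
    obtain ⟨σ₁, x₁, r₁, v₁, f₁, g₁⟩ := ih hr hd h.1
    obtain ⟨σ₃, x₃, r₃, v₃, f₃, g₃⟩ := exec_setReg (i := .load d d) (L := L) r₁ hd
      (k := σ₁.mem (σ₁.reg d)) (by simp [Instr.run, v₁, h.2]) (r₁.memLe _)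
    exact ⟨σ₃, .seq x₁ x₃, r₃, by rw [v₃, v₁, r₁.mem]; rfl,
      fun r h => by rw [f₃ r h, f₁ r h], by rw [g₃, g₁]⟩

/-- Real expressions. -/
inductive RE
  | zero
  | real (e : Ex)
  | add (e f : RE)
  | sub (e f : RE)
  | mul (e f : RE)

namespace RE

/-- The value of an expression. -/
@[simp] def val (s : HS) : RE → ℝ
  | zero => 0
  | .real e => s.rmem (e.val s)
  | add e f => e.val s + f.val s
  | sub e f => e.val s - f.val s
  | mul e f => e.val s * f.val s

/-- The evaluation of an expression causes no fault. -/
@[simp] def Safe (L W : ℕ) (s : HS) : RE → Prop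
  | zero => True
  | .real e => e.Safe L W s ∧ e.val s < L
  | add e f => e.Safe L W s ∧ f.Safe L W s
  | sub e f => e.Safe L W s ∧ f.Safe L W s
  | mul e f => e.Safe L W s ∧ f.Safe L W s

/-- The number of steps that the evaluation takes. -/
def size : RE → ℕ
  | zero => 1
  | .real e => e.size + 1
  | add e f => e.size + f.size + 1
  | sub e f => e.size + f.size + 1
  | mul e f => e.size + f.size + 1

/-- Evaluate an expression into the real register `d`. -/
def code (d : ℕ) : RE → Prog
  -- The machine has no real constants, so zero is produced as a difference.
  | zero => .instr (.rsub d d d)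
  -- No word result stays live across real operations, so one fixed scratch register serves for all
  -- addresses.
  | .real e => .seq (e.code 50) (.instr (.rload d 50))
  | add e f => .seq (.seq (e.code d) (f.code (d + 1))) (.instr (.radd d d (d + 1)))
  | sub e f => .seq (.seq (e.code d) (f.code (d + 1))) (.instr (.rsub d d (d + 1)))
  | mul e f => .seq (.seq (e.code d) (f.code (d + 1))) (.instr (.rmul d d (d + 1)))

end RE

theorem Rep.setRReg {W : ℕ} {σ : State} {s : HS} (h : Rep W σ s) (d : ℕ) (k : ℝ) :
    Rep W (σ.setRReg d k) s := ⟨h.reg, h.mem, h.rmem, h.regLe, h.memLe⟩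

theorem exec_setRReg {L W : ℕ} {σ : State} {s : HS} (hr : Rep W σ s) {d : ℕ} {k : ℝ}
    {i : Instr} (hi : i.run L W σ = some (σ.setRReg d k)) :
    ∃ σ', Exec L W (.instr i) σ 1 σ' ∧ Rep W σ' s ∧ σ'.rreg d = k ∧
      (∀ r < d, σ'.rreg r = σ.rreg r) :=
  ⟨_, .instr hi, hr.setRReg d k, by simp [State.setRReg],
    fun r h => by simp [State.setRReg, h.ne]⟩

theorem RE.exec {L W : ℕ} {s : HS} (e : RE) : ∀ {σ : State} {d : ℕ}, Rep W σ s →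
    e.Safe L W s → ∃ σ', Exec L W (e.code d) σ e.size σ' ∧ Rep W σ' s ∧ σ'.rreg d = e.val s ∧
      (∀ r < d, σ'.rreg r = σ.rreg r) := by
  have binary : ∀ (e f : RE) (I : Instr) {σ : State} {d : ℕ} {k : ℝ},
      (∃ σ', Exec L W (e.code d) σ e.size σ' ∧ Rep W σ' s ∧ σ'.rreg d = e.val s ∧
        (∀ r < d, σ'.rreg r = σ.rreg r)) →
      (∀ {σ : State}, Rep W σ s →
        ∃ σ', Exec L W (f.code (d + 1)) σ f.size σ' ∧ Rep W σ' s ∧ σ'.rreg (d + 1) = f.val s ∧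
        (∀ r < d + 1, σ'.rreg r = σ.rreg r)) →
      (∀ σ', σ'.rreg d = e.val s → σ'.rreg (d + 1) = f.val s →
        I.run L W σ' = some (σ'.setRReg d k)) →
      ∃ σ', Exec L W (.seq (.seq (e.code d) (f.code (d + 1))) (.instr I)) σ
        (e.size + f.size + 1) σ' ∧ Rep W σ' s ∧ σ'.rreg d = k ∧
        (∀ r < d, σ'.rreg r = σ.rreg r) := by
    rintro e f I σ d k ⟨σ₁, x₁, r₁, v₁, f₁⟩ hf hI
    obtain ⟨σ₂, x₂, r₂, v₂, f₂⟩ := hf r₁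
    obtain ⟨σ₃, x₃, r₃, v₃, f₃⟩ := exec_setRReg r₂ (hI σ₂ ((f₂ d (by omega)).trans v₁) v₂)
    exact ⟨σ₃, .seq (.seq x₁ x₂) x₃, r₃, v₃,
      fun r h => by rw [f₃ r h, f₂ r (by omega), f₁ r h]⟩
  induction e with
  | zero =>
    intro σ d hr _
    exact exec_setRReg hr (by simp [Instr.run])
  | real e =>
    intro σ d hr h
    obtain ⟨σ₁, x₁, r₁, v₁, f₁, g₁⟩ := e.exec (d := 50) hr (by norm_num) h.1
    obtain ⟨σ₃, x₃, r₃, v₃, f₃⟩ := exec_setRReg (i := .rload d 50) (L := L) r₁ (d := d)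
      (k := σ₁.rmem (σ₁.reg 50)) (by simp [Instr.run, v₁, h.2])
    exact ⟨σ₃, .seq x₁ x₃, r₃, by rw [v₃, v₁, r₁.rmem]; rfl, fun r h => by rw [f₃ r h, g₁]⟩
  | add e f ihe ihf =>
    intro σ d hr h
    exact binary e f _ (ihe hr h.1) (fun hr => ihf hr h.2)
      (fun σ' h₁ h₂ => by simp [Instr.run, h₁, h₂])
  | sub e f ihe ihf =>
    intro σ d hr h
    exact binary e f _ (ihe hr h.1) (fun hr => ihf hr h.2)
      (fun σ' h₁ h₂ => by simp [Instr.run, h₁, h₂])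
  | mul e f ihe ihf =>
    intro σ d hr h
    exact binary e f _ (ihe hr h.1) (fun hr => ihf hr h.2)
      (fun σ' h₁ h₂ => by simp [Instr.run, h₁, h₂])

/-! ### Commands, their weakest preconditions and their compilation -/

/-- Commands. The loop `loop x y c` runs the body `c` for `x = 0, …, y - 1`. -/
inductive Cmd
  | skip
  | assign (x : Var) (e : Ex)
  | store (e f : Ex)
  | rstore (e : Ex) (f : RE)
  | seq (c d : Cmd)
  | ifLt (e f : Ex) (c d : Cmd)
  | ifEq (e f : Ex) (c d : Cmd)
  | ifR (e f : RE) (c d : Cmd)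
  | loop (x y : Var) (c : Cmd)

namespace Cmd

/-- The variables that a command assigns. -/
def writes : Cmd → List Var
  | skip => []
  | assign x _ => [x]
  | store _ _ => []
  | rstore _ _ => []
  | seq c d => c.writes ++ d.writes
  | ifLt _ _ c d => c.writes ++ d.writes
  | ifEq _ _ c d => c.writes ++ d.writes
  | ifR _ _ c d => c.writes ++ d.writes
  | loop x _ c => x :: c.writes

/-- The command does not store words. -/
def noStore : Cmd → Bool
  | skip => true
  | assign _ _ => true
  | store _ _ => false
  | rstore _ _ => true
  | seq c d => c.noStore && d.noStore
  | ifLt _ _ c d => c.noStore && d.noStore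
  | ifEq _ _ c d => c.noStore && d.noStore
  | ifR _ _ c d => c.noStore && d.noStore
  | loop _ _ c => c.noStore

/-- The command does not store real numbers. -/
def noRStore : Cmd → Bool
  | skip => true
  | assign _ _ => true
  | store _ _ => true
  | rstore _ _ => false
  | seq c d => c.noRStore && d.noRStore
  | ifLt _ _ c d => c.noRStore && d.noRStore
  | ifEq _ _ c d => c.noRStore && d.noRStore
  | ifR _ _ c d => c.noRStore && d.noRStore
  | loop _ _ c => c.noRStore

/-- No loop body assigns the counter or the bound of the loop. -/
def Wf : Cmd → Prop
  | skip => True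
  | assign _ _ => True
  | store _ _ => True
  | rstore _ _ => True
  | seq c d => c.Wf ∧ d.Wf
  | ifLt _ _ c d => c.Wf ∧ d.Wf
  | ifEq _ _ c d => c.Wf ∧ d.Wf
  | ifR _ _ c d => c.Wf ∧ d.Wf
  | loop x y c => x ≠ y ∧ x ∉ c.writes ∧ y ∉ c.writes ∧ c.Wf

instance decidableWf : ∀ c : Cmd, Decidable c.Wf
  | skip => .isTrue trivial
  | assign _ _ => .isTrue trivial
  | store _ _ => .isTrue trivial
  | rstore _ _ => .isTrue trivial
  | seq c d => have := decidableWf c; have := decidableWf d; inferInstanceAs (Decidable (_ ∧ _))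
  | ifLt _ _ c d =>
    have := decidableWf c; have := decidableWf d; inferInstanceAs (Decidable (_ ∧ _))
  | ifEq _ _ c d =>
    have := decidableWf c; have := decidableWf d; inferInstanceAs (Decidable (_ ∧ _))
  | ifR _ _ c d =>
    have := decidableWf c; have := decidableWf d; inferInstanceAs (Decidable (_ ∧ _))
  | loop _ _ c => have := decidableWf c; inferInstanceAs (Decidable (_ ∧ _ ∧ _ ∧ _))

/-- A bound on the number of steps, when the bounds of all loops are at most `B`. -/
def time (B : ℕ) : Cmd → ℕ
  | skip => 0
  | assign _ e => e.size + 1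
  | store e f => e.size + f.size + 1
  | rstore e f => f.size + e.size + 1
  | seq c d => c.time B + d.time B
  | ifLt e f c d => e.size + f.size + 1 + c.time B + d.time B
  | ifEq e f c d => e.size + f.size + 1 + c.time B + d.time B
  | ifR e f c d => e.size + f.size + 1 + c.time B + d.time B
  | loop _ _ c => B * (c.time B + 3) + 2

/-- Compile a command. -/
def code : Cmd → Prog
  | skip => .skip
  | assign x e => .seq (e.code 40) (.instr (.copy x.idx 40))
  | store e f => .seq (.seq (e.code 40) (f.code 41)) (.instr (.store 40 41))
  | rstore e f => .seq (.seq (f.code 0) (e.code 40)) (.instr (.rstore 40 0))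
  | seq c d => .seq c.code d.code
  | ifLt e f c d => .seq (.seq (e.code 40) (f.code 41)) (.ite (.lt 40 41) c.code d.code)
  | ifEq e f c d => .seq (.seq (e.code 40) (f.code 41)) (.ite (.eq 40 41) c.code d.code)
  | ifR e f c d => .seq (.seq (e.code 0) (f.code 1)) (.ite (.rlt 0 1) c.code d.code)
  | loop x y c => .seq (.instr (.const x.idx 0))
      (.while (.lt x.idx y.idx)
        (.seq c.code (.seq (.instr (.const 40 1)) (.instr (.add x.idx x.idx 40)))))

/-- What a command may change. -/
structure Frame (c : Cmd) (s s' : HS) : Prop where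
  var : ∀ x, x ∉ c.writes → s'.v x = s.v x
  mem : c.noStore = true → s'.mem = s.mem
  rmem : c.noRStore = true → s'.rmem = s.rmem

/-- Weakest preconditions. -/
def wp (L W B : ℕ) : Cmd → (HS → Prop) → HS → Prop
  | skip, Q, s => Q s
  | assign x e, Q, s => e.Safe L W s ∧ Q (s.set x (e.val s))
  | store e f, Q, s => e.Safe L W s ∧ f.Safe L W s ∧ e.val s < L ∧ Q (s.setMem (e.val s) (f.val s))
  | rstore e f, Q, s =>
    e.Safe L W s ∧ f.Safe L W s ∧ e.val s < L ∧ Q (s.setRMem (e.val s) (f.val s))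
  | seq c d, Q, s => c.wp L W B (d.wp L W B Q) s
  | ifLt e f c d, Q, s => e.Safe L W s ∧ f.Safe L W s ∧
      (e.val s < f.val s → c.wp L W B Q s) ∧ (¬ e.val s < f.val s → d.wp L W B Q s)
  | ifEq e f c d, Q, s => e.Safe L W s ∧ f.Safe L W s ∧
      (e.val s = f.val s → c.wp L W B Q s) ∧ (¬ e.val s = f.val s → d.wp L W B Q s)
  | ifR e f c d, Q, s => e.Safe L W s ∧ f.Safe L W s ∧
      (e.val s < f.val s → c.wp L W B Q s) ∧ (¬ e.val s < f.val s → d.wp L W B Q s)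
  -- The bound `B` on the number of iterations makes the running time a function of the command
  -- alone. The invariant is indexed by the number of completed iterations and refers to states
  -- whose counter already has that value.
  | .loop x y c, Q, s => s.v y ≤ B ∧ ∃ I : ℕ → HS → Prop, I 0 (s.set x 0) ∧
      (∀ j s', j < s.v y → I j s' → s'.v x = j → s'.v y = s.v y →
        c.wp L W B (fun s'' => I (j + 1) (s''.set x (j + 1))) s') ∧
      (∀ s', I (s.v y) s' → s'.v x = s.v y → Q s')

variable {L W B : ℕ}

theorem wp_mono {c : Cmd} : ∀ {Q R : HS → Prop} {s : HS}, (∀ s', Q s' → R s') →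
    c.wp L W B Q s → c.wp L W B R s := by
  induction c with
  | skip => exact fun h => h _
  | assign x e => exact fun h h' => ⟨h'.1, h _ h'.2⟩
  | store e f => exact fun h h' => ⟨h'.1, h'.2.1, h'.2.2.1, h _ h'.2.2.2⟩
  | rstore e f => exact fun h h' => ⟨h'.1, h'.2.1, h'.2.2.1, h _ h'.2.2.2⟩
  | seq c d ihc ihd => exact fun h h' => ihc (fun _ => ihd h) h'
  | ifLt e f c d ihc ihd =>
    exact fun h h' => ⟨h'.1, h'.2.1, fun x => ihc h (h'.2.2.1 x), fun x => ihd h (h'.2.2.2 x)⟩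
  | ifEq e f c d ihc ihd =>
    exact fun h h' => ⟨h'.1, h'.2.1, fun x => ihc h (h'.2.2.1 x), fun x => ihd h (h'.2.2.2 x)⟩
  | ifR e f c d ihc ihd =>
    exact fun h h' => ⟨h'.1, h'.2.1, fun x => ihc h (h'.2.2.1 x), fun x => ihd h (h'.2.2.2 x)⟩
  | loop x y c ih =>
    rintro Q R s h ⟨hB, I, h0, h1, h2⟩
    exact ⟨hB, I, h0, h1, fun s' a b => h _ (h2 s' a b)⟩

theorem Frame.refl (c : Cmd) (s : HS) : c.Frame s s := ⟨fun _ _ => rfl, fun _ => rfl, fun _ => rfl⟩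

theorem Frame.trans {c d e : Cmd} {s s' s'' : HS} (h : c.Frame s s') (h' : d.Frame s' s'')
    (hw : ∀ x, x ∉ e.writes → x ∉ c.writes ∧ x ∉ d.writes)
    (hs : e.noStore = true → c.noStore = true ∧ d.noStore = true)
    (hr : e.noRStore = true → c.noRStore = true ∧ d.noRStore = true) : e.Frame s s'' where
  var x hx := (h'.var x (hw x hx).2).trans (h.var x (hw x hx).1)
  mem hx := (h'.mem (hs hx).2).trans (h.mem (hs hx).1)
  rmem hx := (h'.rmem (hr hx).2).trans (h.rmem (hr hx).1)

/-- What a command can change is visible in its text; for a loop the frame condition joins the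
invariant. Specifications may thus mention only the intended effect, and everything else follows by
deciding membership in `writes`. -/
theorem wp_frame {c : Cmd} : ∀ {Q : HS → Prop} {s : HS},
    c.wp L W B Q s → c.wp L W B (fun s' => Q s' ∧ c.Frame s s') s := by
  have two : ∀ {c d e : Cmd}, e.writes = c.writes ++ d.writes →
      e.noStore = (c.noStore && d.noStore) → e.noRStore = (c.noRStore && d.noRStore) →
      (∀ s s', c.Frame s s' → e.Frame s s') ∧ (∀ s s', d.Frame s s' → e.Frame s s') := by
    intro c d e hw hs hr
    constructor <;> intro s s' h <;>
    exact ⟨fun x hx => h.var x (by simp_all), fun hx => h.mem (by simp_all),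
      fun hx => h.rmem (by simp_all)⟩
  induction c with
  | skip => exact fun h => ⟨h, Frame.refl _ _⟩
  | assign x e =>
    intro Q s h
    refine ⟨h.1, h.2, ⟨fun y hy => ?_, fun _ => rfl, fun _ => rfl⟩⟩
    simp only [writes, List.mem_singleton] at hy
    simp [hy]
  | store e f => exact fun h => ⟨h.1, h.2.1, h.2.2.1, h.2.2.2, fun _ _ => rfl, by simp [noStore], fun _ => rfl⟩
  | rstore e f => exact fun h => ⟨h.1, h.2.1, h.2.2.1, h.2.2.2, fun _ _ => rfl, fun _ => rfl, by simp [noRStore]⟩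
  | seq c d ihc ihd =>
    intro Q s h
    refine wp_mono (c := c) ?_ (ihc h)
    rintro s' ⟨h₁, h₂⟩
    refine wp_mono (c := d) ?_ (ihd h₁)
    rintro s'' ⟨h₃, h₄⟩
    refine ⟨h₃, h₂.trans h₄ ?_ ?_ ?_⟩ <;> simp [writes, noStore, noRStore]
  | ifLt e f c d ihc ihd =>
    intro Q s h
    obtain ⟨t₁, t₂⟩ := two (c := c) (d := d) (e := ifLt e f c d) rfl rfl rfl
    exact ⟨h.1, h.2.1, fun x => wp_mono (fun _ h => ⟨h.1, t₁ _ _ h.2⟩) (ihc (h.2.2.1 x)),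
      fun x => wp_mono (fun _ h => ⟨h.1, t₂ _ _ h.2⟩) (ihd (h.2.2.2 x))⟩
  | ifEq e f c d ihc ihd =>
    intro Q s h
    obtain ⟨t₁, t₂⟩ := two (c := c) (d := d) (e := ifEq e f c d) rfl rfl rfl
    exact ⟨h.1, h.2.1, fun x => wp_mono (fun _ h => ⟨h.1, t₁ _ _ h.2⟩) (ihc (h.2.2.1 x)),
      fun x => wp_mono (fun _ h => ⟨h.1, t₂ _ _ h.2⟩) (ihd (h.2.2.2 x))⟩
  | ifR e f c d ihc ihd =>
    intro Q s h
    obtain ⟨t₁, t₂⟩ := two (c := c) (d := d) (e := ifR e f c d) rfl rfl rfl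
    exact ⟨h.1, h.2.1, fun x => wp_mono (fun _ h => ⟨h.1, t₁ _ _ h.2⟩) (ihc (h.2.2.1 x)),
      fun x => wp_mono (fun _ h => ⟨h.1, t₂ _ _ h.2⟩) (ihd (h.2.2.2 x))⟩
  | loop x y c ih =>
    rintro Q s ⟨hB, I, h0, h1, h2⟩
    refine ⟨hB, fun j s' => I j s' ∧ (loop x y c).Frame s s', ⟨h0, ?_⟩, ?_, ?_⟩
    · refine ⟨fun z hz => ?_, fun _ => rfl, fun _ => rfl⟩
      simp only [writes, List.mem_cons, not_or] at hz
      simp [hz]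
    · rintro j s' hj ⟨hI, hF⟩ hx hy
      refine wp_mono ?_ (ih (h1 j s' hj hI hx hy))
      rintro s'' ⟨h₁, h₂⟩
      refine ⟨h₁, ⟨fun z hz => ?_, fun h => ?_, fun h => ?_⟩⟩
      · have hz' := hz
        simp only [writes, List.mem_cons, not_or] at hz
        simp [hz, h₂.var z hz.2, hF.var z hz']
      · simp [h₂.mem h, hF.mem h]
      · simp [h₂.rmem h, hF.rmem h]
    · exact fun s' h hx => ⟨h2 s' h.1 hx, h.2⟩

theorem wp_conseq {c : Cmd} {Q R : HS → Prop} {s : HS} (h : c.wp L W B Q s)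
    (h' : ∀ s', Q s' → c.Frame s s' → R s') : c.wp L W B R s :=
  wp_mono (fun s' h => h' s' h.1 h.2) (wp_frame h)

theorem wp_seq {c d : Cmd} {Q : HS → Prop} {s : HS} {R : HS → Prop} (h : c.wp L W B R s)
    (h' : ∀ s', R s' → c.Frame s s' → d.wp L W B Q s') : (c.seq d).wp L W B Q s :=
  wp_conseq (c := c) h h'

/-- The rule for loops. -/
theorem wp_loop {x y : Var} {c : Cmd} {Q : HS → Prop} {s : HS} (I : ℕ → HS → Prop)
    (hB : s.v y ≤ B)
    (hI : ∀ j s' k, I j s' → I j (s'.set x k)) (h0 : I 0 s)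
    (hs : ∀ j s', j < s.v y → I j s' → s'.v x = j → (loop x y c).Frame s s' →
      c.wp L W B (I (j + 1)) s')
    (hQ : ∀ s', I (s.v y) s' → (loop x y c).Frame s s' → Q s') : (loop x y c).wp L W B Q s := by
  refine wp_conseq (Q := fun s' => I (s.v y) s')
    ⟨hB, fun j s' => I j s' ∧ (loop x y c).Frame s s', ⟨hI _ _ _ h0, ?_⟩, ?_, ?_⟩ hQ
  · refine ⟨fun z hz => ?_, fun _ => rfl, fun _ => rfl⟩
    simp only [writes, List.mem_cons, not_or] at hz
    simp [hz]
  · rintro j s' hj ⟨hI', hF⟩ hx -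
    refine wp_conseq (hs j s' hj hI' hx hF) ?_
    intro s'' h₁ h₂
    refine ⟨hI _ _ _ h₁, ⟨fun z hz => ?_, fun h => ?_, fun h => ?_⟩⟩
    · have hz' := hz
      simp only [writes, List.mem_cons, not_or] at hz
      simp [hz, h₂.var z hz.2, hF.var z hz']
    · simp [h₂.mem h, hF.mem h]
    · simp [h₂.rmem h, hF.rmem h]
  · exact fun s' h _ => h.1

theorem exec_pair {σ : State} {s : HS} (hr : Rep W σ s) {e f : Ex}
    (he : e.Safe L W s) (hf : f.Safe L W s) :
    ∃ σ', Exec L W (.seq (e.code 40) (f.code 41)) σ (e.size + f.size) σ' ∧ Rep W σ' s ∧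
      σ'.reg 40 = e.val s ∧ σ'.reg 41 = f.val s := by
  obtain ⟨σ₁, x₁, r₁, v₁, f₁, g₁⟩ := e.exec (d := 40) hr (by norm_num) he
  obtain ⟨σ₂, x₂, r₂, v₂, f₂, g₂⟩ := f.exec (d := 41) r₁ (by norm_num) hf
  exact ⟨σ₂, .seq x₁ x₂, r₂, (f₂ 40 (by norm_num)).trans v₁, v₂⟩

theorem exec_ite {σ₀ σ : State} {P : Prog} {T t₁ t₂ : ℕ} {b : Test} {p : Prop} {c d : Prog}
    {R : State → Prop} (hx : Exec L W P σ₀ T σ) (hb : b.holds σ ↔ p)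
    (hc : p → ∃ t σ', t ≤ t₁ ∧ Exec L W c σ t σ' ∧ R σ')
    (hd : ¬ p → ∃ t σ', t ≤ t₂ ∧ Exec L W d σ t σ' ∧ R σ') :
    ∃ t σ', t ≤ T + 1 + t₁ + t₂ ∧ Exec L W (.seq P (.ite b c d)) σ₀ t σ' ∧ R σ' := by
  by_cases h : p
  · obtain ⟨t, σ', ht, x, r⟩ := hc h
    exact ⟨_, σ', by omega, .seq hx (.ite_true (hb.2 h) x), r⟩
  · obtain ⟨t, σ', ht, x, r⟩ := hd h
    exact ⟨_, σ', by omega, .seq hx (.ite_false (fun hb' => h (hb.1 hb')) x), r⟩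

/-- The code of a command does what its weakest precondition says. -/
theorem exec {c : Cmd} : ∀ {Q : HS → Prop} {σ : State} {s : HS}, c.Wf → c.wp L W B Q s →
    Rep W σ s → 1 ≤ W →
    ∃ t σ', t ≤ c.time B ∧ Exec L W c.code σ t σ' ∧ ∃ s', Rep W σ' s' ∧ Q s' := by
  induction c with
  | skip => exact fun _ h hr _ => ⟨0, _, le_rfl, .skip _, _, hr, h⟩
  | assign x e =>
    intro Q σ s _ h hr _
    obtain ⟨σ₁, x₁, r₁, v₁, f₁, g₁⟩ := e.exec (d := 40) hr (by norm_num) h.1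
    have hW : e.val s ≤ W := v₁ ▸ r₁.regLe _
    refine ⟨e.size + 1, _, le_rfl, .seq x₁ (.instr ?_), _, r₁.setVar hW, h.2⟩
    simp [Instr.run, State.setReg, v₁, hW]
  | store e f =>
    intro Q σ s _ h hr _
    obtain ⟨σ₁, x₁, r₁, v₁, v₂⟩ := exec_pair hr h.1 h.2.1
    refine ⟨_, _, le_rfl, .seq x₁ (.instr (σ' := { σ₁ with
      mem := Function.update σ₁.mem (e.val s) (f.val s) }) ?_), s.setMem (e.val s) (f.val s), ⟨r₁.reg, ?_, r₁.rmem, r₁.regLe, ?_⟩,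
      h.2.2.2⟩
    · simp [Instr.run, v₁, v₂, h.2.2.1]
    · simp [r₁.mem, HS.setMem]
    · intro a
      simp only [Function.update_apply]
      split_ifs
      exacts [v₂ ▸ r₁.regLe _, r₁.memLe a]
  | rstore e f =>
    intro Q σ s _ h hr _
    obtain ⟨σ₁, x₁, r₁, v₁, f₁⟩ := f.exec (d := 0) hr h.2.1
    obtain ⟨σ₂, x₂, r₂, v₂, f₂, g₂⟩ := e.exec (d := 40) r₁ (by norm_num) h.1
    refine ⟨_, _, le_rfl, .seq (.seq x₁ x₂) (.instr (σ' := { σ₂ with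
      rmem := Function.update σ₂.rmem (e.val s) (f.val s) }) ?_), s.setRMem (e.val s) (f.val s),
      ⟨r₂.reg, r₂.mem, ?_, r₂.regLe, r₂.memLe⟩, h.2.2.2⟩
    · simp [Instr.run, v₂, g₂, v₁, h.2.2.1]
    · simp [r₂.rmem, HS.setRMem]
  | seq c d ihc ihd =>
    intro Q σ s hwf h hr hW
    obtain ⟨t₁, σ₁, ht₁, x₁, s₁, r₁, h₁⟩ := ihc hwf.1 h hr hW
    obtain ⟨t₂, σ₂, ht₂, x₂, s₂, r₂, h₂⟩ := ihd hwf.2 h₁ r₁ hW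
    exact ⟨_, σ₂, Nat.add_le_add ht₁ ht₂, .seq x₁ x₂, s₂, r₂, h₂⟩
  | ifLt e f c d ihc ihd =>
    intro Q σ s hwf h hr hW
    obtain ⟨σ₁, x₁, r₁, v₁, v₂⟩ := exec_pair hr h.1 h.2.1
    exact exec_ite x₁ (by simp [Test.holds, v₁, v₂]) (fun hp => ihc hwf.1 (h.2.2.1 hp) r₁ hW)
      (fun hp => ihd hwf.2 (h.2.2.2 hp) r₁ hW)
  | ifEq e f c d ihc ihd =>
    intro Q σ s hwf h hr hW
    obtain ⟨σ₁, x₁, r₁, v₁, v₂⟩ := exec_pair hr h.1 h.2.1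
    exact exec_ite x₁ (by simp [Test.holds, v₁, v₂]) (fun hp => ihc hwf.1 (h.2.2.1 hp) r₁ hW)
      (fun hp => ihd hwf.2 (h.2.2.2 hp) r₁ hW)
  | ifR e f c d ihc ihd =>
    intro Q σ s hwf h hr hW
    obtain ⟨σ₁, x₁, r₁, v₁, f₁⟩ := e.exec (d := 0) hr h.1
    obtain ⟨σ₂, x₂, r₂, v₂, f₂⟩ := f.exec (d := 1) r₁ h.2.1
    exact exec_ite (.seq x₁ x₂) (by simp [Test.holds, v₁, v₂, f₂])
      (fun hp => ihc hwf.1 (h.2.2.1 hp) r₂ hW) (fun hp => ihd hwf.2 (h.2.2.2 hp) r₂ hW)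
  | loop x y c ih =>
    rintro Q σ s ⟨hxy, hx, hy, hwf⟩ ⟨hB, I, h0, h1, h2⟩ hr hW
    -- Here `k` counts the remaining iterations. Each costs the body and three steps (test, loading
    -- 1, incrementing); the final failing test is the extra 1.
    have body : ∀ k j σ' s', j + k = s.v y → I j s' → s'.v x = j → s'.v y = s.v y → Rep W σ' s' →
        ∃ t σ'', t ≤ k * (c.time B + 3) + 1 ∧ Exec L W (.while (.lt x.idx y.idx)
          (.seq c.code (.seq (.instr (.const 40 1)) (.instr (.add x.idx x.idx 40))))) σ' t σ'' ∧
          ∃ s'', Rep W σ'' s'' ∧ Q s'' := by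
      intro k
      induction k with
      | zero =>
        intro j σ' s' hj hI hsx hsy hr'
        refine ⟨1, σ', by omega, .while_false ?_, s', hr', h2 s' ?_ ?_⟩
        · simp only [Test.holds, hr'.reg]; omega
        · rw [← hj]; exact hI
        · omega
      | succ k ihk =>
        intro j σ' s' hj hI hsx hsy hr'
        obtain ⟨t₁, σ₁, ht₁, x₁, s₁, r₁, h₁, hF⟩ := ih hwf
          (wp_frame (h1 j s' (by omega) hI hsx hsy)) hr' hW
        have hxj : s₁.v x = j := (hF.var x hx).trans hsx
        have hyj : s₁.v y = s.v y := (hF.var y hy).trans hsy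
        -- The loop bound is itself a word in a register, so the incremented counter, which does not
        -- exceed it, is a word too.
        have hyW : s.v y ≤ W := by rw [← hyj, ← r₁.reg]; exact r₁.regLe _
        have r₂ := r₁.setReg (d := 40) (k := 1) (by norm_num) hW
        have r₃ := r₂.setVar (x := x) (k := j + 1) (by omega)
        obtain ⟨t₄, σ₄, ht₄, x₄, h₄⟩ := ihk (j + 1) _ _ (by omega) h₁ (by simp)
          (by simp [hxy.symm, hyj]) r₃
        refine ⟨_, σ₄, ?_, .while_true ?_ (.seq x₁ (.seq
          (.instr (σ' := { σ₁ with reg := Function.update σ₁.reg 40 1 }) ?_) (.instr ?_))) x₄, h₄⟩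
        · rw [Nat.succ_mul]; omega
        · simp only [Test.holds, hr'.reg]; omega
        · simp [Instr.run, State.setReg, hW]
        · have := x.idx_lt
          simp only [Instr.run, State.setReg]
          simp [show x.idx ≠ 40 by omega, r₁.reg, hxj,
            show j + 1 ≤ W by omega]
    have r₀ := hr.setVar (x := x) (k := 0) (Nat.zero_le _)
    obtain ⟨t, σ', ht, x', h'⟩ := body (s.v y) 0 _ _ (by simp) h0 (by simp) (by simp [hxy.symm]) r₀
    refine ⟨1 + t, σ', ?_, .seq (.instr ?_) x', h'⟩
    · have : s.v y * (c.time B + 3) ≤ B * (c.time B + 3) := Nat.mul_le_mul_right _ hB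
      simp only [time]; omega
    · simp [Instr.run, State.setReg]

end Cmd

/-! ### Partial placements -/

/-- An instance after sorting: vertices `0, …, n - 1`, edges `tl j → hd j` for `j < m`, and the point
`(px r, py r)` of rank `r` for `1 ≤ r ≤ n`. -/
structure Problem where
  n : ℕ
  m : ℕ
  tl : ℕ → ℕ
  hd : ℕ → ℕ
  px : ℕ → ℝ
  py : ℕ → ℝ

namespace Problem

variable (K : Problem)

/-- The horizontal distance between the segments `a b` and `c d` at the height of `z`, multiplied by
the heights of both segments. -/
def gap (a b c d z : ℕ) : ℝ :=
  (K.px a * (K.py b - K.py a) + (K.py z - K.py a) * (K.px b - K.px a)) * (K.py d - K.py c) -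
    (K.px c * (K.py d - K.py c) + (K.py z - K.py c) * (K.px d - K.px c)) * (K.py b - K.py a)

/-- The segments `a b` and `c d`, which overlap vertically, do not cross. -/
def Ok (a b c d : ℕ) : Prop :=
  -- At a common end point the gap vanishes; it is then evaluated at the other end of the overlap
  -- instead, so that the product becomes a square and only tests for nonzero.
  0 < K.gap a b c d (if a = c then min b d else max a c) *
    K.gap a b c d (if b = d then max a c else min b d)

/-! A partial placement is a function `x`. The number `x n` is the level: the ranks below it have been
filled. For a vertex `v`, the value `x v` is `0` if `v` and its out-neighbours have been placed, the
rank of `v` if `v` is another placed vertex or has been promised a rank, and `n + 1` otherwise. -/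

/-- The last of the first `j` edges from a placed vertex to a vertex without a rank determines the
next vertex that is promised a rank; `n` if there is none. -/
def pickUpTo (x : ℕ → ℕ) : ℕ → ℕ
  | 0 => K.n
  | j + 1 => if x (K.tl j) < x K.n ∧ x (K.hd j) = K.n + 1 then K.hd j else pickUpTo x j

/-- The vertex that is promised a rank next. -/
def pick (x : ℕ → ℕ) : ℕ := K.pickUpTo x K.m

/-- Forget the ranks of the placed vertices that have no out-neighbour that is not placed. -/
def forget (x : ℕ → ℕ) (v : ℕ) : ℕ :=
  open Classical in
  if v < K.n ∧ x v < x K.n ∧ ∀ j < K.m, K.tl j = v → x (K.hd j) < x K.n then 0 else x v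

/-- The successors of a partial placement: either promise the rank `p + 1` to the next vertex that
needs a rank, or place a vertex. -/
def next (x : ℕ → ℕ) (p : ℕ) : ℕ → ℕ :=
  if K.pick x < K.n then Function.update x (K.pick x) (p + 1)
  else K.forget (Function.update x K.n (x K.n + 1))

/-- The edge `j` leads from a placed vertex to a vertex that has been promised a rank. -/
def Cut (x : ℕ → ℕ) (j : ℕ) : Prop :=
  x (K.tl j) < x K.n ∧ x K.n ≤ x (K.hd j) ∧ x (K.hd j) ≤ K.n

/-- The edges of the cut do not cross. -/
def Planar (x : ℕ → ℕ) : Prop :=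
  ∀ j < K.m, K.Cut x j → ∀ j' < K.m, K.Cut x j' → j ≠ j' →
    K.Ok (x (K.tl j)) (x (K.hd j)) (x (K.tl j')) (x (K.hd j'))

/-- The step from `x` to `K.next x p` is admissible, apart from crossings. -/
def Fair (x : ℕ → ℕ) (p : ℕ) : Prop :=
  -- Forgotten ranks need no test for a clash: they lie below the level.
  if K.pick x < K.n then x K.n ≤ p + 1 ∧ ∀ v < K.n, x v ≠ p + 1
  else ∀ j < K.m, x (K.hd j) = x K.n → x (K.tl j) < x K.n

/-- The step from `x` to `K.next x p` is admissible. -/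
def Good (x : ℕ → ℕ) (p : ℕ) : Prop := K.Fair x p ∧ K.Planar (K.next x p)

/-- The next rank can still be filled. -/
def Alive (x : ℕ → ℕ) : Prop :=
  ∃ j < K.m, x (K.tl j) < x K.n ∧ (x (K.hd j) = K.n + 1 ∨ x (K.hd j) = x K.n)

end Problem

/-! ### The program for one step -/

/-- The memory is large enough for the work array, and words are large enough for addresses. -/
structure Problem.Fits (K : Problem) (L W B : ℕ) : Prop where
  tl : ∀ j < K.m, K.tl j < K.n
  hd : ∀ j < K.m, K.hd j < K.n
  pos : 1 ≤ K.n
  mem : 2 * K.m + 4 * K.n + 4 ≤ L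
  word : L ≤ W
  loop : K.m + K.n + 1 ≤ B

/-- The machine holds the instance `K`. -/
structure Env (K : Problem) (s : HS) : Prop where
  n : s.v .n = K.n
  m : s.v .m = K.m
  n1 : s.v .n1 = K.n + 1
  -- Word memory: edges from 0, point indices by rank from `A + 1`, the work array of length n + 1
  -- from `X`, then records of length `S` from `Bs`. The offset n in `A` keeps the point indices
  -- clear of the cells 0, …, n - 1, which the output overwrites.
  A : s.v .A = 2 * K.m + K.n
  X : s.v .X = 2 * K.m + 2 * K.n + 1
  Bs : s.v .Bs = 2 * K.m + 3 * K.n + 2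
  S : s.v .S = K.n + 2
  zero : s.v .zero = 0
  tl : ∀ j < K.m, s.mem (2 * j) = K.tl j
  hd : ∀ j < K.m, s.mem (2 * j + 1) = K.hd j
  px : ∀ r ≤ K.n, s.rmem (2 * K.n + 2 * r) = K.px r
  py : ∀ r ≤ K.n, s.rmem (2 * K.n + 2 * r + 1) = K.py r

/-- The variables that hold the parameters of the instance. -/
def envVars : List Var := [.n, .m, .n1, .A, .X, .Bs, .S, .zero]

theorem Env.congr {K : Problem} {s s' : HS} (E : Env K s) (hv : ∀ x ∈ envVars, s'.v x = s.v x)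
    (hm : ∀ a < 2 * K.m, s'.mem a = s.mem a) (hr : s'.rmem = s.rmem) : Env K s' where
  n := (hv _ (by decide)).trans E.n
  m := (hv _ (by decide)).trans E.m
  n1 := (hv _ (by decide)).trans E.n1
  A := (hv _ (by decide)).trans E.A
  X := (hv _ (by decide)).trans E.X
  Bs := (hv _ (by decide)).trans E.Bs
  S := (hv _ (by decide)).trans E.S
  zero := (hv _ (by decide)).trans E.zero
  tl j hj := (hm _ (by omega)).trans (E.tl j hj)
  hd j hj := (hm _ (by omega)).trans (E.hd j hj)
  px r h := hr ▸ E.px r h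
  py r h := hr ▸ E.py r h

theorem Env.set {K : Problem} {s : HS} (E : Env K s) {x : Var} {k : ℕ} (h : x ∉ envVars) :
    Env K (s.set x k) :=
  E.congr (fun y hy => by simp [show y ≠ x from fun e => h (e ▸ hy)]) (fun _ _ => rfl) rfl

theorem Env.setMem {K : Problem} {s : HS} (E : Env K s) {a k : ℕ} (h : 2 * K.m ≤ a) :
    Env K (s.setMem a k) :=
  E.congr (fun y hy => rfl) (fun b hb => by simp [show b ≠ a by omega]) rfl

theorem Env.frame {K : Problem} {s s' : HS} (E : Env K s) {c : Cmd} (F : c.Frame s s')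
    (hv : ∀ x ∈ envVars, x ∉ c.writes) (hm : ∀ a < 2 * K.m, s'.mem a = s.mem a)
    (hr : c.noRStore = true) : Env K s' :=
  E.congr (fun x hx => F.var x (hv x hx)) hm (F.rmem hr)

theorem Env.frame' {K : Problem} {s s' : HS} (E : Env K s) {c : Cmd} (F : c.Frame s s')
    (hv : ∀ x ∈ envVars, x ∉ c.writes) (hm : c.noStore = true)
    (hr : c.noRStore = true) : Env K s' :=
  E.frame F hv (fun a _ => by rw [F.mem hm]) hr

/-- The work array. -/
def Problem.arr (K : Problem) (s : HS) (j : ℕ) : ℕ :=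
  -- Extension by zero makes work arrays, stored keys and abstract placements comparable as
  -- functions.
  if j ≤ K.n then s.mem (2 * K.m + 2 * K.n + 1 + j) else 0

theorem Problem.arr_congr (K : Problem) {s s' : HS} (h : s'.mem = s.mem) : K.arr s' = K.arr s := by
  funext j; simp [Problem.arr, h]

theorem Problem.arr_set (K : Problem) {s : HS} (x : Var) (k : ℕ) : K.arr (s.set x k) = K.arr s := rfl

theorem Problem.arr_setMem (K : Problem) {s : HS} {v k : ℕ} (h : v ≤ K.n) :
    K.arr (s.setMem (2 * K.m + 2 * K.n + 1 + v) k) = Function.update (K.arr s) v k := by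
  funext j
  by_cases hj : j = v
  · simp [Problem.arr, hj, h]
  · simp [Problem.arr, hj]

namespace Ex

/-- The entry `e` of the work array. -/
def xAt (e : Ex) : Ex := .get (.add (.var .X) e)

/-- The tail of the edge `y`. -/
def tlE (y : Var) : Ex := .get (.mul (.lit 2) (.var y))

/-- The head of the edge `y`. -/
def hdE (y : Var) : Ex := .get (.add (.mul (.lit 2) (.var y)) (.lit 1))

/-- The entry of the tail of the edge `y`. -/
def xTl (y : Var) : Ex := xAt (tlE y)

/-- The entry of the head of the edge `y`. -/
def xHd (y : Var) : Ex := xAt (hdE y)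

variable {K : Problem} {L W B : ℕ} {s : HS}

theorem xAt_val (E : Env K s) {e : Ex} (h : e.val s ≤ K.n) : (xAt e).val s = K.arr s (e.val s) := by
  simp [xAt, E.X, Problem.arr, h]

theorem xAt_safe (E : Env K s) (H : K.Fits L W B) {e : Ex} (hs : e.Safe L W s)
    (h : e.val s ≤ K.n) : (xAt e).Safe L W s := by
  have := H.mem; have := H.word
  simp only [xAt, Safe, val, E.X]
  exact ⟨⟨trivial, hs, by omega⟩, by omega⟩

variable {y : Var}

theorem tlE_val (E : Env K s) (h : s.v y < K.m) : (tlE y).val s = K.tl (s.v y) := by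
  simp [tlE, E.tl _ h]

theorem hdE_val (E : Env K s) (h : s.v y < K.m) : (hdE y).val s = K.hd (s.v y) := by
  simp [hdE, E.hd _ h]

theorem tlE_safe (H : K.Fits L W B) (h : s.v y < K.m) : (tlE y).Safe L W s := by
  have := H.mem; have := H.word
  simp only [tlE, Safe, val, true_and]
  omega

theorem hdE_safe (H : K.Fits L W B) (h : s.v y < K.m) : (hdE y).Safe L W s := by
  have := H.mem; have := H.word
  simp only [hdE, Safe, val, true_and]
  omega

theorem xTl_val (E : Env K s) (H : K.Fits L W B) (h : s.v y < K.m) :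
    (xTl y).val s = K.arr s (K.tl (s.v y)) := by
  have := tlE_val E h
  rw [xTl, xAt_val E (by rw [this]; exact (H.tl _ h).le), this]

theorem xHd_val (E : Env K s) (H : K.Fits L W B) (h : s.v y < K.m) :
    (xHd y).val s = K.arr s (K.hd (s.v y)) := by
  have := hdE_val E h
  rw [xHd, xAt_val E (by rw [this]; exact (H.hd _ h).le), this]

theorem xTl_safe (E : Env K s) (H : K.Fits L W B) (h : s.v y < K.m) : (xTl y).Safe L W s :=
  xAt_safe E H (tlE_safe H h) (by rw [tlE_val E h]; exact (H.tl _ h).le)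

theorem xHd_safe (E : Env K s) (H : K.Fits L W B) (h : s.v y < K.m) : (xHd y).Safe L W s :=
  xAt_safe E H (hdE_safe H h) (by rw [hdE_val E h]; exact (H.hd _ h).le)

end Ex

infixr:60 " ;; " => Cmd.seq

namespace Cmd

open Ex

/-- Find the vertex that is promised a rank next. -/
def pickC : Cmd :=
  assign .w (var .n) ;;
  loop .j .m (ifLt (xTl .j) (var .lvl)
    (ifEq (xHd .j) (var .n1) (assign .w (hdE .j)) skip) skip)

/-- Promise the rank `p + 1` to the vertex `w`. -/
def promiseC : Cmd :=
  ifLt (add (var .p) (lit 1)) (var .lvl) (assign .flag (lit 0)) skip ;;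
  loop .v .n (ifEq (xAt (var .v)) (add (var .p) (lit 1)) (assign .flag (lit 0)) skip) ;;
  store (add (var .X) (var .w)) (add (var .p) (lit 1))

/-- Check that all in-neighbours of the vertex to be placed have been placed. -/
def inCheckC : Cmd :=
  loop .j .m (ifEq (xHd .j) (var .lvl)
    (ifLt (xTl .j) (var .lvl) skip (assign .flag (lit 0))) skip)

/-- Test whether the vertex `v` has an out-neighbour that is not placed. -/
def outCheckC : Cmd :=
  assign .g (lit 0) ;;
  loop .j .m (ifEq (tlE .j) (var .v) (ifLt (xHd .j) (var .lvl) skip (assign .g (lit 1))) skip)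

/-- Forget the ranks that are not needed any more. -/
def forgetC : Cmd :=
  loop .v .n (ifLt (xAt (var .v)) (var .lvl)
    (outCheckC ;; ifEq (var .g) (lit 0) (store (add (var .X) (var .v)) (lit 0)) skip) skip)

/-- Place a vertex. -/
def placeC : Cmd :=
  inCheckC ;; assign .lvl (add (var .lvl) (lit 1)) ;;
  store (add (var .X) (var .n)) (var .lvl) ;; forgetC

variable {K : Problem} {L W B : ℕ} {s : HS}

/-- Later hits overwrite earlier ones, which is why the abstract choice takes the last suitable
edge. Any deterministic rule would serve the search. -/
theorem pickC_spec (E : Env K s) (H : K.Fits L W B) (hl : s.v .lvl = K.arr s K.n) :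
    pickC.wp L W B (fun s' => s'.v .w = K.pick (K.arr s)) s := by
  refine ⟨trivial, ?_⟩
  have E' : Env K (s.set .w (s.v .n)) := E.set (by decide)
  have hB := H.loop
  refine wp_loop (fun j s' => s'.v .w = K.pickUpTo (K.arr s) j) (by simp [E.m]; omega) ?_ ?_ ?_ ?_
  · intro j s' k h; simpa using h
  · simp [Problem.pickUpTo, E.n]
  · intro j s' hj hI hjv hF
    have E₁ := E'.frame' hF (by decide) (by decide) (by decide)
    have hj' : s'.v .j < K.m := by simpa [hjv, E.m] using hj
    have ha : K.arr s' = K.arr s := K.arr_congr (hF.mem (by decide))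
    have hl' : s'.v .lvl = K.arr s K.n := by rw [hF.var _ (by decide)]; simpa using hl
    simp only [wp, xTl_val E₁ H hj', xHd_val E₁ H hj', hdE_val E₁ hj', xTl_safe E₁ H hj',
      xHd_safe E₁ H hj', hdE_safe H hj', Ex.val, Ex.Safe, ha, hjv, hl', true_and,
      Problem.pickUpTo, E₁.n1, HS.set_v, if_true]
    exact ⟨fun h₁ => ⟨fun h₂ => by simp [h₁, h₂], fun h₂ => by simp [h₂, hI]⟩,
      fun h₁ => by simp [h₁, hI]⟩
  · intro s' h _
    simpa [E.m, Problem.pick] using h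

theorem inCheckC_spec (E : Env K s) (H : K.Fits L W B) (hl : s.v .lvl = K.arr s K.n) :
    inCheckC.wp L W B (fun s' => s'.v .flag = 1 ↔ s.v .flag = 1 ∧
      ∀ j < K.m, K.arr s (K.hd j) = K.arr s K.n → K.arr s (K.tl j) < K.arr s K.n) s := by
  have hB := H.loop
  refine wp_loop (fun i s' => s'.v .flag = 1 ↔ s.v .flag = 1 ∧
      ∀ j < i, K.arr s (K.hd j) = K.arr s K.n → K.arr s (K.tl j) < K.arr s K.n)
      (by simp [E.m]; omega) ?_ ?_ ?_ ?_
  · intro j s' k h; simpa using h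
  · simp
  · intro j s' hj hI hjv hF
    have E₁ := E.frame' hF (by decide) (by decide) (by decide)
    have hj' : s'.v .j < K.m := by simpa [hjv, E.m] using hj
    have ha : K.arr s' = K.arr s := K.arr_congr (hF.mem (by decide))
    have hl' : s'.v .lvl = K.arr s K.n := by rw [hF.var _ (by decide)]; simpa using hl
    simp only [wp, xTl_val E₁ H hj', xHd_val E₁ H hj', xTl_safe E₁ H hj',
      xHd_safe E₁ H hj', Ex.val, Ex.Safe, ha, hjv, hl', true_and, HS.set_v, if_true,
      Nat.forall_lt_succ_right, hI, Nat.zero_le]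
    refine ⟨fun h₁ => ⟨fun h₂ => by simp [h₂], fun h₂ => ?_⟩, fun h₁ => by simp [h₁]⟩
    simp [h₁, h₂]
  · intro s' h _
    simpa [E.m] using h

theorem outCheckC_spec (E : Env K s) (H : K.Fits L W B) (hl : s.v .lvl = K.arr s K.n) :
    outCheckC.wp L W B (fun s' => s'.v .g = 0 ↔
      ∀ j < K.m, K.tl j = s.v .v → K.arr s (K.hd j) < K.arr s K.n) s := by
  have hB := H.loop
  have hW := H.word; have hL := H.mem
  refine ⟨Nat.zero_le _, ?_⟩
  refine wp_loop (fun i s' => s'.v .g = 0 ↔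
      ∀ j < i, K.tl j = s.v .v → K.arr s (K.hd j) < K.arr s K.n)
      (by simp [E.m]; omega) ?_ ?_ ?_ ?_
  · intro j s' k h; simpa using h
  · simp
  · intro j s' hj hI hjv hF
    have E₁ := (E.set (x := .g) (k := 0) (by decide)).frame' hF (by decide) (by decide) (by decide)
    have hj' : s'.v .j < K.m := by simpa [hjv, E.m] using hj
    have ha : K.arr s' = K.arr s := K.arr_congr (hF.mem (by decide))
    have hl' : s'.v .lvl = K.arr s K.n := by rw [hF.var _ (by decide)]; simpa using hl
    have hv' : s'.v .v = s.v .v := by rw [hF.var _ (by decide)]; simp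
    simp only [wp, tlE_val E₁ hj', xHd_val E₁ H hj', tlE_safe H hj',
      xHd_safe E₁ H hj', Ex.val, Ex.Safe, ha, hjv, hl', hv', true_and, HS.set_v, if_true,
      Nat.forall_lt_succ_right, hI]
    refine ⟨fun h₁ => ⟨fun h₂ => by simp [h₂], fun h₂ => ⟨by omega, ?_⟩⟩, fun h₁ => by simp [h₁]⟩
    simp [h₁, h₂]
  · intro s' h _
    simpa [E.m] using h

/-- Only the work array has changed. -/
def OnlyArr (K : Problem) (s s' : HS) : Prop :=
  ∀ a, (a < 2 * K.m + 2 * K.n + 1 ∨ 2 * K.m + 3 * K.n + 1 < a) → s'.mem a = s.mem a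

theorem OnlyArr.refl (s : HS) : OnlyArr K s s := fun _ _ => rfl

theorem OnlyArr.trans {s s' s'' : HS} (h : OnlyArr K s s') (h' : OnlyArr K s' s'') :
    OnlyArr K s s'' := fun a ha => (h' a ha).trans (h a ha)

theorem OnlyArr.of_mem {s s' : HS} (h : s'.mem = s.mem) : OnlyArr K s s' := fun a _ => by rw [h]

theorem OnlyArr.setMem (s : HS) {v : ℕ} (hv : v ≤ K.n) (k : ℕ) :
    OnlyArr K s (s.setMem (2 * K.m + 2 * K.n + 1 + v) k) := fun a ha => by
  rw [HS.setMem_mem, if_neg (by omega)]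

theorem Env.onlyArr {s s' : HS} (E : Env K s) {c : Cmd} (F : c.Frame s s')
    (hv : ∀ x ∈ envVars, x ∉ c.writes) (hm : OnlyArr K s s') (hr : c.noRStore = true) : Env K s' :=
  E.frame F hv (fun a _ => hm a (by omega)) hr

theorem forgetC_spec (E : Env K s) (H : K.Fits L W B) (hl : s.v .lvl = K.arr s K.n) :
    forgetC.wp L W B (fun s' => K.arr s' = K.forget (K.arr s) ∧ OnlyArr K s s') s := by
  classical
  have hB := H.loop
  have hW := H.word; have hL := H.mem
  refine wp_loop (fun i s' => K.arr s' = (fun v => if v < i then K.forget (K.arr s) v else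
    K.arr s v) ∧ OnlyArr K s s') (by simp [E.n]; omega) ?_ ?_ ?_ ?_
  · intro j s' k h; exact h
  · exact ⟨by simp, OnlyArr.refl s⟩
  · rintro i s' hi ⟨hI, hO⟩ hiv hF
    have E₁ : Env K s' := Env.onlyArr E hF (by decide) hO (by decide)
    have hi' : i < K.n := by simpa [E.n] using hi
    have hl' : s'.v .lvl = K.arr s K.n := by rw [hF.var _ (by decide)]; simpa using hl
    -- The array is overwritten in place, but only entries below the level are replaced, and by 0,
    -- which is below the level as well. Later comparisons with the level come out as for the
    -- original array.
    have hlow : ∀ u, K.arr s' u < K.arr s K.n ↔ K.arr s u < K.arr s K.n := by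
      intro u
      rw [hI]
      dsimp only
      split_ifs with h
      · rw [Problem.forget]; split_ifs with h'
        · constructor <;> intro <;> omega
        · rfl
      · rfl
    have hn : K.arr s' K.n = K.arr s K.n := by
      rw [hI]; dsimp only; split_ifs <;> simp [Problem.forget]
    have hxi : K.arr s' i = K.arr s i := by simp [hI]
    have upd : ∀ k, k = K.forget (K.arr s) i → Function.update (K.arr s') i k =
        fun v => if v < i + 1 then K.forget (K.arr s) v else K.arr s v := by
      intro k hk
      funext v
      by_cases hv : v = i
      · simp [hv, hk]
      · rw [Function.update_of_ne hv, hI]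
        simp only [show v < i + 1 ↔ v < i by omega]
    have same : K.arr s i = K.forget (K.arr s) i → K.arr s' =
        fun v => if v < i + 1 then K.forget (K.arr s) v else K.arr s v := by
      intro hk; rw [← upd _ hk, ← hxi, Function.update_eq_self]
    simp only [wp]
    refine ⟨xAt_safe E₁ H trivial (by simp [hiv, hi'.le]), trivial, ?_, ?_⟩
    · rw [xAt_val E₁ (by simp [hiv, hi'.le])]
      simp only [Ex.val, hiv, hl', hxi]
      intro hlt
      refine wp_conseq (outCheckC_spec E₁ H (hl'.trans hn.symm)) ?_
      intro s₁ hg hF₁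
      have E₂ := E₁.frame' hF₁ (by decide) (by decide) (by decide)
      have ha : K.arr s₁ = K.arr s' := K.arr_congr (hF₁.mem (by decide))
      have hO₁ : OnlyArr K s s₁ := hO.trans (.of_mem (hF₁.mem (by decide)))
      have hv₁ : s₁.v .v = i := (hF₁.var _ (by decide)).trans hiv
      rw [hiv] at hg
      simp only [hn, hlow] at hg
      simp only [Ex.val, Ex.Safe, E₂.X, hv₁]
      refine ⟨trivial, Nat.zero_le _, fun h0 => ⟨⟨trivial, trivial, by omega⟩, Nat.zero_le _,
        by omega, ?_, hO₁.trans (.setMem _ hi'.le _)⟩, fun h0 => ⟨?_, hO₁⟩⟩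
      · rw [K.arr_setMem hi'.le, ha]
        refine upd _ ?_
        rw [Problem.forget, if_pos ⟨hi', hlt, hg.1 h0⟩]
      · rw [ha]
        refine same ?_
        rw [Problem.forget, if_neg (fun h => h0 (hg.2 h.2.2))]
    · rw [xAt_val E₁ (by simp [hiv, hi'.le])]
      simp only [Ex.val, hiv, hl', hxi]
      exact fun h => ⟨same (by rw [Problem.forget, if_neg (fun h' => h h'.2.1)]), hO⟩
  · rintro s' ⟨h, hO⟩ _
    refine ⟨?_, hO⟩
    rw [h, E.n]
    funext v
    split_ifs with hv
    · rfl
    · rw [Problem.forget, if_neg (fun h => hv h.1)]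

theorem promiseC_spec (E : Env K s) (H : K.Fits L W B) (hl : s.v .lvl = K.arr s K.n)
    (hw : s.v .w < K.n) (hp : s.v .p < K.n) :
    promiseC.wp L W B (fun s' => K.arr s' = Function.update (K.arr s) (s.v .w) (s.v .p + 1) ∧
      OnlyArr K s s' ∧ (s'.v .flag = 1 ↔ s.v .flag = 1 ∧ K.arr s K.n ≤ s.v .p + 1 ∧
        ∀ v < K.n, K.arr s v ≠ s.v .p + 1)) s := by
  have hB := H.loop
  have hW := H.word; have hL := H.mem
  refine wp_seq (R := fun s' => s'.v .flag = 1 ↔ s.v .flag = 1 ∧ K.arr s K.n ≤ s.v .p + 1) ?_ ?_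
  · simp only [wp, Ex.val, Ex.Safe, true_and, hl]
    refine ⟨by omega, fun h => ⟨Nat.zero_le _, ?_⟩, fun h => ?_⟩
    · simp; omega
    · have : K.arr s K.n ≤ s.v .p + 1 := by omega
      simp [this]
  intro s₁ h₁ F₁
  have E₁ := E.frame' F₁ (by decide) (by decide) (by decide)
  have ha₁ : K.arr s₁ = K.arr s := K.arr_congr (F₁.mem (by decide))
  have hp₁ : s₁.v .p = s.v .p := F₁.var _ (by decide)
  have hw₁ : s₁.v .w = s.v .w := F₁.var _ (by decide)
  change (loop _ _ _).wp L W B (wp L W B (store _ _) _) s₁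
  refine wp_loop (fun i s' => s'.v .flag = 1 ↔ s₁.v .flag = 1 ∧
    ∀ v < i, K.arr s v ≠ s.v .p + 1) (by simp [E₁.n]; omega) ?_ ?_ ?_ ?_
  · intro j s' k h; simpa using h
  · simp
  · intro i s' hi hI hiv hF
    have E₂ := E₁.frame' hF (by decide) (by decide) (by decide)
    have hi' : i < K.n := by simpa [E₁.n] using hi
    have ha : K.arr s' = K.arr s := (K.arr_congr (hF.mem (by decide))).trans ha₁
    have hp₂ : s'.v .p = s.v .p := (hF.var _ (by decide)).trans hp₁
    have hx : (xAt (var .v)).val s' = K.arr s i := by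
      rw [xAt_val E₂ (by simp [hiv, hi'.le]), ha]; simp [hiv]
    simp only [wp, Ex.val, Ex.Safe, hx, xAt_safe E₂ H (e := var .v) trivial (by simp [hiv, hi'.le]),
      true_and, hp₂, Nat.forall_lt_succ_right, hI]
    refine ⟨by omega, fun h => ⟨Nat.zero_le _, ?_⟩, fun h => ?_⟩
    · simp [h]
    · simp [h]
  · intro s₂ h₂ F₂
    have E₂ := E₁.frame' F₂ (by decide) (by decide) (by decide)
    have ha₂ : K.arr s₂ = K.arr s := (K.arr_congr (F₂.mem (by decide))).trans ha₁
    have hp₂ : s₂.v .p = s.v .p := (F₂.var _ (by decide)).trans hp₁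
    have hw₂ : s₂.v .w = s.v .w := (F₂.var _ (by decide)).trans hw₁
    have hm₂ : s₂.mem = s.mem := (F₂.mem (by decide)).trans (F₁.mem (by decide))
    simp only [wp, Ex.val, Ex.Safe, E₂.X, hw₂, hp₂, true_and]
    refine ⟨by omega, by omega, by omega, ?_, (OnlyArr.of_mem hm₂).trans (.setMem _ hw.le _), ?_⟩
    · rw [K.arr_setMem hw.le, ha₂]
    · rw [HS.setMem_v, h₂, h₁, E₁.n]; tauto

theorem placeC_spec (E : Env K s) (H : K.Fits L W B) (hl : s.v .lvl = K.arr s K.n)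
    (hn : K.arr s K.n ≤ K.n) :
    placeC.wp L W B (fun s' =>
      K.arr s' = K.forget (Function.update (K.arr s) K.n (K.arr s K.n + 1)) ∧
      s'.v .lvl = K.arr s' K.n ∧
      OnlyArr K s s' ∧ (s'.v .flag = 1 ↔ s.v .flag = 1 ∧
        ∀ j < K.m, K.arr s (K.hd j) = K.arr s K.n → K.arr s (K.tl j) < K.arr s K.n)) s := by
  have hW := H.word; have hL := H.mem
  refine wp_seq (inCheckC_spec E H hl) ?_
  intro s₁ h₁ F₁
  have E₁ := E.frame' F₁ (by decide) (by decide) (by decide)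
  have ha₁ : K.arr s₁ = K.arr s := K.arr_congr (F₁.mem (by decide))
  have hl₁ : s₁.v .lvl = K.arr s K.n := (F₁.var _ (by decide)).trans hl
  simp only [wp]
  simp only [Ex.val, Ex.Safe, HS.set_v, true_and, hl₁, E₁.X, E₁.n, reduceCtorEq, if_false, if_true]
  refine ⟨by omega, by omega, by omega, ?_⟩
  have E₂ : Env K ((s₁.set .lvl (K.arr s K.n + 1)).setMem (2 * K.m + 2 * K.n + 1 + K.n)
    (K.arr s K.n + 1)) := (E₁.set (by decide)).setMem (by omega)
  have ha₂ : K.arr ((s₁.set .lvl (K.arr s K.n + 1)).setMem (2 * K.m + 2 * K.n + 1 + K.n)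
    (K.arr s K.n + 1)) = Function.update (K.arr s) K.n (K.arr s K.n + 1) := by
    rw [K.arr_setMem le_rfl, K.arr_set, ha₁]
  refine wp_conseq (forgetC_spec E₂ H (by rw [ha₂]; simp)) ?_
  rintro s₃ ⟨h₃, hO⟩ F₃
  have hfl : s₃.v .flag = s₁.v .flag := by rw [F₃.var _ (by decide)]; simp
  refine ⟨by rw [h₃, ha₂], ?_, ?_, by rw [hfl, h₁]⟩
  · rw [F₃.var _ (by decide), h₃, ha₂, Problem.forget, if_neg (by simp)]
    simp
  · refine OnlyArr.trans ?_ hO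
    refine (OnlyArr.of_mem ?_).trans (.setMem _ le_rfl _)
    simpa using F₁.mem (by decide)

end Cmd

/-! ### The crossing test and the program for a complete step -/

namespace RE

/-- The horizontal coordinate of the point of rank `y`. -/
def pxE (y : Var) : RE := .real (.add (.mul (.lit 2) (.var .n)) (.mul (.lit 2) (.var y)))

/-- The vertical coordinate of the point of rank `y`. -/
def pyE (y : Var) : RE :=
  .real (.add (.add (.mul (.lit 2) (.var .n)) (.mul (.lit 2) (.var y))) (.lit 1))

/-- The expression for `Problem.gap`. -/
def gapE (z : Var) : RE :=
  sub
    (mul (add (mul (pxE .a) (sub (pyE .b) (pyE .a)))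
      (mul (sub (pyE z) (pyE .a)) (sub (pxE .b) (pxE .a)))) (sub (pyE .d) (pyE .c)))
    (mul (add (mul (pxE .c) (sub (pyE .d) (pyE .c)))
      (mul (sub (pyE z) (pyE .c)) (sub (pxE .d) (pxE .c)))) (sub (pyE .b) (pyE .a)))

variable {K : Problem} {L W B : ℕ} {s : HS} {y : Var}

theorem pxE_val (E : Env K s) (h : s.v y ≤ K.n) : (pxE y).val s = K.px (s.v y) := by
  simp [pxE, E.n, E.px _ h]

theorem pyE_val (E : Env K s) (h : s.v y ≤ K.n) : (pyE y).val s = K.py (s.v y) := by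
  simp [pyE, E.n, E.py _ h]

theorem pxE_safe (E : Env K s) (H : K.Fits L W B) (h : s.v y ≤ K.n) : (pxE y).Safe L W s := by
  have := H.mem; have := H.word
  simp only [pxE, Safe, Ex.Safe, Ex.val, E.n, true_and]
  omega

theorem pyE_safe (E : Env K s) (H : K.Fits L W B) (h : s.v y ≤ K.n) : (pyE y).Safe L W s := by
  have := H.mem; have := H.word
  simp only [pyE, Safe, Ex.Safe, Ex.val, E.n, true_and]
  omega

end RE

namespace Cmd

open Ex RE

/-- Assign to `z` the smaller one of `x` and `y`. -/
def minC (z x y : Var) : Cmd := ifLt (var x) (var y) (assign z (var x)) (assign z (var y))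

/-- Assign to `z` the larger one of `x` and `y`. -/
def maxC (z x y : Var) : Cmd := ifLt (var x) (var y) (assign z (var y)) (assign z (var x))

/-- Check that the segments `a b` and `c d` do not cross. -/
def okC : Cmd :=
  ifEq (var .a) (var .c) (minC .z1 .b .d) (maxC .z1 .a .c) ;;
  ifEq (var .b) (var .d) (maxC .z2 .a .c) (minC .z2 .b .d) ;;
  ifR .zero (.mul (gapE .z1) (gapE .z2)) skip (assign .flag (lit 0))

/-- Check that the edge `j` does not cross another edge of the cut. -/
def planarInnerC : Cmd :=
  loop .j2 .m (assign .c (xTl .j2) ;; assign .d (xHd .j2) ;;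
    ifLt (var .c) (var .lvl) (ifLt (var .d) (var .lvl) skip (ifLt (var .d) (var .n1)
      (ifEq (var .j) (var .j2) skip okC) skip)) skip)

/-- Check that the edges of the cut do not cross. -/
def planarC : Cmd :=
  loop .j .m (assign .a (xTl .j) ;; assign .b (xHd .j) ;;
    ifLt (var .a) (var .lvl) (ifLt (var .b) (var .lvl) skip (ifLt (var .b) (var .n1)
      planarInnerC skip)) skip)

/-- Test whether the next rank can still be filled. -/
def aliveC : Cmd :=
  assign .g (lit 0) ;;
  loop .j .m (ifLt (xTl .j) (var .lvl) (ifEq (xHd .j) (var .n1) (assign .g (lit 1))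
    (ifEq (xHd .j) (var .lvl) (assign .g (lit 1)) skip)) skip)

/-- Make one step from the partial placement in the work array. -/
def stepC : Cmd :=
  assign .lvl (xAt (var .n)) ;; assign .flag (lit 1) ;; pickC ;;
  ifLt (var .w) (var .n) promiseC placeC ;; planarC

variable {K : Problem} {L W B : ℕ} {s : HS}

theorem minC_spec (z x y : Var) : (minC z x y).wp L W B
    (fun s' => s'.v z = min (s.v x) (s.v y)) s := by
  simp only [minC, wp, Ex.val, Ex.Safe, HS.set_v, if_true, true_and]
  omega

theorem maxC_spec (z x y : Var) : (maxC z x y).wp L W B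
    (fun s' => s'.v z = max (s.v x) (s.v y)) s := by
  simp only [maxC, wp, Ex.val, Ex.Safe, HS.set_v, if_true, true_and]
  omega

theorem okC_spec (E : Env K s) (H : K.Fits L W B) (ha : s.v .a ≤ K.n) (hb : s.v .b ≤ K.n)
    (hc : s.v .c ≤ K.n) (hd : s.v .d ≤ K.n) : okC.wp L W B
    (fun s' => s'.v .flag = 1 ↔ s.v .flag = 1 ∧ K.Ok (s.v .a) (s.v .b) (s.v .c) (s.v .d)) s := by
  refine wp_seq (R := fun s' => s'.v .z1 =
    if s.v .a = s.v .c then min (s.v .b) (s.v .d) else max (s.v .a) (s.v .c)) ?_ ?_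
  · refine ⟨trivial, trivial, fun h => ?_, fun h => ?_⟩ <;> simp only [Ex.val] at h
    · simpa [h] using minC_spec _ _ _
    · simpa [h] using maxC_spec _ _ _
  intro s₁ h₁ F₁
  refine wp_seq (R := fun s' => s'.v .z2 =
    if s.v .b = s.v .d then max (s.v .a) (s.v .c) else min (s.v .b) (s.v .d)) ?_ ?_
  · rw [← F₁.var .a (by decide), ← F₁.var .b (by decide), ← F₁.var .c (by decide),
      ← F₁.var .d (by decide)]
    refine ⟨trivial, trivial, fun h => ?_, fun h => ?_⟩ <;> simp only [Ex.val] at h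
    · simpa [h] using maxC_spec _ _ _
    · simpa [h] using minC_spec _ _ _
  intro s₂ h₂ F₂
  have E₂ := (E.frame' F₁ (by decide) (by decide) (by decide)).frame' F₂ (by decide) (by decide)
    (by decide)
  have ea : s₂.v .a = s.v .a := (F₂.var _ (by decide)).trans (F₁.var _ (by decide))
  have eb : s₂.v .b = s.v .b := (F₂.var _ (by decide)).trans (F₁.var _ (by decide))
  have ec : s₂.v .c = s.v .c := (F₂.var _ (by decide)).trans (F₁.var _ (by decide))
  have ed : s₂.v .d = s.v .d := (F₂.var _ (by decide)).trans (F₁.var _ (by decide))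
  have ef : s₂.v .flag = s.v .flag := (F₂.var _ (by decide)).trans (F₁.var _ (by decide))
  have e1 : s₂.v .z1 = _ := (F₂.var .z1 (by decide)).trans h₁
  have ha' := ea.trans_le ha
  have hb' := eb.trans_le hb
  have hc' := ec.trans_le hc
  have hd' := ed.trans_le hd
  have hz1 : s₂.v .z1 ≤ K.n := by rw [e1]; split_ifs <;> omega
  have hz2 : s₂.v .z2 ≤ K.n := by rw [h₂]; split_ifs <;> omega
  have hg1 : (gapE .z1).val s₂ = K.gap (s.v .a) (s.v .b) (s.v .c) (s.v .d) (s₂.v .z1) := by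
    simp only [gapE, RE.val, pxE_val E₂ ha', pxE_val E₂ hb', pxE_val E₂ hc', pxE_val E₂ hd',
      pyE_val E₂ ha', pyE_val E₂ hb', pyE_val E₂ hc', pyE_val E₂ hd', pyE_val E₂ hz1,
      Problem.gap, ea, eb, ec, ed]
  have hg2 : (gapE .z2).val s₂ = K.gap (s.v .a) (s.v .b) (s.v .c) (s.v .d) (s₂.v .z2) := by
    simp only [gapE, RE.val, pxE_val E₂ ha', pxE_val E₂ hb', pxE_val E₂ hc', pxE_val E₂ hd',
      pyE_val E₂ ha', pyE_val E₂ hb', pyE_val E₂ hc', pyE_val E₂ hd', pyE_val E₂ hz2,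
      Problem.gap, ea, eb, ec, ed]
  refine ⟨trivial, ?_, ?_, ?_⟩
  · simp only [gapE, RE.Safe, pxE_safe E₂ H, pyE_safe E₂ H, ha', hb', hc', hd', hz1, hz2, and_self]
  · simp only [RE.val, hg1, hg2, e1, h₂]
    intro h
    simp [wp, ef, Problem.Ok, h]
  · simp only [RE.val, hg1, hg2, e1, h₂]
    intro h
    simp [wp, Problem.Ok, h]

theorem planarInnerC_spec (E : Env K s) (H : K.Fits L W B) (hl : s.v .lvl = K.arr s K.n)
    (hn : K.arr s K.n ≤ K.n + 1) (ha : s.v .a ≤ K.n) (hb : s.v .b ≤ K.n) : planarInnerC.wp L W B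
    (fun s' => s'.v .flag = 1 ↔ s.v .flag = 1 ∧ ∀ j' < K.m, K.Cut (K.arr s) j' → s.v .j ≠ j' →
      K.Ok (s.v .a) (s.v .b) (K.arr s (K.tl j')) (K.arr s (K.hd j'))) s := by
  have hB := H.loop
  refine wp_loop (fun i s' => s'.v .flag = 1 ↔ s.v .flag = 1 ∧ ∀ j' < i, K.Cut (K.arr s) j' →
      s.v .j ≠ j' → K.Ok (s.v .a) (s.v .b) (K.arr s (K.tl j')) (K.arr s (K.hd j')))
      (by simp [E.m]; omega) ?_ ?_ ?_ ?_
  · intro j s' k h; simpa using h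
  · simp
  · intro i s' hi hI hiv hF
    have E₁ := E.frame' hF (by decide) (by decide) (by decide)
    have hi' : s'.v .j2 < K.m := by simpa [hiv, E.m] using hi
    have hx : K.arr s' = K.arr s := K.arr_congr (hF.mem (by decide))
    have hl' : s'.v .lvl = K.arr s K.n := by rw [hF.var _ (by decide)]; simpa using hl
    refine ⟨xTl_safe E₁ H hi', ?_⟩
    rw [xTl_val E₁ H hi', hx, hiv]
    set s₁ := s'.set .c (K.arr s (K.tl i)) with hs₁
    have E₂ : Env K s₁ := E₁.set (by decide)
    have hi₁ : s₁.v .j2 < K.m := by simpa [hs₁] using hi'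
    have hx₁ : K.arr s₁ = K.arr s := hx
    refine ⟨xHd_safe E₂ H hi₁, ?_⟩
    rw [xHd_val E₂ H hi₁, hx₁, show s₁.v .j2 = i by simp [hs₁, hiv]]
    set s₂ := s₁.set .d (K.arr s (K.hd i)) with hs₂
    have E₃ : Env K s₂ := E₂.set (by decide)
    have vc : s₂.v .c = K.arr s (K.tl i) := by simp [hs₂, hs₁]
    have vd : s₂.v .d = K.arr s (K.hd i) := by simp [hs₂]
    have vl : s₂.v .lvl = K.arr s K.n := by simp [hs₂, hs₁, hl']
    have va : s₂.v .a = s.v .a := by simp [hs₂, hs₁, hF.var .a (by decide)]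
    have vb : s₂.v .b = s.v .b := by simp [hs₂, hs₁, hF.var .b (by decide)]
    have vj : s₂.v .j = s.v .j := by simp [hs₂, hs₁, hF.var .j (by decide)]
    have vj2 : s₂.v .j2 = i := by simp [hs₂, hs₁, hiv]
    have vf : s₂.v .flag = s'.v .flag := by simp [hs₂, hs₁]
    have irrel : ¬ (K.Cut (K.arr s) i ∧ s.v .j ≠ i) → (s₂.v .flag = 1 ↔ s.v .flag = 1 ∧
        ∀ j' < i + 1, K.Cut (K.arr s) j' →
      s.v .j ≠ j' → K.Ok (s.v .a) (s.v .b) (K.arr s (K.tl j')) (K.arr s (K.hd j'))) := by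
      intro h
      rw [vf, hI, Nat.forall_lt_succ_right]
      exact ⟨fun h' => ⟨h'.1, h'.2, fun h₁ h₂ => absurd ⟨h₁, h₂⟩ h⟩, fun h' => ⟨h'.1, h'.2.1⟩⟩
    simp only [wp, Ex.val, Ex.Safe, true_and, vc, vd, vl, vj, vj2, E₃.n1]
    refine ⟨fun h₁ => ⟨fun h₂ => irrel fun h => ?_, fun h₂ => ⟨fun h₃ => ⟨fun h₄ => irrel fun h => ?_,
      fun h₄ => ?_⟩, fun h₃ => irrel fun h => ?_⟩⟩, fun h₁ => irrel fun h => ?_⟩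
    · have := h.1.2.1; omega
    · exact h.2 h₄
    · refine wp_mono ?_ (okC_spec E₃ H (va.trans_le ha) (vb.trans_le hb) (by omega) (by omega))
      intro s₃ h₃
      have : K.Cut (K.arr s) i := ⟨h₁, by omega, by omega⟩
      rw [h₃, vf, hI, Nat.forall_lt_succ_right, va, vb, vc, vd, and_assoc,
        forall_prop_of_true this, forall_prop_of_true h₄]
    · have := h.1.2.2; omega
    · exact h₁ h.1.1
  · intro s' h _
    simpa [E.m] using h

theorem planarC_spec (E : Env K s) (H : K.Fits L W B) (hl : s.v .lvl = K.arr s K.n)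
    (hn : K.arr s K.n ≤ K.n + 1) : planarC.wp L W B
    (fun s' => s'.v .flag = 1 ↔ s.v .flag = 1 ∧ K.Planar (K.arr s)) s := by
  have hB := H.loop
  refine wp_loop (fun i s' => s'.v .flag = 1 ↔ s.v .flag = 1 ∧ ∀ j < i, K.Cut (K.arr s) j →
      ∀ j' < K.m, K.Cut (K.arr s) j' → j ≠ j' → K.Ok (K.arr s (K.tl j)) (K.arr s (K.hd j))
        (K.arr s (K.tl j')) (K.arr s (K.hd j')))
      (by simp [E.m]; omega) ?_ ?_ ?_ ?_
  · intro j s' k h; simpa using h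
  · simp
  · intro i s' hi hI hiv hF
    have E₁ := E.frame' hF (by decide) (by decide) (by decide)
    have hi' : s'.v .j < K.m := by simpa [hiv, E.m] using hi
    have hx : K.arr s' = K.arr s := K.arr_congr (hF.mem (by decide))
    have hl' : s'.v .lvl = K.arr s K.n := by rw [hF.var _ (by decide)]; simpa using hl
    refine ⟨xTl_safe E₁ H hi', ?_⟩
    rw [xTl_val E₁ H hi', hx, hiv]
    set s₁ := s'.set .a (K.arr s (K.tl i)) with hs₁
    have E₂ : Env K s₁ := E₁.set (by decide)
    have hi₁ : s₁.v .j < K.m := by simpa [hs₁] using hi'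
    have hx₁ : K.arr s₁ = K.arr s := hx
    refine ⟨xHd_safe E₂ H hi₁, ?_⟩
    rw [xHd_val E₂ H hi₁, hx₁, show s₁.v .j = i by simp [hs₁, hiv]]
    set s₂ := s₁.set .b (K.arr s (K.hd i)) with hs₂
    have E₃ : Env K s₂ := E₂.set (by decide)
    have hx₂ : K.arr s₂ = K.arr s := hx
    have va : s₂.v .a = K.arr s (K.tl i) := by simp [hs₂, hs₁]
    have vb : s₂.v .b = K.arr s (K.hd i) := by simp [hs₂]
    have vl : s₂.v .lvl = K.arr s K.n := by simp [hs₂, hs₁, hl']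
    have vj : s₂.v .j = i := by simp [hs₂, hs₁, hiv]
    have vf : s₂.v .flag = s'.v .flag := by simp [hs₂, hs₁]
    have irrel : ¬ K.Cut (K.arr s) i → (s₂.v .flag = 1 ↔ s.v .flag = 1 ∧
        ∀ j < i + 1, K.Cut (K.arr s) j → ∀ j' < K.m, K.Cut (K.arr s) j' → j ≠ j' →
        K.Ok (K.arr s (K.tl j)) (K.arr s (K.hd j)) (K.arr s (K.tl j')) (K.arr s (K.hd j'))) := by
      intro h
      rw [vf, hI, Nat.forall_lt_succ_right]
      exact ⟨fun h' => ⟨h'.1, h'.2, fun h₁ => absurd h₁ h⟩, fun h' => ⟨h'.1, h'.2.1⟩⟩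
    simp only [wp, Ex.val, Ex.Safe, true_and, va, vb, vl, E₃.n1]
    refine ⟨fun h₁ => ⟨fun h₂ => irrel fun h => ?_, fun h₂ => ⟨fun h₃ => ?_,
      fun h₃ => irrel fun h => ?_⟩⟩, fun h₁ => irrel fun h => ?_⟩
    · have := h.2.1; omega
    · refine wp_mono ?_ (planarInnerC_spec E₃ H (by rw [vl, hx₂]) (by rwa [hx₂]) (by omega)
        (by omega))
      intro s₃ h₃
      have : K.Cut (K.arr s) i := ⟨h₁, by omega, by omega⟩
      rw [h₃, vf, hI, Nat.forall_lt_succ_right, va, vb, hx₂, vj, and_assoc,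
        forall_prop_of_true this]
    · have := h.2.2; omega
    · exact h₁ h.1
  · intro s' h _
    simpa [E.m, Problem.Planar] using h

theorem aliveC_spec (E : Env K s) (H : K.Fits L W B) (hl : s.v .lvl = K.arr s K.n) :
    aliveC.wp L W B (fun s' => s'.v .g = 1 ↔ K.Alive (K.arr s)) s := by
  have hB := H.loop
  have hW := H.word; have hL := H.mem
  refine ⟨Nat.zero_le _, ?_⟩
  refine wp_loop (fun i s' => s'.v .g = 1 ↔ ∃ j < i, K.arr s (K.tl j) < K.arr s K.n ∧
      (K.arr s (K.hd j) = K.n + 1 ∨ K.arr s (K.hd j) = K.arr s K.n))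
      (by simp [E.m]; omega) ?_ ?_ ?_ ?_
  · intro j s' k h; simpa using h
  · simp
  · intro j s' hj hI hjv hF
    have E₁ := (E.set (x := .g) (k := 0) (by decide)).frame' hF (by decide) (by decide) (by decide)
    have hj' : s'.v .j < K.m := by simpa [hjv, E.m] using hj
    have ha : K.arr s' = K.arr s := K.arr_congr (hF.mem (by decide))
    have hl' : s'.v .lvl = K.arr s K.n := by rw [hF.var _ (by decide)]; simpa using hl
    simp only [wp, xTl_val E₁ H hj', xHd_val E₁ H hj', xTl_safe E₁ H hj',
      xHd_safe E₁ H hj', Ex.val, Ex.Safe, ha, hjv, hl', E₁.n1, true_and, HS.set_v, if_true,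
      Nat.exists_lt_succ_right, hI]
    have hW1 : 1 ≤ W := by omega
    refine ⟨fun h₁ => ⟨fun h₂ => ?_, fun h₂ => ⟨fun h₃ => ?_, fun h₃ => ?_⟩⟩, fun h₁ => ?_⟩ <;>
    simp_all
  · intro s' h _
    simpa [E.m, Problem.Alive] using h

theorem _root_.UPSE.Problem.next_level (x : ℕ → ℕ) (p : ℕ) : K.next x p K.n =
    if K.pick x < K.n then x K.n else x K.n + 1 := by
  unfold Problem.next
  split_ifs with h
  · rw [Function.update_of_ne h.ne']
  · simp [Problem.forget]

/-- The successor is computed even when the step is not admissible; admissibility is collected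
separately in `flag`, so that control flow and arithmetic need not be interleaved. -/
theorem stepC_spec (E : Env K s) (H : K.Fits L W B) (hn : K.arr s K.n ≤ K.n)
    (hp : s.v .p < K.n) : stepC.wp L W B (fun s' => K.arr s' = K.next (K.arr s) (s.v .p) ∧
      s'.v .lvl = K.arr s' K.n ∧ OnlyArr K s s' ∧
      (s'.v .flag = 1 ↔ K.Good (K.arr s) (s.v .p))) s := by
  have hW := H.word; have hL := H.mem
  refine ⟨xAt_safe E H trivial (by simp [E.n]), ?_⟩
  rw [xAt_val E (by simp [E.n])]
  refine ⟨show 1 ≤ W by omega, ?_⟩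
  simp only [Ex.val, E.n]
  set s₁ := (s.set .lvl (K.arr s K.n)).set .flag 1 with hs₁
  have E₁ : Env K s₁ := (E.set (by decide)).set (by decide)
  have hx₁ : K.arr s₁ = K.arr s := rfl
  have hl₁ : s₁.v .lvl = K.arr s K.n := by simp [hs₁]
  refine wp_seq (pickC_spec E₁ H (by rw [hl₁, hx₁])) ?_
  intro s₂ h₂ F₂
  have E₂ := E₁.frame' F₂ (by decide) (by decide) (by decide)
  have hx₂ : K.arr s₂ = K.arr s := K.arr_congr (F₂.mem (by decide))
  have hl₂ : s₂.v .lvl = K.arr s₂ K.n := by rw [F₂.var _ (by decide), hl₁, hx₂]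
  have hp₂ : s₂.v .p = s.v .p := by rw [F₂.var _ (by decide)]; simp [hs₁]
  have hf₂ : s₂.v .flag = 1 := by rw [F₂.var _ (by decide)]; simp [hs₁]
  have hO₂ : OnlyArr K s s₂ := .of_mem (F₂.mem (by decide))
  rw [hx₁] at h₂
  refine wp_seq (R := fun s' => K.arr s' = K.next (K.arr s) (s.v .p) ∧ s'.v .lvl = K.arr s' K.n ∧
    OnlyArr K s s' ∧ (s'.v .flag = 1 ↔ K.Fair (K.arr s) (s.v .p))) ?_ ?_
  · refine ⟨trivial, trivial, fun h => ?_, fun h => ?_⟩ <;> simp only [Ex.val, h₂, E₂.n] at h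
    · refine wp_conseq (promiseC_spec E₂ H hl₂ (by rwa [h₂]) (by rwa [hp₂])) ?_
      rintro s₃ ⟨a₁, a₂, a₃⟩ F₃
      have hn3 : K.arr s₃ = K.next (K.arr s) (s.v .p) := by
        rw [a₁, hx₂, h₂, hp₂, Problem.next, if_pos h]
      refine ⟨hn3, ?_, hO₂.trans a₂, ?_⟩
      · rw [F₃.var _ (by decide), hl₂, hn3, Problem.next_level, if_pos h, hx₂]
      · rw [a₃, hp₂, hx₂, Problem.Fair, if_pos h]; simp [hf₂]
    · refine wp_conseq (placeC_spec E₂ H hl₂ (by rwa [hx₂])) ?_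
      rintro s₃ ⟨a₁, a₂, a₃, a₄⟩ F₃
      have hn3 : K.arr s₃ = K.next (K.arr s) (s.v .p) := by
        rw [a₁, hx₂, Problem.next, if_neg h]
      refine ⟨hn3, a₂, hO₂.trans a₃, ?_⟩
      rw [a₄, hx₂, Problem.Fair, if_neg h]; simp [hf₂]
  rintro s₃ ⟨a₁, a₂, a₃, a₄⟩ F₃
  have E₃ := Env.onlyArr E₂ F₃ (by decide) (K := K) (fun a ha => by rw [a₃ a ha, hO₂ a ha])
    (by decide)
  refine wp_conseq (planarC_spec E₃ H a₂ ?_) ?_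
  · rw [a₁, Problem.next_level]; split_ifs <;> omega
  · intro s₄ h₄ F₄
    have hx₄ : K.arr s₄ = K.arr s₃ := K.arr_congr (F₄.mem (by decide))
    refine ⟨hx₄.trans a₁, by rw [hx₄, F₄.var _ (by decide), a₂],
      a₃.trans (.of_mem (F₄.mem (by decide))), ?_⟩
    rw [h₄, a₁, a₄, Problem.Good]

end Cmd

/-! ### The memory of visited placements -/

namespace Problem

variable (K : Problem)

/-- The address of the field `d` of the record `r`. -/
def cell (r d : ℕ) : ℕ := 2 * K.m + 3 * K.n + 2 + r * (K.n + 2) + d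

/-- The child `d` of the node `r` of the trie. -/
def child (mem : ℕ → ℕ) (r d : ℕ) : ℕ := mem (K.cell (2 * r) d)

/-- The visited placement with the number `q`. -/
def key (mem : ℕ → ℕ) (q j : ℕ) : ℕ := if j ≤ K.n then mem (K.cell (2 * q + 1) j) else 0

/-- The number of the placement from which the placement `q` was reached. -/
def pred (mem : ℕ → ℕ) (q : ℕ) : ℕ := mem (K.cell (2 * q + 1) (K.n + 1))

/-- Uniqueness of division with remainder by the record length n + 2. -/
theorem cell_inj {r d r' d' : ℕ} (hd : d < K.n + 2) (hd' : d' < K.n + 2) :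
    K.cell r d = K.cell r' d' ↔ r = r' ∧ d = d' := by
  refine ⟨fun h => ?_, by rintro ⟨rfl, rfl⟩; rfl⟩
  have h' : d + r * (K.n + 2) = d' + r' * (K.n + 2) := by unfold cell at h; omega
  have h₁ := congrArg (· / (K.n + 2)) h'
  simp only [Nat.add_mul_div_right _ _ (Nat.succ_pos (K.n + 1)), Nat.div_eq_of_lt hd,
    Nat.div_eq_of_lt hd', Nat.zero_add] at h₁
  subst h₁
  exact ⟨rfl, by omega⟩

theorem cell_lt {r d M L : ℕ} (hr : r ≤ 2 * M + 1) (hd : d < K.n + 2)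
    (hM : 2 * K.m + 3 * K.n + 2 + (2 * M + 2) * (K.n + 2) ≤ L) : K.cell r d < L := by
  have : (r + 1) * (K.n + 2) ≤ (2 * M + 2) * (K.n + 2) := Nat.mul_le_mul_right _ (by omega)
  rw [Nat.add_mul, Nat.one_mul] at this
  unfold cell
  omega

/-- The nodes on the path of the key `x`. -/
def Path (mem : ℕ → ℕ) (x w : ℕ → ℕ) (k : ℕ) : Prop :=
  w 0 = 0 ∧ ∀ i < k, K.child mem (w i) (x i) = w (i + 1) ∧ w (i + 1) ≠ 0

/-- Each node of the path is read off from its predecessor and the key. -/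
theorem Path.unique {K : Problem} {mem x w w' : ℕ → ℕ} {k k' : ℕ} (h : K.Path mem x w k)
    (h' : K.Path mem x w' k') : ∀ i ≤ k, i ≤ k' → w i = w' i := by
  intro i
  induction i with
  | zero => intros; rw [h.1, h'.1]
  | succ i ih =>
    intro h₁ h₂
    rw [← (h.2 i (by omega)).1, ← (h'.2 i (by omega)).1, ih (by omega) (by omega)]

/-- The trie only grows: fields that are zero get filled, and existing links stay. -/
theorem Path.mono {K : Problem} {mem mem' x w : ℕ → ℕ} {k : ℕ} (h : K.Path mem x w k)
    (hx : ∀ i < k, x i ≤ K.n + 1)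
    (hc : ∀ r d, d < K.n + 2 → K.child mem r d ≠ 0 → K.child mem' r d = K.child mem r d) :
    K.Path mem' x w k :=
  ⟨h.1, fun i hi => by
    rw [hc _ _ (by have := hx i hi; omega) (by rw [(h.2 i hi).1]; exact (h.2 i hi).2)]
    exact h.2 i hi⟩

/-- The records `0, …, R - 1` are the nodes of a trie for the keys of the numbers `1, …, Q - 1`. The
node `r` is at depth `len r`, the first entries of the keys below it are those of `pre r`. -/
structure Trie (mem : ℕ → ℕ) (R Q : ℕ) (len : ℕ → ℕ) (pre : ℕ → ℕ → ℕ) : Prop where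
  pos : 1 ≤ R
  root : len 0 = 0
  -- The root has number 0 and is nobody's child, so 0 can stand for a missing child.
  node : ∀ r < R, len r < K.n → ∀ d < K.n + 2, K.child mem r d ≠ 0 → K.child mem r d < R ∧
    len (K.child mem r d) = len r + 1 ∧ (∀ j < len r, pre (K.child mem r d) j = pre r j) ∧
    pre (K.child mem r d) (len r) = d
  -- A key has n + 1 entries. At depth n the field is no longer a link but a mark that the whole key
  -- is stored.
  leaf : ∀ r < R, len r = K.n → ∀ d < K.n + 2, K.child mem r d ≠ 0 →
    ∃ q, 1 ≤ q ∧ q < Q ∧ (∀ j < K.n, K.key mem q j = pre r j) ∧ K.key mem q K.n = d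
  fresh : ∀ r, R ≤ r → ∀ d < K.n + 2, K.child mem r d = 0
  path : ∀ q, 1 ≤ q → q < Q → ∃ w, K.Path mem (K.key mem q) w K.n ∧
    K.child mem (w K.n) (K.key mem q K.n) ≠ 0
  digit : ∀ q, 1 ≤ q → q < Q → ∀ j, K.key mem q j ≤ K.n + 1
  inj : ∀ q q', 1 ≤ q → q < Q → 1 ≤ q' → q' < Q → K.key mem q = K.key mem q' → q = q'

variable {K}

theorem child_update {mem : ℕ → ℕ} {r₀ d₀ k r d : ℕ} (h₀ : d₀ < K.n + 2) (h : d < K.n + 2) :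
    K.child (Function.update mem (K.cell (2 * r₀) d₀) k) r d =
      if r = r₀ ∧ d = d₀ then k else K.child mem r d := by
  rw [child, Function.update_apply]
  simp only [K.cell_inj h h₀]
  simp [child]

/-- Trie nodes occupy the records with even numbers, stored placements those with odd numbers. -/
theorem key_update {mem : ℕ → ℕ} {r₀ d₀ k : ℕ} (h₀ : d₀ < K.n + 2) :
    K.key (Function.update mem (K.cell (2 * r₀) d₀) k) = K.key mem := by
  funext q j
  unfold key
  split_ifs with h
  · rw [Function.update_of_ne]
    rw [Ne, K.cell_inj (by omega) h₀]
    omega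
  · rfl

/-- The next unused record is still blank by `fresh`, hence a valid node without children; its
prefix is that of the parent followed by the new digit. -/
theorem Trie.addNode {mem : ℕ → ℕ} {R Q : ℕ} {len : ℕ → ℕ} {pre : ℕ → ℕ → ℕ}
    (T : K.Trie mem R Q len pre) {r₀ d₀ : ℕ} (hr : r₀ < R) (hl : len r₀ < K.n) (hd : d₀ < K.n + 2)
    (h0 : K.child mem r₀ d₀ = 0) :
    K.Trie (Function.update mem (K.cell (2 * r₀) d₀) R) (R + 1) Q
      (Function.update len R (len r₀ + 1))
      (Function.update pre R (Function.update (pre r₀) (len r₀) d₀)) := by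
  have hc : ∀ r d, d < K.n + 2 → K.child mem r d ≠ 0 →
      K.child (Function.update mem (K.cell (2 * r₀) d₀) R) r d = K.child mem r d := by
    intro r d h h'
    rw [child_update hd h, if_neg]
    rintro ⟨rfl, rfl⟩
    exact h' h0
  have hR : ∀ d < K.n + 2, K.child (Function.update mem (K.cell (2 * r₀) d₀) R) R d = 0 := by
    intro d h
    rw [child_update hd h, if_neg (by omega), T.fresh R le_rfl d h]
  have hpos := T.pos
  refine ⟨by omega, ?_, ?_, ?_, ?_, ?_, ?_, ?_⟩
  · rw [Function.update_of_ne (by omega), T.root]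
  · intro r hrR hlr d h hne
    rcases Nat.lt_succ_iff_lt_or_eq.1 hrR with h' | rfl
    · rw [Function.update_of_ne h'.ne] at hlr ⊢
      rw [Function.update_of_ne h'.ne]
      by_cases e : r = r₀ ∧ d = d₀
      · obtain ⟨rfl, rfl⟩ := e
        rw [child_update hd h, if_pos ⟨rfl, rfl⟩]
        refine ⟨by omega, by simp, ?_, by simp⟩
        intro j hj
        simp [hj.ne]
      · rw [child_update hd h, if_neg e] at hne ⊢
        obtain ⟨a₁, a₂, a₃, a₄⟩ := T.node r h' hlr d h hne
        rw [Function.update_of_ne a₁.ne, Function.update_of_ne a₁.ne]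
        exact ⟨by omega, a₂, a₃, a₄⟩
    · exact absurd (hR d h) hne
  · intro r hrR hlr d h hne
    rcases Nat.lt_succ_iff_lt_or_eq.1 hrR with h' | rfl
    · rw [Function.update_of_ne h'.ne] at hlr ⊢
      rw [child_update hd h, if_neg (by rintro ⟨rfl, rfl⟩; omega)] at hne
      rw [key_update hd]
      exact T.leaf r h' hlr d h hne
    · exact absurd (hR d h) hne
  · intro r hrR d h
    rw [child_update hd h, if_neg (by omega)]
    exact T.fresh r (by omega) d h
  · intro q h₁ h₂
    rw [key_update hd]
    obtain ⟨w, p₁, p₂⟩ := T.path q h₁ h₂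
    refine ⟨w, p₁.mono (fun i _ => T.digit q h₁ h₂ i) hc, ?_⟩
    rwa [hc _ _ (by have := T.digit q h₁ h₂ K.n; omega) p₂]
  · rw [key_update hd]
    exact T.digit
  · rw [key_update hd]
    exact T.inj

/-- The new memory is described only through its fields and keys, because by then both the mark and
a whole record have been written. -/
theorem Trie.addKey {mem mem' : ℕ → ℕ} {R Q : ℕ} {len : ℕ → ℕ} {pre : ℕ → ℕ → ℕ}
    (T : K.Trie mem R Q len pre) {x w : ℕ → ℕ} (hr : w K.n < R) (hl : len (w K.n) = K.n)
    (hpre : ∀ j < K.n, pre (w K.n) j = x j) (hw : K.Path mem x w K.n) (hx : ∀ j, x j ≤ K.n + 1)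
    (h0 : K.child mem (w K.n) (x K.n) = 0)
    (hc : ∀ r d, d < K.n + 2 → K.child mem' r d =
      if r = w K.n ∧ d = x K.n then 1 else K.child mem r d)
    (hk : ∀ q, 1 ≤ q → q < Q → K.key mem' q = K.key mem q) (hkQ : K.key mem' Q = x)
    (hQ : 1 ≤ Q) : K.Trie mem' R (Q + 1) len pre := by
  have hc' : ∀ r d, d < K.n + 2 → K.child mem r d ≠ 0 → K.child mem' r d = K.child mem r d := by
    intro r d h h'
    rw [hc r d h, if_neg]
    rintro ⟨rfl, rfl⟩
    exact h' h0
  -- A stored copy of the key would lead along the same path and would already have set the mark.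
  have hnew : ∀ q, 1 ≤ q → q < Q → K.key mem q ≠ x := by
    rintro q h₁ h₂ rfl
    obtain ⟨w', p₁, p₂⟩ := T.path q h₁ h₂
    rw [← hw.unique p₁ _ le_rfl le_rfl] at p₂
    exact p₂ h0
  refine ⟨T.pos, T.root, ?_, ?_, ?_, ?_, ?_, ?_⟩
  · intro r hrR hlr d h hne
    rw [hc r d h, if_neg (by rintro ⟨rfl, rfl⟩; omega)] at hne ⊢
    exact T.node r hrR hlr d h hne
  · intro r hrR hlr d h hne
    rw [hc r d h] at hne
    split_ifs at hne with e
    · obtain ⟨rfl, rfl⟩ := e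
      exact ⟨Q, hQ, by omega, fun j hj => by rw [hkQ, hpre j hj], by rw [hkQ]⟩
    · obtain ⟨q, q₁, q₂, q₃⟩ := T.leaf r hrR hlr d h hne
      exact ⟨q, q₁, by omega, by rwa [hk q q₁ q₂]⟩
  · intro r hrR d h
    rw [hc r d h, if_neg (by omega)]
    exact T.fresh r hrR d h
  · intro q h₁ h₂
    rcases Nat.lt_succ_iff_lt_or_eq.1 h₂ with h' | rfl
    · rw [hk q h₁ h']
      obtain ⟨w, p₁, p₂⟩ := T.path q h₁ h'
      refine ⟨w, p₁.mono (fun i _ => T.digit q h₁ h' i) hc', ?_⟩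
      rwa [hc' _ _ (by have := T.digit q h₁ h' K.n; omega) p₂]
    · rw [hkQ]
      refine ⟨w, hw.mono (fun i _ => hx i) hc', ?_⟩
      rw [hc _ _ (by have := hx K.n; omega), if_pos ⟨rfl, rfl⟩]
      exact one_ne_zero
  · intro q h₁ h₂
    rcases Nat.lt_succ_iff_lt_or_eq.1 h₂ with h' | rfl
    · rw [hk q h₁ h']; exact T.digit q h₁ h'
    · rwa [hkQ]
  · intro q q' h₁ h₂ h₁' h₂' e
    rcases Nat.lt_succ_iff_lt_or_eq.1 h₂ with h | rfl <;>
    rcases Nat.lt_succ_iff_lt_or_eq.1 h₂' with h' | rfl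
    · rw [hk q h₁ h, hk q' h₁' h'] at e; exact T.inj q q' h₁ h h₁' h' e
    · rw [hk q h₁ h, hkQ] at e; exact absurd e (hnew q h₁ h)
    · rw [hk q' h₁' h', hkQ] at e; exact absurd e.symm (hnew q' h₁' h')
    · rfl

end Problem

/-! ### Insertion of a placement into the trie -/

namespace Cmd

open Ex

/-- Follow the path of the key in the work array and extend it if necessary. -/
def walkC : Cmd :=
  assign .node (lit 0) ;;
  loop .j .n (
    assign .ad (add (add (var .Bs) (mul (mul (lit 2) (var .node)) (var .S))) (xAt (var .j))) ;;
    assign .ch (get (var .ad)) ;;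
    ifEq (var .ch) (lit 0)
      (assign .ch (var .cnt) ;; store (var .ad) (var .ch) ;; assign .cnt (add (var .cnt) (lit 1)))
      skip ;;
    assign .node (var .ch))

/-- The address of the record of the next placement. -/
def recE : Ex := add (var .Bs) (mul (add (mul (lit 2) (var .qc)) (lit 1)) (var .S))

/-- Append the work array to the list of visited placements. -/
def appendC : Cmd :=
  loop .j .n1 (store (add recE (var .j)) (xAt (var .j))) ;;
  store (add recE (var .n1)) (var .q) ;;
  assign .qc (add (var .qc) (lit 1))

/-- Append the work array to the list of visited placements unless it is there. -/
def insertC : Cmd :=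
  walkC ;;
  assign .ad (add (add (var .Bs) (mul (mul (lit 2) (var .node)) (var .S))) (xAt (var .n))) ;;
  ifEq (get (var .ad)) (lit 0) (store (var .ad) (lit 1) ;; appendC) skip

variable {K : Problem} {L W B : ℕ} {s : HS}

/-- Only nodes of the trie have changed. -/
def OnlyTrie (K : Problem) (mem mem' : ℕ → ℕ) : Prop :=
  (∀ a < 2 * K.m + 3 * K.n + 2, mem' a = mem a) ∧
    ∀ q, ∀ d < K.n + 2, mem' (K.cell (2 * q + 1) d) = mem (K.cell (2 * q + 1) d)

theorem OnlyTrie.refl (mem : ℕ → ℕ) : OnlyTrie K mem mem := ⟨fun _ _ => rfl, fun _ _ _ => rfl⟩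

theorem OnlyTrie.update {mem mem' : ℕ → ℕ} (h : OnlyTrie K mem mem') {r d k : ℕ}
    (hd : d < K.n + 2) : OnlyTrie K mem (Function.update mem' (K.cell (2 * r) d) k) := by
  refine ⟨fun a ha => ?_, fun q d' hd' => ?_⟩
  · rw [Function.update_of_ne (by unfold Problem.cell; omega), h.1 a ha]
  · rw [Function.update_of_ne, h.2 q d' hd']
    rw [Ne, K.cell_inj hd' hd]
    omega

theorem OnlyTrie.key {mem mem' : ℕ → ℕ} (h : OnlyTrie K mem mem') : K.key mem' = K.key mem := by
  funext q j
  unfold Problem.key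
  split_ifs
  exacts [h.2 q j (by omega), rfl]

theorem OnlyTrie.arr {s s' : HS} (h : OnlyTrie K s.mem s'.mem) : K.arr s' = K.arr s := by
  funext j
  unfold Problem.arr
  split_ifs
  exacts [h.1 _ (by omega), rfl]

/-- The state of the walk along the path of the key `x` at depth `j`. -/
def Walk (K : Problem) (x : ℕ → ℕ) (s s' : HS) (j : ℕ) : Prop :=
  ∃ len pre w, K.Trie s'.mem (s'.v .cnt) (s.v .qc) len pre ∧ s'.v .node < s'.v .cnt ∧
    len (s'.v .node) = j ∧ (∀ i < j, pre (s'.v .node) i = x i) ∧ K.Path s'.mem x w j ∧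
    w j = s'.v .node ∧ s'.v .cnt ≤ s.v .cnt + j ∧
    ((∃ q, 1 ≤ q ∧ q < s.v .qc ∧ K.key s.mem q = x) → s'.v .cnt = s.v .cnt) ∧
    OnlyTrie K s.mem s'.mem

/-- There are records for `M` more nodes and placements. -/
def Room (K : Problem) (L M : ℕ) : Prop :=
  2 * K.m + 3 * K.n + 2 + (2 * M + 2) * (K.n + 2) ≤ L

theorem nodeE_safe (E : Env K s) (H : K.Fits L W B) {M r : ℕ} (hM : Room K L M) (hr : s.v .node = r)
    (hrM : r ≤ M) {e : Ex} (he : e.Safe L W s) (hv : e.val s < K.n + 2) :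
    (add (add (var .Bs) (mul (mul (lit 2) (var .node)) (var .S))) e).Safe L W s ∧
    (add (add (var .Bs) (mul (mul (lit 2) (var .node)) (var .S))) e).val s =
      K.cell (2 * r) (e.val s) ∧ K.cell (2 * r) (e.val s) < L := by
  have h := K.cell_lt (r := 2 * r) (d := e.val s) (by omega) hv hM
  have hW := H.word
  have hn : 2 * r ≤ 2 * r * (K.n + 2) := Nat.le_mul_of_pos_right _ (by omega)
  simp only [Ex.Safe, Ex.val, E.Bs, E.S, hr, he, true_and]
  unfold Problem.cell at h ⊢
  omega

/-- Nodes are created before it is known whether the key is new. No node is wasted all the same: a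
stored key has its complete path in the trie, so for such a key nothing is created. This bounds the
nodes by n per stored placement, plus the root. -/
theorem walkC_spec (E : Env K s) (H : K.Fits L W B) {M : ℕ} (hM : Room K L M)
    {len : ℕ → ℕ} {pre : ℕ → ℕ → ℕ} (T : K.Trie s.mem (s.v .cnt) (s.v .qc) len pre)
    (hc : s.v .cnt + K.n ≤ M) (hx : ∀ j, K.arr s j ≤ K.n + 1) :
    walkC.wp L W B (fun s' => Walk K (K.arr s) s s' K.n) s := by
  have hB := H.loop
  have hW := H.word; have hL := H.mem
  refine ⟨Nat.zero_le _, ?_⟩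
  refine wp_loop (fun j s' => Walk K (K.arr s) s s' j) (by simp [E.n]; omega) ?_ ?_ ?_ ?_
  · intro j s' k h; exact h
  · refine ⟨len, pre, fun _ => 0, ?_, ?_, ?_, by simp, ⟨rfl, by simp⟩, by simp, by simp, by simp,
      OnlyTrie.refl _⟩
    · simpa using T
    · simpa using show 0 < s.v .cnt from T.pos
    · simpa using T.root
  · rintro j s' hj ⟨len, pre, w, T, h₁, h₂, h₃, h₄, h₅, h₆, h₇, h₈⟩ hjv hF
    have E₁ := (E.set (x := .node) (k := 0) (by decide)).frame hF (by decide)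
      (fun a ha => h₈.1 a (by omega)) (by decide)
    have hj' : j < K.n := by simpa [E.n] using hj
    have hv : (xAt (var .j)).val s' = K.arr s j := by
      rw [xAt_val E₁ (by simp [hjv, hj'.le]), h₈.arr]; simp [hjv]
    have hxj : K.arr s j < K.n + 2 := by have := hx j; omega
    obtain ⟨a₁, a₂, a₃⟩ := nodeE_safe E₁ H hM rfl (by omega)
      (xAt_safe E₁ H (e := var .j) trivial (by simp [hjv, hj'.le])) (by rw [hv]; exact hxj)
    rw [hv] at a₂ a₃
    refine ⟨a₁, ?_⟩
    rw [a₂]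
    set r := s'.v .node with hr
    simp only [wp]
    simp only [Ex.val, Ex.Safe, HS.set_v, HS.set_mem, reduceCtorEq, if_false, if_true, true_and,
      HS.setMem_v]
    have hch : s'.mem (K.cell (2 * r) (K.arr s j)) = K.child s'.mem r (K.arr s j) := rfl
    rw [hch]
    refine ⟨a₃, Nat.zero_le _, fun h0 => ⟨a₃, ?_, ?_⟩, fun h0 => ?_⟩
    · have : 2 * M + 2 ≤ (2 * M + 2) * (K.n + 2) := Nat.le_mul_of_pos_right _ (by omega)
      unfold Room at hM
      omega
    · refine ⟨_, _, fun i => if i = j + 1 then s'.v .cnt else w i, T.addNode h₁ (h₂.trans_lt hj')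
        hxj h0, ?_, ?_, ?_, ?_, ?_, ?_, ?_, ?_⟩
      · simp
      · simp [h₂]
      · intro i hi
        simp only [HS.set_v, if_true, Function.update_self, h₂]
        rcases Nat.lt_succ_iff_lt_or_eq.1 hi with h | rfl
        · rw [Function.update_of_ne h.ne, h₃ i h]
        · simp
      · refine ⟨by simp [h₄.1], fun i hi => ?_⟩
        have hxi : K.arr s i < K.n + 2 := by have := hx i; omega
        simp only [HS.set_mem, HS.setMem]
        rw [Problem.child_update hxj hxi, if_neg (show ¬ i = j + 1 by omega)]
        rcases Nat.lt_succ_iff_lt_or_eq.1 hi with h | rfl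
        · have h' := h₄.2 i h
          rw [if_neg, if_neg (show ¬ i + 1 = j + 1 by omega)]
          · exact h'
          · rintro ⟨e₁, e₂⟩
            rw [← e₁, ← e₂, h'.1] at h0
            exact h'.2 h0
        · have := T.pos
          rw [h₅]
          simp; omega
      · simp
      · simp; omega
      -- If the key were stored, its path would pass through the current node and the child just
      -- found missing would exist.
      · rintro ⟨q, q₁, q₂, q₃⟩
        exfalso
        obtain ⟨w', p₁, p₂⟩ := T.path q q₁ q₂
        rw [h₈.key, q₃] at p₁
        have e := h₄.unique p₁ j le_rfl hj'.le
        have := p₁.2 j hj'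
        rw [← e, h₅, h0] at this
        exact this.2 this.1.symm
      · exact h₈.update hxj
    · have hcn := T.node r h₁ (by omega) _ hxj h0
      refine ⟨len, pre, fun i => if i = j + 1 then K.child s'.mem r (K.arr s j) else w i, ?_, ?_,
        ?_, ?_, ?_, ?_, ?_, ?_, ?_⟩
      · simpa using T
      · simpa using hcn.1
      · simpa [h₂] using hcn.2.1
      · intro i hi
        simp only [HS.set_v, if_true]
        rcases Nat.lt_succ_iff_lt_or_eq.1 hi with h | rfl
        · rw [hcn.2.2.1 i (by omega), h₃ i h]
        · have := hcn.2.2.2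
          rwa [h₂] at this
      · refine ⟨by simp [h₄.1], fun i hi => ?_⟩
        simp only [HS.set_mem]
        rw [if_neg (show ¬ i = j + 1 by omega)]
        rcases Nat.lt_succ_iff_lt_or_eq.1 hi with h | rfl
        · rw [if_neg (show ¬ i + 1 = j + 1 by omega)]
          exact h₄.2 i h
        · rw [h₅]
          simpa using h0
      · simp
      · simp; omega
      · simpa using h₇
      · simpa using h₈
  · intro s' h _
    simpa [E.n] using h

/-- The result of inserting the key `x` with the predecessor `p`. -/
structure Inserted (K : Problem) (x : ℕ → ℕ) (p : ℕ) (s s' : HS) : Prop where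
  trie : ∃ len pre, K.Trie s'.mem (s'.v .cnt) (s'.v .qc) len pre
  count : s'.v .cnt + K.n * s.v .qc ≤ s.v .cnt + K.n * s'.v .qc
  low : ∀ a < 2 * K.m + 3 * K.n + 2, s'.mem a = s.mem a
  key : ∀ q, 1 ≤ q → q < s.v .qc → K.key s'.mem q = K.key s.mem q ∧ K.pred s'.mem q = K.pred s.mem q
  cases : (s'.v .qc = s.v .qc ∧ ∃ q, 1 ≤ q ∧ q < s.v .qc ∧ K.key s.mem q = x) ∨
    (s'.v .qc = s.v .qc + 1 ∧ K.key s'.mem (s.v .qc) = x ∧ K.pred s'.mem (s.v .qc) = p)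

/-- Only the record of the placement `q` has changed. -/
def OnlyRec (K : Problem) (q : ℕ) (mem mem' : ℕ → ℕ) : Prop :=
  (∀ a < 2 * K.m + 3 * K.n + 2, mem' a = mem a) ∧
    ∀ r ≠ 2 * q + 1, ∀ d < K.n + 2, mem' (K.cell r d) = mem (K.cell r d)

theorem OnlyRec.refl (q : ℕ) (mem : ℕ → ℕ) : OnlyRec K q mem mem :=
  ⟨fun _ _ => rfl, fun _ _ _ _ => rfl⟩

theorem OnlyRec.update {q : ℕ} {mem mem' : ℕ → ℕ} (h : OnlyRec K q mem mem') {d k : ℕ}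
    (hd : d < K.n + 2) : OnlyRec K q mem (Function.update mem' (K.cell (2 * q + 1) d) k) := by
  refine ⟨fun a ha => ?_, fun r hr d' hd' => ?_⟩
  · rw [Function.update_of_ne (by unfold Problem.cell; omega), h.1 a ha]
  · rw [Function.update_of_ne, h.2 r hr d' hd']
    rw [Ne, K.cell_inj hd' hd]
    omega

theorem recE_val (E : Env K s) (d : ℕ) : recE.val s + d = K.cell (2 * s.v .qc + 1) d := by
  simp [recE, E.Bs, E.S, Problem.cell]

theorem recE_safe (E : Env K s) (H : K.Fits L W B) {M : ℕ} (hM : Room K L M) (hq : s.v .qc ≤ M) :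
    recE.Safe L W s := by
  have hW := H.word
  have h := K.cell_lt (r := 2 * s.v .qc + 1) (d := 0) (by omega) (by omega) hM
  have hn : 2 * s.v .qc + 1 ≤ (2 * s.v .qc + 1) * (K.n + 2) := Nat.le_mul_of_pos_right _ (by omega)
  simp only [recE, Ex.Safe, Ex.val, E.Bs, E.S, true_and]
  unfold Problem.cell at h
  omega

theorem appendC_spec (E : Env K s) (H : K.Fits L W B) {M : ℕ} (hM : Room K L M)
    (hq : s.v .qc ≤ M) :
    appendC.wp L W B (fun s' => OnlyRec K (s.v .qc) s.mem s'.mem ∧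
      K.key s'.mem (s.v .qc) = K.arr s ∧ K.pred s'.mem (s.v .qc) = s.v .q ∧
      s'.v .qc = s.v .qc + 1) s := by
  have hB := H.loop
  have hW := H.word; have hL := H.mem
  refine wp_seq (R := fun s' => OnlyRec K (s.v .qc) s.mem s'.mem ∧
    K.key s'.mem (s.v .qc) = K.arr s) ?_ ?_
  · refine wp_loop (fun j s' => OnlyRec K (s.v .qc) s.mem s'.mem ∧
      ∀ i < j, s'.mem (K.cell (2 * s.v .qc + 1) i) = K.arr s i) (by simp [E.n1]; omega) ?_ ?_ ?_ ?_
    · intro j s' k h; exact h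
    · exact ⟨OnlyRec.refl _ _, by simp⟩
    · rintro j s' hj ⟨hO, hI⟩ hjv hF
      have E₁ := E.frame hF (by decide) (fun a ha => hO.1 a (by omega)) (by decide)
      have hj' : j ≤ K.n := by rw [E.n1] at hj; omega
      have ha : K.arr s' = K.arr s := by
        funext i
        unfold Problem.arr
        split_ifs
        exacts [hO.1 _ (by omega), rfl]
      have hv : (xAt (var .j)).val s' = K.arr s j := by
        rw [xAt_val E₁ (by simp [hjv, hj']), ha]; simp [hjv]
      have hqc : s'.v .qc = s.v .qc := hF.var _ (by decide)
      have hlt := K.cell_lt (r := 2 * s.v .qc + 1) (d := j) (by omega) (by omega) hM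
      have hrec := recE_val E₁ j
      rw [hqc] at hrec
      simp only [wp]
      rw [hv]
      simp only [Ex.val, Ex.Safe, hjv, hrec]
      refine ⟨⟨recE_safe E₁ H hM (by omega), trivial, by omega⟩,
        xAt_safe E₁ H trivial (by simp [hjv, hj']), hlt, hO.update (by omega), ?_⟩
      intro i hi
      rw [HS.setMem_mem]
      simp only [K.cell_inj (show i < K.n + 2 by omega) (show j < K.n + 2 by omega), true_and]
      split_ifs with h
      · rw [h]
      · exact hI i (by omega)
    · rintro s' ⟨hO, hI⟩ hF
      refine ⟨hO, ?_⟩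
      funext i
      unfold Problem.key
      split_ifs with h
      · exact hI i (by rw [E.n1]; omega)
      · simp [Problem.arr, h]
  · rintro s' ⟨hO, hI⟩ hF
    have E₁ := E.frame hF (by decide) (fun a ha => hO.1 a (by omega)) (by decide)
    have hqc : s'.v .qc = s.v .qc := hF.var _ (by decide)
    have hqv : s'.v .q = s.v .q := hF.var _ (by decide)
    have hlt := K.cell_lt (r := 2 * s.v .qc + 1) (d := K.n + 1) (by omega) (by omega) hM
    have hrec := recE_val E₁ (K.n + 1)
    rw [hqc] at hrec
    have hM' : s.v .qc + 1 ≤ W := by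
      have : 2 * M + 2 ≤ (2 * M + 2) * (K.n + 2) := Nat.le_mul_of_pos_right _ (by omega)
      unfold Room at hM
      omega
    simp only [wp]
    simp only [Ex.val, Ex.Safe, E₁.n1, hrec, HS.setMem_v, hqc, hqv, true_and]
    refine ⟨⟨recE_safe E₁ H hM (by omega), by omega⟩, hlt, ⟨by omega, hM'⟩, ?_, ?_, ?_, by simp⟩
    · exact hO.update (by omega)
    · rw [← hI]
      funext i
      unfold Problem.key
      split_ifs with h
      · simp [K.cell_inj (show i < K.n + 2 by omega) (show K.n + 1 < K.n + 2 by omega)]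
        omega
      · rfl
    · simp [Problem.pred]

/-- The mark at the end of the path decides. If it is set, `leaf` supplies a stored key with the
same digits, hence the same key; otherwise the mark is set and the record appended. -/
theorem insertC_spec (E : Env K s) (H : K.Fits L W B) {M : ℕ} (hM : Room K L M)
    (T : ∃ len pre, K.Trie s.mem (s.v .cnt) (s.v .qc) len pre)
    (hc : s.v .cnt + K.n ≤ M) (hq : s.v .qc ≤ M) (hq1 : 1 ≤ s.v .qc)
    (hx : ∀ j, K.arr s j ≤ K.n + 1) :
    insertC.wp L W B (Inserted K (K.arr s) (s.v .q) s) s := by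
  obtain ⟨len₀, pre₀, T₀⟩ := T
  have hW := H.word; have hL := H.mem
  refine wp_seq (walkC_spec E H hM T₀ hc hx) ?_
  rintro s' ⟨len, pre, w, T, h₁, h₂, h₃, h₄, h₅, h₆, h₇, h₈⟩ hF
  have E₁ := E.frame hF (by decide) (fun a ha => h₈.1 a (by omega)) (by decide)
  have hv : (xAt (var .n)).val s' = K.arr s K.n := by
    rw [xAt_val E₁ (by simp [E₁.n]), h₈.arr]; simp [E₁.n]
  have hxn : K.arr s K.n < K.n + 2 := by have := hx K.n; omega
  obtain ⟨a₁, a₂, a₃⟩ := nodeE_safe E₁ H hM rfl (by omega)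
    (xAt_safe E₁ H (e := var .n) trivial (by simp [E₁.n])) (by rw [hv]; exact hxn)
  rw [hv] at a₂ a₃
  refine ⟨a₁, ?_⟩
  rw [a₂]
  set r := s'.v .node with hr
  have hqc : s'.v .qc = s.v .qc := hF.var _ (by decide)
  have hqv : s'.v .q = s.v .q := hF.var _ (by decide)
  have hch : s'.mem (K.cell (2 * r) (K.arr s K.n)) = K.child s'.mem r (K.arr s K.n) := rfl
  have hpred : ∀ q, K.pred s'.mem q = K.pred s.mem q := fun q => h₈.2 q _ (by omega)
  simp only [wp]
  simp only [Ex.val, Ex.Safe, HS.set_v, HS.set_mem, if_true, true_and, hch]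
  refine ⟨a₃, Nat.zero_le _, fun h0 => ⟨by omega, a₃, ?_⟩, fun h0 => ?_⟩
  · set s₁ := (s'.set .ad (K.cell (2 * r) (K.arr s K.n))).setMem (K.cell (2 * r) (K.arr s K.n)) 1
      with hs₁
    have E₂ : Env K s₁ := (E₁.set (by decide)).setMem (by unfold Problem.cell; omega)
    have hO : OnlyTrie K s.mem s₁.mem := h₈.update hxn
    refine wp_conseq (appendC_spec E₂ H hM (by simpa [hs₁, hqc] using hq)) ?_
    rintro s₂ ⟨b₁, b₂, b₃, b₄⟩ F₂
    rw [hO.arr] at b₂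
    have q₁ : s₁.v .qc = s.v .qc := by simp [hs₁, hqc]
    have q₂ : s₁.v .q = s.v .q := by simp [hs₁, hqv]
    have c₂ : s₂.v .cnt = s'.v .cnt := by rw [F₂.var _ (by decide)]; simp [hs₁]
    rw [q₁] at b₁ b₂ b₃ b₄
    rw [q₂] at b₃
    have hk : ∀ q, 1 ≤ q → q < s.v .qc → K.key s₂.mem q = K.key s.mem q ∧
        K.pred s₂.mem q = K.pred s.mem q := by
      intro q _ hlt
      rw [← hO.key]
      constructor
      · funext j
        unfold Problem.key
        split_ifs
        · exact b₁.2 _ (by omega) _ (by omega)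
        · rfl
      · exact (b₁.2 _ (by omega) _ (by omega)).trans (hO.2 q _ (by omega))
    refine ⟨⟨len, pre, ?_⟩, ?_, fun a ha => (b₁.1 a ha).trans (hO.1 a ha), hk, .inr ⟨b₄, b₂, b₃⟩⟩
    · rw [c₂, b₄]
      refine T.addKey (x := K.arr s) (w := w) (by rw [h₅]; exact h₁) (by rw [h₅, h₂])
        (by rw [h₅]; exact h₃) h₄ hx (by rw [h₅]; exact h0) ?_ ?_ b₂ hq1
      · intro r' d hd
        rw [h₅, ← Problem.child_update hxn hd]
        exact b₁.2 _ (by omega) _ hd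
      · intro q hq1 hlt
        rw [(hk q hq1 hlt).1, h₈.key]
    · rw [c₂, b₄, Nat.mul_add]
      omega
  · have hlf := T.leaf r h₁ h₂ _ hxn h0
    obtain ⟨q, q₁, q₂, q₃, q₄⟩ := hlf
    have hkey : K.key s.mem q = K.arr s := by
      rw [← h₈.key]
      funext j
      rcases lt_trichotomy j K.n with h | h | h
      · rw [q₃ j h, h₃ j h]
      · rw [h, q₄]
      · rw [Problem.key, Problem.arr, if_neg (by omega), if_neg (by omega)]
    have hex : ∃ q, 1 ≤ q ∧ q < s.v .qc ∧ K.key s.mem q = K.arr s := ⟨q, q₁, q₂, hkey⟩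
    refine ⟨⟨len, pre, ?_⟩, ?_, h₈.1, fun q _ _ => ⟨by simp [h₈.key], hpred q⟩, .inl ⟨?_, hex⟩⟩
    · simpa [hqc] using T
    · simp [hqc, h₇ hex]
    · simp [hqc]

end Cmd

namespace Problem

/-! ### The search space -/

/-- The digraph of `K` is an `st`-graph. -/
structure STGraph (K : Problem) (s t : ℕ) : Prop where
  tl_lt : ∀ j < K.m, K.tl j < K.n
  hd_lt : ∀ j < K.m, K.hd j < K.n
  noLoop : ∀ j < K.m, K.tl j ≠ K.hd j
  s_lt : s < K.n
  source : ∀ v < K.n, (∀ j < K.m, K.hd j ≠ v) ↔ v = s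
  sink : ∀ v < K.n, v ≠ t → ∃ j < K.m, K.tl j = v
  -- Every vertex reaches the sink, phrased as an induction principle for down-closed sets.
  top : ∀ D : Set ℕ, (∀ j < K.m, K.hd j ∈ D → K.tl j ∈ D) → t ∈ D → ∀ v < K.n, v ∈ D

/-- The initial partial placement: the source is promised the first rank. -/
def start (K : Problem) (j : ℕ) : ℕ :=
  open Classical in
  if j < K.n then (if ∃ i < K.m, K.hd i = j then K.n + 1 else 1) else if j = K.n then 1 else 0

/-- The partial placements that the search reaches. -/
inductive Reach (K : Problem) : (ℕ → ℕ) → Prop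
  | start : Reach K K.start
  | next {x : ℕ → ℕ} {p : ℕ} : Reach K x → p < K.n → K.Good x p → K.next x p K.n ≠ K.n + 1 →
      K.Alive (K.next x p) → Reach K (K.next x p)

/-- The step from `x` to `K.next x p` places the last vertex. -/
def Accept (K : Problem) (x : ℕ → ℕ) (p : ℕ) : Prop :=
  p < K.n ∧ K.Good x p ∧ K.next x p K.n = K.n + 1

/-- The invariant of the reachable partial placements. -/
structure Inv (K : Problem) (s : ℕ) (x : ℕ → ℕ) : Prop where
  le : ∀ v, x v ≤ K.n + 1
  one_le : 1 ≤ x K.n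
  inj : ∀ u < K.n, ∀ v < K.n, x u = x v → 1 ≤ x u → x u ≤ K.n → u = v
  down : ∀ j < K.m, x (K.hd j) < x K.n → x (K.tl j) < x K.n
  card : ((Finset.range K.n).filter fun v => x v < x K.n).card + 1 = x K.n
  done : ∀ j < K.m, x (K.tl j) = 0 → x (K.hd j) < x K.n
  tail : ∀ v < K.n, x v < x K.n → x v ≠ 0 → ∃ j < K.m, K.tl j = v ∧ x K.n ≤ x (K.hd j)
  head : ∀ v < K.n, x K.n ≤ x v → x v ≤ K.n → 2 ≤ x K.n → ∃ j < K.m, K.hd j = v ∧ x (K.tl j) < x K.n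
  -- This pins the rank of one tail of the cut to the value just below the level, which saves a
  -- factor n in the count of placements; it also shows that the cut is not empty.
  recent : 2 ≤ x K.n → x K.n ≤ K.n → ∃ j < K.m, x (K.tl j) + 1 = x K.n ∧ x K.n ≤ x (K.hd j)
  first : x K.n = 1 → x = K.start
  planar : K.Planar x
  zero : ∀ j, K.n < j → x j = 0

variable {K : Problem} {s t : ℕ} {x : ℕ → ℕ}

theorem pickUpTo_spec (x : ℕ → ℕ) : ∀ i, (K.pickUpTo x i = K.n ∧
      ∀ j < i, ¬ (x (K.tl j) < x K.n ∧ x (K.hd j) = K.n + 1)) ∨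
    ∃ j < i, x (K.tl j) < x K.n ∧ x (K.hd j) = K.n + 1 ∧ K.pickUpTo x i = K.hd j := by
  intro i
  induction i with
  | zero => exact .inl ⟨rfl, by simp⟩
  | succ i ih =>
    by_cases h : x (K.tl i) < x K.n ∧ x (K.hd i) = K.n + 1
    · exact .inr ⟨i, by omega, h.1, h.2, by simp [pickUpTo, h]⟩
    · rw [pickUpTo, if_neg h]
      rcases ih with ⟨h₁, h₂⟩ | ⟨j, h₁, h₂⟩
      · refine .inl ⟨h₁, fun j hj => ?_⟩
        rcases Nat.lt_succ_iff_lt_or_eq.1 hj with h' | rfl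
        exacts [h₂ j h', h]
      · exact .inr ⟨j, by omega, h₂⟩

theorem pick_lt (h : K.pick x < K.n) :
    ∃ j < K.m, x (K.tl j) < x K.n ∧ x (K.hd j) = K.n + 1 ∧ K.pick x = K.hd j := by
  rcases pickUpTo_spec (K := K) x K.m with ⟨h₁, -⟩ | h₁
  · unfold pick at h; omega
  · exact h₁

theorem pick_not_lt (G : K.STGraph s t) (h : ¬ K.pick x < K.n) :
    ∀ j < K.m, ¬ (x (K.tl j) < x K.n ∧ x (K.hd j) = K.n + 1) := by
  rcases pickUpTo_spec (K := K) x K.m with ⟨-, h₁⟩ | ⟨j, h₁, -, -, h₂⟩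
  · exact h₁
  · exact absurd ((show K.pick x = K.hd j from h₂).trans_lt (G.hd_lt j h₁)) h

theorem next_of_lt {p : ℕ} (h : K.pick x < K.n) :
    K.next x p = Function.update x (K.pick x) (p + 1) := if_pos h

theorem next_of_not_lt {p : ℕ} (h : ¬ K.pick x < K.n) :
    K.next x p = K.forget (Function.update x K.n (x K.n + 1)) := if_neg h

/-- The level after placing a vertex. -/
theorem place_level : K.forget (Function.update x K.n (x K.n + 1)) K.n = x K.n + 1 := by
  simp [forget]

/-- The entries of the vertices after placing a vertex. -/
theorem place_apply (G : K.STGraph s t) {v : ℕ} (hv : v < K.n) :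
    K.forget (Function.update x K.n (x K.n + 1)) v = open Classical in
      if x v < x K.n + 1 ∧ ∀ j < K.m, K.tl j = v → x (K.hd j) < x K.n + 1 then 0 else x v := by
  have h : ∀ j < K.m, K.hd j ≠ K.n := fun j hj => (G.hd_lt j hj).ne
  simp only [forget, hv, true_and, Function.update_self, Function.update_of_ne hv.ne]
  congr 1
  simp only [eq_iff_iff, and_congr_right_iff]
  intro _
  refine forall₂_congr fun j hj => ?_
  rw [Function.update_of_ne (h j hj)]

theorem place_lt_iff (G : K.STGraph s t) {v : ℕ} (hv : v < K.n) :
    K.forget (Function.update x K.n (x K.n + 1)) v < x K.n + 1 ↔ x v < x K.n + 1 := by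
  rw [place_apply G hv]
  split_ifs with h
  · simp [h.1]
  · rfl

theorem place_of_ge (G : K.STGraph s t) {v : ℕ} (hv : v < K.n) (h : x K.n + 1 ≤ x v) :
    K.forget (Function.update x K.n (x K.n + 1)) v = x v := by
  rw [place_apply G hv, if_neg (by omega)]

theorem place_eq_or (G : K.STGraph s t) {v : ℕ} (hv : v < K.n) :
    K.forget (Function.update x K.n (x K.n + 1)) v = 0 ∨
      K.forget (Function.update x K.n (x K.n + 1)) v = x v := by
  rw [place_apply G hv]
  split_ifs <;> simp

theorem start_level : K.start K.n = 1 := by simp [start]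

theorem start_vertex {v : ℕ} (hv : v < K.n) : K.start v = 1 ∨ K.start v = K.n + 1 := by
  simp only [start, hv, if_true]
  split_ifs <;> simp

theorem start_eq_one (G : K.STGraph s t) {v : ℕ} (hv : v < K.n) : K.start v = 1 ↔ v = s := by
  rw [← G.source v hv]
  simp only [start, hv, if_true]
  have := G.s_lt
  split_ifs with h
  · simp only [Nat.add_eq_right]
    refine iff_of_false (by omega) ?_
    obtain ⟨i, h₁, h₂⟩ := h
    exact fun h' => h' i h₁ h₂
  · push Not at h
    exact iff_of_true rfl h

theorem inv_start (G : K.STGraph s t) : K.Inv s K.start := by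
  have pos : ∀ v < K.n, 1 ≤ K.start v := fun v hv => by
    rcases start_vertex hv with h | h <;> omega
  refine ⟨?_, start_level.ge, ?_, ?_, ?_, ?_, ?_, ?_, ?_, fun _ => rfl, ?_, ?_⟩
  · intro v
    unfold start
    split_ifs <;> omega
  · intro u hu v hv h h₁ h₂
    have hu' : K.start u = 1 := by rcases start_vertex hu with h | h <;> omega
    rw [(start_eq_one G hu).1 hu', (start_eq_one G hv).1 (h ▸ hu')]
  · intro j hj h
    have := pos _ (G.hd_lt j hj)
    rw [start_level] at h; omega
  · rw [start_level, Finset.card_eq_zero.2]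
    refine Finset.filter_eq_empty_iff.2 fun v hv => ?_
    have := pos v (Finset.mem_range.1 hv)
    omega
  · intro j hj h
    have := pos _ (G.tl_lt j hj)
    omega
  · intro v hv h
    have := pos v hv
    rw [start_level] at h; omega
  · intro v _ _ _ h
    rw [start_level] at h; omega
  · intro h
    rw [start_level] at h; omega
  · intro j hj h
    have := pos _ (G.tl_lt j hj)
    have := h.1
    rw [start_level] at this; omega
  · intro j hj
    simp [start, show ¬ j < K.n by omega, show j ≠ K.n by omega]

/-- A promised rank is at least the level, as was the previous entry n + 1, so no comparison with
the level changes and most clauses carry over. -/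
theorem inv_promise (G : K.STGraph s t) (I : K.Inv s x) {p : ℕ} (hp : p < K.n)
    (hg : K.Good x p) (h : K.pick x < K.n) : K.Inv s (K.next x p) := by
  obtain ⟨j₀, hj₀, h₁, h₂, h₃⟩ := pick_lt h
  obtain ⟨hf, hpl⟩ := hg
  rw [Fair, if_pos h] at hf
  rw [next_of_lt h] at hpl ⊢
  set w := K.pick x with hw
  have hxw : x w = K.n + 1 := by rw [h₃, h₂]
  have hn : Function.update x w (p + 1) K.n = x K.n := Function.update_of_ne h.ne' _ _
  have hlow : ∀ v, Function.update x w (p + 1) v < x K.n ↔ x v < x K.n := by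
    intro v
    by_cases e : v = w
    · subst e; simp; have := I.le K.n; omega
    · rw [Function.update_of_ne e]
  have hge : ∀ v, x K.n ≤ Function.update x w (p + 1) v ↔ x K.n ≤ x v := by
    intro v; rw [← not_lt, hlow, not_lt]
  have h0 : ∀ v, Function.update x w (p + 1) v < x K.n → Function.update x w (p + 1) v = x v := by
    intro v hv
    refine Function.update_of_ne ?_ _ _
    rintro rfl
    simp at hv; omega
  have hone := I.one_le
  refine ⟨?_, by rwa [hn], ?_, ?_, ?_, ?_, ?_, ?_, ?_, ?_, hpl, ?_⟩
  · intro v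
    by_cases e : v = w
    · subst e; simp; omega
    · rw [Function.update_of_ne e]; exact I.le v
  · intro u hu v hv e e₁ e₂
    by_cases e₃ : u = w <;> by_cases e₄ : v = w
    · rw [e₃, e₄]
    · subst e₃
      rw [Function.update_self, Function.update_of_ne e₄] at e
      exact absurd e.symm (hf.2 v hv)
    · subst e₄
      rw [Function.update_self, Function.update_of_ne e₃] at e
      exact absurd e (hf.2 u hu)
    · rw [Function.update_of_ne e₃] at e e₁ e₂
      rw [Function.update_of_ne e₄] at e
      exact I.inj u hu v hv e e₁ e₂
  · intro j hj
    rw [hn, hlow, hlow]; exact I.down j hj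
  · simp only [hn, hlow]; exact I.card
  · intro j hj e
    rw [hn, hlow]
    rw [h0 _ (by omega)] at e
    exact I.done j hj e
  · intro v hv e₁ e₂
    rw [hn] at e₁
    rw [h0 _ e₁] at e₂
    obtain ⟨j, hj, a₁, a₂⟩ := I.tail v hv ((hlow v).1 e₁) e₂
    exact ⟨j, hj, a₁, by rwa [hn, hge]⟩
  · intro v hv e₁ e₂ e₃
    rw [hn] at e₁ e₃
    by_cases e : v = w
    · exact ⟨j₀, hj₀, by rw [e, h₃], by rwa [hn, hlow]⟩
    · rw [Function.update_of_ne e] at e₁ e₂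
      obtain ⟨j, hj, a₁, a₂⟩ := I.head v hv e₁ e₂ e₃
      exact ⟨j, hj, a₁, by rwa [hn, hlow]⟩
  · rw [hn]
    intro e e'
    obtain ⟨j, hj, a₁, a₂⟩ := I.recent e e'
    refine ⟨j, hj, ?_, by rwa [hge]⟩
    rw [h0 _ ((hlow _).2 (by omega)), a₁]
  -- At level 1 nothing has been placed, so no edge has a placed tail and no promise can be made:
  -- the start is the only placement of that level.
  · rw [hn]
    intro e
    have : 0 < ((Finset.range K.n).filter fun v => x v < x K.n).card :=
      Finset.card_pos.2 ⟨K.tl j₀, by simp [G.tl_lt j₀ hj₀, h₁]⟩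
    have := I.card
    omega
  · intro j hj
    rw [Function.update_of_ne (by omega)]
    exact I.zero j hj

/-- The level never exceeds the number of vertices before the last step. -/
theorem Inv.exists_next (G : K.STGraph s t) (I : K.Inv s x) (hA : x K.n = 1 ∨ K.Alive x)
    (h : ¬ K.pick x < K.n) : ∃ v < K.n, x v = x K.n := by
  rcases hA with hA | ⟨j, hj, h₁, h₂ | h₂⟩
  · exact ⟨s, G.s_lt, by rw [hA, I.first hA, (start_eq_one G G.s_lt).2 rfl]⟩
  · exact absurd ⟨h₁, h₂⟩ (pick_not_lt G h j hj)
  · exact ⟨K.hd j, G.hd_lt j hj, h₂⟩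

/-- Exactly one vertex has been promised the current rank. It joins the placed vertices, which stay
down-closed because `Fair` requires its in-neighbours to be placed. -/
theorem inv_place (G : K.STGraph s t) (I : K.Inv s x) (hx : x K.n ≤ K.n)
    (hA : x K.n = 1 ∨ K.Alive x) {p : ℕ}
    (hg : K.Good x p) (h : ¬ K.pick x < K.n) : K.Inv s (K.next x p) := by
  classical
  obtain ⟨hf, hpl⟩ := hg
  rw [Fair, if_neg h] at hf
  obtain ⟨v₀, hv₀, hxv₀⟩ := I.exists_next G hA h
  have hpend := pick_not_lt G h
  rw [next_of_not_lt h] at hpl ⊢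
  have hn := place_level (K := K) (x := x)
  have hone := I.one_le
  have huniq : ∀ v < K.n, x v = x K.n → v = v₀ := fun v hv e =>
    I.inj v hv v₀ hv₀ (by rw [e, hxv₀]) (by omega) (by omega)
  have hset : ((Finset.range K.n).filter fun v => x v < x K.n + 1) =
      insert v₀ ((Finset.range K.n).filter fun v => x v < x K.n) := by
    ext v
    simp only [Finset.mem_filter, Finset.mem_range, Finset.mem_insert]
    constructor
    · rintro ⟨e₁, e₂⟩
      rcases Nat.lt_succ_iff_lt_or_eq.1 e₂ with e | e
      · exact .inr ⟨e₁, e⟩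
      · exact .inl (huniq v e₁ e)
    · rintro (rfl | ⟨e₁, e₂⟩)
      · exact ⟨hv₀, by omega⟩
      · exact ⟨e₁, by omega⟩
  have hcard : ((Finset.range K.n).filter fun v => x v < x K.n + 1).card = x K.n := by
    rw [hset, Finset.card_insert_of_notMem (by simp [hxv₀]), I.card]
  have hdown : ∀ j < K.m, x (K.hd j) < x K.n + 1 → x (K.tl j) < x K.n + 1 := by
    intro j hj e
    rcases Nat.lt_succ_iff_lt_or_eq.1 e with e | e
    · have := I.down j hj e; omega
    · have := hf j hj e; omega
  have hlow := fun {v : ℕ} (hv : v < K.n) => place_lt_iff (x := x) G hv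
  refine ⟨?_, by omega, ?_, ?_, ?_, ?_, ?_, ?_, ?_, by omega, hpl, ?_⟩
  · intro v
    by_cases e : v = K.n
    · rw [e, hn]; omega
    · unfold forget
      split_ifs
      · omega
      · rw [Function.update_of_ne e]; exact I.le v
  · intro u hu v hv e e₁ e₂
    have a := (place_eq_or (x := x) G hu).resolve_left (by omega)
    have b := (place_eq_or (x := x) G hv).resolve_left (by omega)
    rw [a] at e e₁ e₂
    rw [b] at e
    exact I.inj u hu v hv e e₁ e₂
  · intro j hj
    rw [hn, hlow (G.hd_lt j hj), hlow (G.tl_lt j hj)]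
    exact hdown j hj
  · rw [hn, ← hcard]
    congr 2
    exact Finset.filter_congr fun v hv => by rw [hcard, hlow (Finset.mem_range.1 hv)]
  · intro j hj e
    rw [hn, hlow (G.hd_lt j hj)]
    rw [place_apply G (G.tl_lt j hj)] at e
    split_ifs at e with e'
    · exact e'.2 j hj rfl
    · have := I.done j hj e; omega
  · intro v hv e₁ e₂
    rw [hn, hlow hv] at e₁
    rw [place_apply G hv] at e₂
    split_ifs at e₂ with e'
    · exact absurd rfl e₂
    · have : ¬ ∀ j < K.m, K.tl j = v → x (K.hd j) < x K.n + 1 := fun e => e' ⟨e₁, e⟩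
      push Not at this
      obtain ⟨j, hj, a₁, a₂⟩ := this
      exact ⟨j, hj, a₁, by rwa [hn, place_of_ge G (G.hd_lt j hj) a₂]⟩
  · intro v hv e₁ e₂ e₃
    rw [hn] at e₁
    rw [← not_lt, hlow hv, not_lt] at e₁
    rw [place_of_ge G hv e₁] at e₂
    obtain ⟨j, hj, a₁, a₂⟩ : ∃ j < K.m, K.hd j = v ∧ x (K.tl j) < x K.n + 1 := by
      by_cases e : 2 ≤ x K.n
      · obtain ⟨j, hj, a₁, a₂⟩ := I.head v hv (by omega) e₂ e
        exact ⟨j, hj, a₁, by omega⟩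
      · have hs := I.first (by omega)
        have := start_vertex hv
        rw [← hs] at this
        omega
    exact ⟨j, hj, a₁, by rwa [hn, hlow (G.tl_lt j hj)]⟩
  · rw [hn]
    intro _ e'
    -- Placing the sink would mean that all n vertices are placed, and the level would exceed n.
    have ht : v₀ ≠ t := by
      rintro rfl
      have := G.top {v | x v < x K.n + 1} hdown (by simp [hxv₀])
      have hall : ((Finset.range K.n).filter fun v => x v < x K.n + 1) = Finset.range K.n :=
        Finset.filter_true_of_mem fun v hv => this v (Finset.mem_range.1 hv)
      rw [hall, Finset.card_range] at hcard
      omega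
    obtain ⟨j, hj, a₁⟩ := G.sink v₀ hv₀ ht
    -- An out-neighbour placed earlier would by down-closedness have forced `v₀` to be placed
    -- earlier too.
    have hge : x K.n + 1 ≤ x (K.hd j) := by
      by_contra hlt
      rcases Nat.lt_succ_iff_lt_or_eq.1 (not_le.1 hlt) with e | e
      · have := I.down j hj e
        rw [a₁, hxv₀] at this; omega
      · exact G.noLoop j hj (by rw [a₁, huniq _ (G.hd_lt j hj) e])
    refine ⟨j, hj, ?_, by rwa [place_of_ge G (G.hd_lt j hj) hge]⟩
    rw [a₁, place_apply G hv₀, if_neg, hxv₀]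
    exact fun e => by have := e.2 j hj a₁; omega
  · intro j hj
    unfold forget
    rw [if_neg (by omega), Function.update_of_ne (by omega)]
    exact I.zero j hj

end Problem

namespace Problem

variable {K : Problem} {s t : ℕ} {x : ℕ → ℕ}

theorem Reach.inv (G : K.STGraph s t) (h : K.Reach x) :
    K.Inv s x ∧ x K.n ≤ K.n ∧ (x K.n = 1 ∨ K.Alive x) := by
  induction h with
  | start => exact ⟨inv_start G, by rw [start_level]; have := G.s_lt; omega, .inl start_level⟩
  | @next x p hx hp hg hn hA ih =>
    obtain ⟨I, h₁, h₂⟩ := ih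
    by_cases h : K.pick x < K.n
    · refine ⟨inv_promise G I hp hg h, ?_, .inr hA⟩
      rwa [next_of_lt h, Function.update_of_ne h.ne']
    · have I' := inv_place G I h₁ h₂ hg h
      have := I'.le K.n
      exact ⟨I', by omega, .inr hA⟩

/-! ### Solutions -/

/-- The assignment `ψ` of ranks completes the partial placement `x`. -/
structure Completes (K : Problem) (x ψ : ℕ → ℕ) : Prop where
  agree : ∀ v < K.n, 1 ≤ x v → x v ≤ K.n → ψ v = x v
  range : ∀ v < K.n, x K.n ≤ x v → x K.n ≤ ψ v ∧ ψ v ≤ K.n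
  -- Vertices with entry 0 stay unconstrained: their ranks are recorded only in earlier placements
  -- and are filled in on the way back.
  inj : ∀ u < K.n, ∀ v < K.n, x u ≠ 0 → x v ≠ 0 → ψ u = ψ v → u = v
  up : ∀ j < K.m, x K.n ≤ x (K.hd j) → ψ (K.tl j) < ψ (K.hd j)
  ok : ∀ j < K.m, ∀ j' < K.m, j ≠ j' → x K.n ≤ x (K.hd j) → x K.n ≤ x (K.hd j') →
    max (ψ (K.tl j)) (ψ (K.tl j')) < min (ψ (K.hd j)) (ψ (K.hd j')) →
    K.Ok (ψ (K.tl j)) (ψ (K.hd j)) (ψ (K.tl j')) (ψ (K.hd j'))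

/-- An assignment of ranks to all vertices without crossings. -/
structure Solution (K : Problem) (ψ : ℕ → ℕ) : Prop where
  range : ∀ v < K.n, 1 ≤ ψ v ∧ ψ v ≤ K.n
  inj : ∀ u < K.n, ∀ v < K.n, ψ u = ψ v → u = v
  up : ∀ j < K.m, ψ (K.tl j) < ψ (K.hd j)
  ok : ∀ j < K.m, ∀ j' < K.m, j ≠ j' →
    max (ψ (K.tl j)) (ψ (K.tl j')) < min (ψ (K.hd j)) (ψ (K.hd j')) →
    K.Ok (ψ (K.tl j)) (ψ (K.hd j)) (ψ (K.tl j')) (ψ (K.hd j'))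

/-- Replace the ranks in `ψ` by those in `x`. -/
def override (K : Problem) (x ψ : ℕ → ℕ) (v : ℕ) : ℕ := if 1 ≤ x v ∧ x v ≤ K.n then x v else ψ v

theorem Completes.solution (G : K.STGraph s t) {ψ : ℕ → ℕ} (h : K.Completes K.start ψ) :
    K.Solution ψ := by
  have pos : ∀ v < K.n, 1 ≤ K.start v := fun v hv => by
    rcases start_vertex hv with h | h <;> omega
  have hl := start_level (K := K)
  refine ⟨fun v hv => ?_, fun u hu v hv => ?_, fun j hj => ?_, fun j hj j' hj' hne => ?_⟩
  · have := h.range v hv (by rw [hl]; exact pos v hv)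
    rwa [hl] at this
  · exact h.inj u hu v hv (by have := pos u hu; omega) (by have := pos v hv; omega)
  · exact h.up j hj (by rw [hl]; exact pos _ (G.hd_lt j hj))
  · exact h.ok j hj j' hj' hne (by rw [hl]; exact pos _ (G.hd_lt j hj))
      (by rw [hl]; exact pos _ (G.hd_lt j' hj'))

/-- All ranks recorded before the promise are still recorded after it, so the override changes
nothing, and the remaining constraints before and after the promise coincide. -/
theorem completes_promise (G : K.STGraph s t) {ψ : ℕ → ℕ} {p : ℕ} (h : K.pick x < K.n)
    (hl : x K.n ≤ p + 1) (hx : x K.n ≤ K.n)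
    (hc : K.Completes (K.next x p) ψ) : K.Completes x (K.override x ψ) := by
  obtain ⟨j₀, hj₀, h₁, h₂, h₃⟩ := pick_lt h
  rw [next_of_lt h] at hc
  set w := K.pick x with hw
  have hxw : x w = K.n + 1 := by rw [h₃, h₂]
  have hn : Function.update x w (p + 1) K.n = x K.n := Function.update_of_ne h.ne' _ _
  have hge : ∀ v, x K.n ≤ Function.update x w (p + 1) v ↔ x K.n ≤ x v := by
    intro v
    by_cases e : v = w
    · subst e; simp; omega
    · rw [Function.update_of_ne e]
  have h0 : ∀ v, Function.update x w (p + 1) v ≠ 0 ↔ x v ≠ 0 := by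
    intro v
    by_cases e : v = w
    · subst e; simp; omega
    · rw [Function.update_of_ne e]
  have hψ : ∀ v < K.n, K.override x ψ v = ψ v := by
    intro v hv
    unfold override
    split_ifs with e
    · have hne : v ≠ w := by rintro rfl; omega
      have := hc.agree v hv
      rw [Function.update_of_ne hne] at this
      exact (this e.1 e.2).symm
    · rfl
  obtain ⟨a, b, c, d, e⟩ := hc
  simp only [hn, hge, h0] at b c d e
  refine ⟨fun v hv e₁ e₂ => by rw [override, if_pos ⟨e₁, e₂⟩], fun v hv => ?_,
    fun u hu v hv => ?_, fun j hj => ?_, fun j hj j' hj' => ?_⟩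
  · rw [hψ v hv]; exact b v hv
  · rw [hψ u hu, hψ v hv]; exact c u hu v hv
  · rw [hψ _ (G.tl_lt j hj), hψ _ (G.hd_lt j hj)]; exact d j hj
  · rw [hψ _ (G.tl_lt j hj), hψ _ (G.hd_lt j hj), hψ _ (G.tl_lt j' hj'), hψ _ (G.hd_lt j' hj')]
    exact e j hj j' hj'

/-- Constraints not covered by the successor involve the vertex just placed. For two overlapping
edges, one of which ends there, both tails are already placed. Since no head of the cut lacks a rank
at this moment, both edges belong to the cut of `x`, whose pairs have been tested. -/
theorem completes_place (G : K.STGraph s t) (I : K.Inv s x) {ψ : ℕ → ℕ} {p : ℕ}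
    (h : ¬ K.pick x < K.n) (hx : x K.n ≤ K.n) (hf : K.Fair x p)
    (hc : K.Completes (K.next x p) ψ) : K.Completes x (K.override x ψ) := by
  rw [Fair, if_neg h] at hf
  have hpend := pick_not_lt G h
  rw [next_of_not_lt h] at hc
  have hn := place_level (K := K) (x := x)
  have hone := I.one_le
  set y := K.forget (Function.update x K.n (x K.n + 1)) with hy
  obtain ⟨a, b, c, d, e⟩ := hc
  rw [hn] at b d e
  have hpos : ∀ j < K.m, x K.n ≤ x (K.hd j) → x (K.tl j) ≠ 0 := fun j hj h₁ h₂ => by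
    have := I.done j hj h₂; omega
  have low : ∀ v < K.n, x v ≠ 0 → x v ≤ x K.n → K.override x ψ v = x v := fun v hv h₁ h₂ => by
    rw [override, if_pos (by omega)]
  have hyx : ∀ v < K.n, x K.n < x v → y v = x v := fun v hv h₁ => place_of_ge G hv h₁
  have high : ∀ v < K.n, x K.n < x v → K.override x ψ v = ψ v := fun v hv h₁ => by
    unfold override
    split_ifs with h₂
    · rw [a v hv (by rw [hyx v hv h₁]; omega) (by rw [hyx v hv h₁]; omega), hyx v hv h₁]
    · rfl
  have highR : ∀ v < K.n, x K.n < x v → x K.n < ψ v ∧ ψ v ≤ K.n := fun v hv h₁ =>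
    b v hv (by rw [hyx v hv h₁]; omega)
  have hcut : ∀ j < K.m, x K.n < x (K.hd j) → K.override x ψ (K.tl j) = ψ (K.tl j) := by
    intro j hj h₁
    have h₂ := hpos j hj h₁.le
    have htl := G.tl_lt j hj
    by_cases h₃ : x K.n < x (K.tl j)
    · exact high _ htl h₃
    · have hytl : y (K.tl j) = x (K.tl j) := by
        rw [hy, place_apply G htl, if_neg]
        exact fun h₄ => by have := h₄.2 j hj rfl; omega
      rw [low _ htl h₂ (by omega), a _ htl (by omega) (by omega), hytl]
  have rangeO : ∀ v < K.n, x K.n ≤ x v → x K.n ≤ K.override x ψ v ∧ K.override x ψ v ≤ K.n := by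
    intro v hv h₁
    rcases h₁.eq_or_lt with h₁ | h₁
    · rw [low v hv (by omega) (by omega)]; omega
    · rw [high v hv h₁]; have := highR v hv h₁; omega
  have upO : ∀ j < K.m, x K.n ≤ x (K.hd j) →
      K.override x ψ (K.tl j) < K.override x ψ (K.hd j) := by
    intro j hj h₁
    rcases h₁.eq_or_lt with h₁ | h₁
    · have h₂ := hf j hj h₁.symm
      rw [low _ (G.tl_lt j hj) (hpos j hj h₁.le) h₂.le, low _ (G.hd_lt j hj) (by omega) h₁.ge]
      omega
    · rw [hcut j hj h₁, high _ (G.hd_lt j hj) h₁]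
      exact d j hj (by rw [hyx _ (G.hd_lt j hj) h₁]; omega)
  -- An edge to an unplaced vertex whose tail lies below the level is in the cut, and its ends have
  -- their recorded ranks: a head without a rank would have been picked first.
  have special : ∀ j < K.m, ∀ j' < K.m, x K.n ≤ x (K.hd j) → x K.n ≤ x (K.hd j') →
      K.override x ψ (K.tl j') < x K.n →
      K.Cut x j' ∧ K.override x ψ (K.tl j') = x (K.tl j') ∧
        K.override x ψ (K.hd j') = x (K.hd j') := by
    intro j hj j' hj' h₁ h₂ h₃
    have h₄ : x (K.tl j') < x K.n := by
      by_contra h₄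
      have := rangeO _ (G.tl_lt j' hj') (not_lt.1 h₄)
      omega
    have h₅ : x (K.hd j') ≤ K.n := by
      have := I.le (K.hd j')
      have := hpend j' hj'
      omega
    refine ⟨⟨h₄, h₂, h₅⟩, low _ (G.tl_lt j' hj') (hpos j' hj' h₂) h₄.le, ?_⟩
    rw [override, if_pos (by omega)]
  refine ⟨fun v hv e₁ e₂ => by rw [override, if_pos ⟨e₁, e₂⟩], rangeO, ?_, upO, ?_⟩
  · intro u hu v hv h₁ h₂ h₃
    by_cases h₄ : x K.n < x u <;> by_cases h₅ : x K.n < x v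
    · rw [high u hu h₄, high v hv h₅] at h₃
      exact c u hu v hv (by rwa [hyx u hu h₄]) (by rwa [hyx v hv h₅]) h₃
    · rw [high u hu h₄, low v hv h₂ (by omega)] at h₃
      have := highR u hu h₄; omega
    · rw [high v hv h₅, low u hu h₁ (by omega)] at h₃
      have := highR v hv h₅; omega
    · rw [low v hv h₂ (by omega), low u hu h₁ (by omega)] at h₃
      exact I.inj u hu v hv h₃ (by omega) (by omega)
  · intro j hj j' hj' hne h₁ h₂ h₃
    have h₄ := upO j hj h₁
    have h₅ := upO j' hj' h₂
    by_cases h₆ : x K.n < x (K.hd j) ∧ x K.n < x (K.hd j')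
    · rw [hcut j hj h₆.1, hcut j' hj' h₆.2, high _ (G.hd_lt j hj) h₆.1,
        high _ (G.hd_lt j' hj') h₆.2] at h₃ ⊢
      exact e j hj j' hj' hne (by rw [hyx _ (G.hd_lt j hj) h₆.1]; omega)
        (by rw [hyx _ (G.hd_lt j' hj') h₆.2]; omega) h₃
    -- One of the two heads is at the level, so a vertical overlap forces both tails below it.
    · have hlt : K.override x ψ (K.tl j) < x K.n ∧ K.override x ψ (K.tl j') < x K.n := by
        rcases not_and_or.1 h₆ with h₆ | h₆
        · rw [low (K.hd j) (G.hd_lt j hj) (by omega) (by omega)] at h₃; omega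
        · rw [low (K.hd j') (G.hd_lt j' hj') (by omega) (by omega)] at h₃; omega
      obtain ⟨c₁, t₁, d₁⟩ := special j' hj' j hj h₂ h₁ hlt.1
      obtain ⟨c₂, t₂, d₂⟩ := special j hj j' hj' h₁ h₂ hlt.2
      rw [t₁, t₂, d₁, d₂]
      exact I.planar j hj c₁ j' hj' c₂ hne

/-- Backward step of the reconstruction of a solution. -/
theorem Reach.completes (G : K.STGraph s t) (hr : K.Reach x) {ψ : ℕ → ℕ} {p : ℕ}
    (hg : K.Good x p) (hc : K.Completes (K.next x p) ψ) : K.Completes x (K.override x ψ) := by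
  obtain ⟨I, h₁, -⟩ := hr.inv G
  by_cases h : K.pick x < K.n
  · have hf := hg.1
    rw [Fair, if_pos h] at hf
    exact completes_promise G h hf.1 h₁ hc
  · exact completes_place G I h h₁ hg.1 hc

/-- The last step of the reconstruction of a solution. -/
theorem Reach.completes_of_accept (G : K.STGraph s t) (hr : K.Reach x) {p : ℕ}
    (ha : K.Accept x p) (ψ : ℕ → ℕ) : K.Completes x (K.override x ψ) := by
  obtain ⟨hp, hg, hn⟩ := ha
  refine hr.completes G hg ?_
  obtain ⟨I, h₁, h₂⟩ := hr.inv G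
  have h : ¬ K.pick x < K.n := fun h => by
    rw [next_of_lt h, Function.update_of_ne h.ne'] at hn; omega
  have I' := inv_place G I h₁ h₂ hg h
  have hall : ∀ v < K.n, K.next x p v < K.next x p K.n := by
    have := I'.card
    have e : ((Finset.range K.n).filter fun v => K.next x p v < K.next x p K.n) = Finset.range K.n :=
      Finset.eq_of_subset_of_card_le (Finset.filter_subset _ _) (by rw [Finset.card_range]; omega)
    intro v hv
    have hv' : v ∈ (Finset.range K.n).filter fun v => K.next x p v < K.next x p K.n := by
      rw [e]; simpa using hv
    exact (Finset.mem_filter.1 hv').2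
  -- With every vertex placed, no rank is needed any longer, so the final placement is completed by
  -- an arbitrary assignment.
  have hzero : ∀ v < K.n, K.next x p v = 0 := by
    intro v hv
    by_contra h₃
    obtain ⟨j, hj, -, h₄⟩ := I'.tail v hv (hall v hv) h₃
    have := hall _ (G.hd_lt j hj)
    omega
  refine ⟨fun v hv h₃ => ?_, fun v hv h₃ => ?_, fun u hu v hv h₃ => ?_, fun j hj h₃ => ?_,
    fun j hj j' hj' _ h₃ => ?_⟩
  · rw [hzero v hv] at h₃; omega
  · have := hall v hv; omega
  · exact absurd (hzero u hu) h₃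
  · have := hall _ (G.hd_lt j hj); omega
  · have := hall _ (G.hd_lt j hj); omega

/-- The partial placement `x` agrees with the assignment `ψ`. -/
structure Consistent (K : Problem) (x ψ : ℕ → ℕ) : Prop where
  zero : ∀ v < K.n, x v = 0 → ψ v < x K.n
  eq : ∀ v < K.n, 1 ≤ x v → x v ≤ K.n → ψ v = x v
  free : ∀ v < K.n, x v = K.n + 1 → x K.n ≤ ψ v

theorem Consistent.lt_iff {ψ : ℕ → ℕ} (C : K.Consistent x ψ) (hle : ∀ v, x v ≤ K.n + 1)
    (hone : 1 ≤ x K.n) {v : ℕ} (hv : v < K.n) :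
    ψ v < x K.n ↔ x v < x K.n := by
  have := hle v
  rcases Nat.eq_zero_or_pos (x v) with h | h
  · exact iff_of_true (C.zero v hv h) (by omega)
  · rcases Nat.lt_or_ge K.n (x v) with h' | h'
    · have := C.free v hv (by omega)
      have := hle K.n
      omega
    · rw [C.eq v hv h h']

/-- The ends of cut edges have nonzero recorded ranks, which agree with those of the solution. Any
two cut edges overlap vertically, since both tails are below the level and both heads are not, so
the solution's own condition applies. -/
theorem Consistent.planar (G : K.STGraph s t) {ψ : ℕ → ℕ} (hs : K.Solution ψ) {y : ℕ → ℕ}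
    (C : K.Consistent y ψ) (hd : ∀ j < K.m, y (K.tl j) = 0 → y (K.hd j) < y K.n) :
    K.Planar y := by
  have key : ∀ j < K.m, K.Cut y j → ψ (K.tl j) = y (K.tl j) ∧ ψ (K.hd j) = y (K.hd j) := by
    rintro j hj ⟨h₁, h₂, h₃⟩
    have h₄ : y (K.tl j) ≠ 0 := fun h => by have := hd j hj h; omega
    exact ⟨C.eq _ (G.tl_lt j hj) (by omega) (by omega), C.eq _ (G.hd_lt j hj) (by omega) h₃⟩
  intro j hj hc j' hj' hc' hne
  have h := hs.ok j hj j' hj' hne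
  rw [(key j hj hc).1, (key j hj hc).2, (key j' hj' hc').1, (key j' hj' hc').2] at h
  refine h ?_
  obtain ⟨h₁, h₂, h₃⟩ := hc
  obtain ⟨h₁', h₂', h₃'⟩ := hc'
  omega

theorem Solution.exists_rank {ψ : ℕ → ℕ} (hs : K.Solution ψ) {r : ℕ} (h₁ : 1 ≤ r) (h₂ : r ≤ K.n) :
    ∃ v < K.n, ψ v = r := by
  have := Finset.surj_on_of_inj_on_of_card_le (s := Finset.range K.n) (t := Finset.Icc 1 K.n)
    (fun v _ => ψ v) (fun v hv => by
      have := hs.range v (Finset.mem_range.1 hv); simpa using this)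
    (fun u v hu hv e => hs.inj u (Finset.mem_range.1 hu) v (Finset.mem_range.1 hv) e)
    (by simp) r (by simp [h₁, h₂])
  obtain ⟨v, hv, e⟩ := this
  exact ⟨v, Finset.mem_range.1 hv, e.symm⟩

/-- The vertex of rank 1 can have no in-neighbour, so it is the source; every other vertex has one.
-/
theorem Solution.exists_in (G : K.STGraph s t) {ψ : ℕ → ℕ} (hs : K.Solution ψ) {v : ℕ}
    (hv : v < K.n) (h : 2 ≤ ψ v) : ∃ j < K.m, K.hd j = v := by
  have rank1 : ∀ u < K.n, ψ u = 1 → u = s := by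
    intro u hu e
    refine (G.source u hu).1 fun j hj e' => ?_
    have := hs.up j hj
    have := hs.range _ (G.tl_lt j hj)
    rw [e'] at *; omega
  obtain ⟨u, hu, e⟩ := hs.exists_rank le_rfl (show 1 ≤ K.n by omega)
  have hus := rank1 u hu e
  by_contra hne
  push Not at hne
  have := (G.source v hv).1 hne
  rw [this, ← hus] at h
  omega

/-- The vertex that the solution puts at the level has an in-neighbour, which is ranked lower and
hence placed. The vertex itself either has been promised this rank or has none yet. -/
theorem Consistent.alive (G : K.STGraph s t) {ψ : ℕ → ℕ} (hs : K.Solution ψ) {y : ℕ → ℕ}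
    (C : K.Consistent y ψ) (hle : ∀ v, y v ≤ K.n + 1) (h₁ : 2 ≤ y K.n) (h₂ : y K.n ≤ K.n) :
    K.Alive y := by
  obtain ⟨v, hv, e⟩ := hs.exists_rank (show 1 ≤ y K.n by omega) h₂
  obtain ⟨j, hj, rfl⟩ := hs.exists_in G hv (by omega)
  have hup := hs.up j hj
  refine ⟨j, hj, (C.lt_iff hle (by omega) (G.tl_lt j hj)).1 (by omega), ?_⟩
  have h₃ : ¬ y (K.hd j) < y K.n := fun h => by
    have := (C.lt_iff hle (by omega) hv).2 h; omega
  by_cases h : y (K.hd j) ≤ K.n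
  · right
    rw [← C.eq _ hv (by omega) h, e]
  · left
    have := hle (K.hd j); omega

/-- A solution leads the search from every consistent placement to acceptance. -/
theorem Reach.exists_accept (G : K.STGraph s t) {ψ : ℕ → ℕ} (hs : K.Solution ψ) :
    ∀ N, ∀ x, K.Reach x → K.Consistent x ψ →
      (K.n + 1 - x K.n) * (K.n + 1) + ((Finset.range K.n).filter fun v => x v = K.n + 1).card ≤ N →
      ∃ x' p, K.Reach x' ∧ K.Accept x' p := by
  -- The measure is lexicographic: a promise reduces the number of vertices without a rank, and
  -- placing a vertex raises the level, which is worth n + 1 and outweighs any change of that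
  -- number.
  intro N
  induction N using Nat.strong_induction_on with
  | _ N ih =>
    intro x hr C hN
    obtain ⟨I, hx, hA⟩ := hr.inv G
    have hone := I.one_le
    by_cases h : K.pick x < K.n
    · obtain ⟨j₀, hj₀, h₁, h₂, h₃⟩ := pick_lt h
      have hrw := hs.range _ h
      have hψw := C.free _ h (by rw [h₃, h₂])
      have hp : ψ (K.pick x) - 1 < K.n := by omega
      -- The step with parameter `p` promises the rank `p + 1`, whence the shift by one.
      have hnx : K.next x (ψ (K.pick x) - 1) = Function.update x (K.pick x) (ψ (K.pick x)) := by
        rw [next_of_lt h]; congr 1; omega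
      set y := Function.update x (K.pick x) (ψ (K.pick x)) with hy
      have hn : y K.n = x K.n := Function.update_of_ne h.ne' _ _
      have hyle : ∀ v, y v ≤ K.n + 1 := by
        intro v
        by_cases e : v = K.pick x
        · rw [e, hy, Function.update_self]; omega
        · rw [hy, Function.update_of_ne e]; exact I.le v
      have C' : K.Consistent y ψ := by
        refine ⟨fun v hv => ?_, fun v hv => ?_, fun v hv => ?_⟩ <;> rw [hn] at * <;>
        by_cases e : v = K.pick x
        · rw [e, hy, Function.update_self]; omega
        · rw [hy, Function.update_of_ne e]; exact C.zero v hv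
        · rw [e, hy, Function.update_self]; simp
        · rw [hy, Function.update_of_ne e]; exact C.eq v hv
        · rw [e, hy, Function.update_self]; omega
        · rw [hy, Function.update_of_ne e]; exact C.free v hv
      have hg : K.Good x (ψ (K.pick x) - 1) := by
        refine ⟨?_, ?_⟩
        · rw [Fair, if_pos h]
          refine ⟨by omega, fun v hv e => ?_⟩
          have e₂ := C.eq v hv (by omega) (by omega)
          have e₃ := hs.inj v hv _ h (by omega)
          rw [e₃, show x (K.pick x) = K.n + 1 by rw [h₃, h₂]] at e
          omega
        · rw [hnx]
          refine C'.planar G hs fun j hj e => ?_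
          have hne : K.tl j ≠ K.pick x := by
            intro e'; rw [e', hy, Function.update_self] at e; omega
          rw [hy, Function.update_of_ne hne] at e
          have h₄ := I.done j hj e
          have hne' : K.hd j ≠ K.pick x := by
            intro e'; rw [e', h₃, h₂] at h₄; omega
          rw [hn, hy, Function.update_of_ne hne']
          exact h₄
      have h2 : 2 ≤ x K.n := by
        have := C.lt_iff I.le hone (G.tl_lt j₀ hj₀)
        have := hs.range _ (G.tl_lt j₀ hj₀)
        omega
      have hr' : K.Reach (K.next x (ψ (K.pick x) - 1)) := by
        refine hr.next hp hg (by rw [hnx, hn]; omega) ?_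
        rw [hnx]
        exact C'.alive G hs hyle (by omega) (by omega)
      rw [hnx] at hr'
      refine ih _ ?_ y hr' C' le_rfl
      refine lt_of_lt_of_le ?_ hN
      rw [hn]
      refine Nat.add_lt_add_left (Finset.card_lt_card ?_) _
      rw [Finset.ssubset_iff_of_subset]
      · refine ⟨K.pick x, by simp [h]; rw [h₃, h₂], ?_⟩
        simp [hy]; omega
      · intro v
        simp only [Finset.mem_filter, Finset.mem_range]
        rintro ⟨hv, e⟩
        refine ⟨hv, ?_⟩
        rwa [hy, Function.update_of_ne] at e
        rintro rfl
        rw [Function.update_self] at e; omega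
    · have hpend := pick_not_lt G h
      have hnx : K.next x 0 = K.forget (Function.update x K.n (x K.n + 1)) := next_of_not_lt h
      have hn := place_level (K := K) (x := x)
      set y := K.forget (Function.update x K.n (x K.n + 1)) with hy
      have hnpos : 0 < K.n := by have := G.s_lt; omega
      have hlow := fun {v : ℕ} (hv : v < K.n) => place_lt_iff (x := x) G hv
      have hyle : ∀ v, y v ≤ K.n + 1 := by
        intro v
        by_cases e : v = K.n
        · rw [e, hn]; omega
        · rw [hy]; unfold forget
          split_ifs
          · omega
          · rw [Function.update_of_ne e]; exact I.le v
      -- The solution's vertex at the level has a placed in-neighbour, so it heads an edge leaving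
      -- the placed set and must have a rank, the level by consistency. At level 1 it is the source.
      have hlvl : ∀ v < K.n, ψ v = x K.n → x v = x K.n := by
        intro v hv e
        have h₁ : ¬ x v < x K.n := fun h => by have := (C.lt_iff I.le hone hv).2 h; omega
        rcases Nat.lt_or_ge K.n (x v) with h₂ | h₂
        · exfalso
          have h₃ : x v = K.n + 1 := by have := I.le v; omega
          by_cases h₄ : 2 ≤ ψ v
          · obtain ⟨j, hj, rfl⟩ := hs.exists_in G hv h₄
            have := hs.up j hj
            exact hpend j hj ⟨(C.lt_iff I.le hone (G.tl_lt j hj)).1 (by omega), h₃⟩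
          · have h₅ := I.first (by omega)
            have h₆ := (start_eq_one G G.s_lt).2 rfl
            rw [← h₅] at h₆
            have h₇ := C.eq s G.s_lt (by omega) (by omega)
            have h₈ := hs.inj v hv s G.s_lt (by omega)
            rw [h₈] at h₃; omega
        · rw [← C.eq v hv (by omega) h₂, e]
      have C' : K.Consistent y ψ := by
        have hlt : ∀ v < K.n, ψ v < x K.n + 1 ↔ x v < x K.n + 1 := by
          intro v hv
          have := C.lt_iff I.le hone hv
          have e₁ := hlvl v hv
          constructor
          · intro h; rcases Nat.lt_succ_iff_lt_or_eq.1 h with h | h <;> omega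
          · intro h; rcases Nat.lt_succ_iff_lt_or_eq.1 h with h | h
            · omega
            · rw [C.eq v hv (by omega) (by omega)]; omega
        refine ⟨fun v hv e => ?_, fun v hv e₁ e₂ => ?_, fun v hv e => ?_⟩
        · rw [hn, hlt v hv, ← hlow hv, ← hy, e]; omega
        · have e := (place_eq_or (x := x) G hv).resolve_left (by rw [← hy]; omega)
          rw [← hy] at e
          rw [e]
          exact C.eq v hv (by omega) (by omega)
        · rw [hn, ← not_lt, hlt v hv, ← hlow hv, ← hy, e]; omega
      have hg : K.Good x 0 := by
        refine ⟨?_, ?_⟩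
        · rw [Fair, if_neg h]
          intro j hj e
          have e₁ := C.eq _ (G.hd_lt j hj) (by omega) (by omega)
          have := hs.up j hj
          exact (C.lt_iff I.le hone (G.tl_lt j hj)).1 (by omega)
        · rw [hnx]
          refine C'.planar G hs fun j hj e => ?_
          rw [hn, hy, hlow (G.hd_lt j hj)]
          rw [hy, place_apply G (G.tl_lt j hj)] at e
          split_ifs at e with e'
          · exact e'.2 j hj rfl
          · have := I.done j hj e; omega
      by_cases hlast : x K.n = K.n
      · exact ⟨x, 0, hr, hnpos, hg, by rw [hnx, hn, hlast]⟩
      have hr' : K.Reach (K.next x 0) := by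
        refine hr.next hnpos hg (by rw [hnx, hn]; omega) ?_
        rw [hnx]
        exact C'.alive G hs hyle (by omega) (by omega)
      rw [hnx] at hr'
      refine ih _ ?_ y hr' C' le_rfl
      refine lt_of_lt_of_le ?_ hN
      rw [hn]
      have h₁ : ((Finset.range K.n).filter fun v => y v = K.n + 1).card ≤ K.n := by
        simpa using Finset.card_filter_le (Finset.range K.n) (fun v => y v = K.n + 1)
      have h₂ : K.n + 1 - x K.n = (K.n + 1 - (x K.n + 1)) + 1 := by omega
      rw [h₂, Nat.add_mul, Nat.one_mul]
      omega

theorem exists_accept (G : K.STGraph s t) {ψ : ℕ → ℕ} (hs : K.Solution ψ) :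
    ∃ x p, K.Reach x ∧ K.Accept x p := by
  refine Reach.exists_accept G hs _ K.start .start ⟨fun v hv h => ?_, fun v hv h₁ h₂ => ?_,
    fun v hv _ => ?_⟩ le_rfl
  · rcases start_vertex hv with h' | h' <;> omega
  · have h₃ : K.start v = 1 := by rcases start_vertex hv with h' | h' <;> omega
    have h₄ := (start_eq_one G hv).1 h₃
    by_contra h₅
    obtain ⟨j, hj, h₆⟩ := hs.exists_in G hv (by have := hs.range v hv; omega)
    exact (G.source v hv).2 h₄ j hj h₆
  · rw [start_level]; exact (hs.range v hv).1

end Problem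

/-! ### The search -/

namespace Problem

variable {K : Problem}

theorem child_congr {mem mem' : ℕ → ℕ} (h : ∀ a, 2 * K.m + 3 * K.n + 2 ≤ a → mem' a = mem a) :
    K.child mem' = K.child mem := by
  funext r d
  exact h _ (by unfold cell; omega)

theorem key_congr {mem mem' : ℕ → ℕ} (h : ∀ a, 2 * K.m + 3 * K.n + 2 ≤ a → mem' a = mem a) :
    K.key mem' = K.key mem := by
  funext q j
  unfold key
  rw [h _ (by unfold cell; omega)]

theorem pred_congr {mem mem' : ℕ → ℕ} (h : ∀ a, 2 * K.m + 3 * K.n + 2 ≤ a → mem' a = mem a) :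
    K.pred mem' = K.pred mem := by
  funext q
  exact h _ (by unfold cell; omega)

theorem Trie.congr {mem mem' : ℕ → ℕ} {R Q : ℕ} {len : ℕ → ℕ} {pre : ℕ → ℕ → ℕ}
    (T : K.Trie mem R Q len pre) (h : ∀ a, 2 * K.m + 3 * K.n + 2 ≤ a → mem' a = mem a) :
    K.Trie mem' R Q len pre := by
  have hc := child_congr h
  have hk := key_congr h
  refine ⟨T.pos, T.root, ?_, ?_, ?_, ?_, ?_, ?_⟩
  · rw [hc]; exact T.node
  · rw [hc, hk]; exact T.leaf
  · rw [hc]; exact T.fresh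
  · simp only [Path, hc, hk]; exact T.path
  · rw [hk]; exact T.digit
  · rw [hk]; exact T.inj

/-- Every set of reachable placements has at most `N` elements. -/
def Bounded (K : Problem) (N : ℕ) : Prop :=
  ∀ F : Finset (ℕ → ℕ), (∀ x ∈ F, K.Reach x) → F.card ≤ N

end Problem

/-- The invariant of the search; `m₀` is the memory at the beginning. -/
structure Search (K : Problem) (m₀ : ℕ → ℕ) (s : HS) : Prop where
  env : Env K s
  trie : ∃ len pre, K.Trie s.mem (s.v .cnt) (s.v .qc) len pre
  -- The root and at most n nodes for each of the `qc - 1` stored placements.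
  count : s.v .cnt + K.n ≤ 1 + K.n * s.v .qc
  qc : 2 ≤ s.v .qc
  low : ∀ a < 2 * K.m + 2 * K.n + 1, s.mem a = m₀ a
  first : K.key s.mem 1 = K.start ∧ K.pred s.mem 1 = 0
  chain : ∀ q, 2 ≤ q → q < s.v .qc → 1 ≤ K.pred s.mem q ∧ K.pred s.mem q < q ∧
    ∃ p < K.n, K.Good (K.key s.mem (K.pred s.mem q)) p ∧
      K.key s.mem q = K.next (K.key s.mem (K.pred s.mem q)) p
  reach : ∀ q, 1 ≤ q → q < s.v .qc → K.Reach (K.key s.mem q)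
  found : s.v .found < s.v .qc ∧ (s.v .found ≠ 0 → ∃ p, K.Accept (K.key s.mem (s.v .found)) p)

/-- The step `p` from the placement `q` has been explored. -/
def Explored (K : Problem) (s : HS) (q p : ℕ) : Prop :=
  (K.Good (K.key s.mem q) p → K.next (K.key s.mem q) p K.n ≠ K.n + 1 →
    K.Alive (K.next (K.key s.mem q) p) →
    ∃ q', 1 ≤ q' ∧ q' < s.v .qc ∧ K.key s.mem q' = K.next (K.key s.mem q) p) ∧
  (K.Accept (K.key s.mem q) p → s.v .found ≠ 0)

/-- The search has made progress from `s` to `s'`. -/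
structure Progress (K : Problem) (s s' : HS) : Prop where
  qc : s.v .qc ≤ s'.v .qc
  key : ∀ q, 1 ≤ q → q < s.v .qc → K.key s'.mem q = K.key s.mem q
  found : s.v .found ≠ 0 → s'.v .found ≠ 0

variable {K : Problem} {L W B : ℕ} {s : HS} {m₀ : ℕ → ℕ}

theorem Progress.refl (s : HS) : Progress K s s := ⟨le_rfl, fun _ _ _ => rfl, id⟩

theorem Progress.trans {s' s'' : HS} (h : Progress K s s') (h' : Progress K s' s'') :
    Progress K s s'' where
  qc := h.qc.trans h'.qc
  key q h₁ h₂ := (h'.key q h₁ (h₂.trans_le h.qc)).trans (h.key q h₁ h₂)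
  found h₁ := h'.found (h.found h₁)

theorem Explored.mono {s' : HS} {q p : ℕ} (h : Explored K s q p) (hP : Progress K s s')
    (h₁ : 1 ≤ q) (h₂ : q < s.v .qc) : Explored K s' q p := by
  unfold Explored
  rw [hP.key q h₁ h₂]
  refine ⟨fun a b c => ?_, fun a => hP.found (h.2 a)⟩
  obtain ⟨q', e₁, e₂, e₃⟩ := h.1 a b c
  exact ⟨q', e₁, e₂.trans_le hP.qc, by rw [hP.key q' e₁ e₂, e₃]⟩

/-- Stored keys are pairwise distinct and reachable, so the bound on reachable placements limits
their number. -/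
theorem Search.qc_le {N : ℕ} (h : Search K m₀ s) (hN : K.Bounded N) : s.v .qc ≤ N + 1 := by
  obtain ⟨len, pre, T⟩ := h.trie
  classical
  have := hN ((Finset.Ico 1 (s.v .qc)).image (K.key s.mem)) (fun x hx => by
    obtain ⟨q, hq, rfl⟩ := Finset.mem_image.1 hx
    rw [Finset.mem_Ico] at hq
    exact h.reach q hq.1 hq.2)
  rw [Finset.card_image_of_injOn, Nat.card_Ico] at this
  · omega
  · intro q hq q' hq' e
    simp only [Finset.coe_Ico, Set.mem_Ico] at hq hq'
    exact T.inj q q' hq.1 hq.2 hq'.1 hq'.2 e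

theorem Search.congr {s' : HS} (h : Search K m₀ s) (hv : ∀ x ∈ envVars, s'.v x = s.v x)
    (hc : s'.v .cnt = s.v .cnt) (hq : s'.v .qc = s.v .qc) (hf : s'.v .found = s.v .found)
    (hm : Cmd.OnlyArr K s s') (hr : s'.rmem = s.rmem) : Search K m₀ s' := by
  have hm' : ∀ a, 2 * K.m + 3 * K.n + 2 ≤ a → s'.mem a = s.mem a := fun a ha => hm a (by omega)
  obtain ⟨len, pre, T⟩ := h.trie
  refine ⟨h.env.congr hv (fun a ha => hm a (by omega)) hr, ⟨len, pre, ?_⟩, ?_, ?_, ?_, ?_, ?_, ?_, ?_⟩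
  · rw [hc, hq]; exact T.congr hm'
  · rw [hc, hq]; exact h.count
  · rw [hq]; exact h.qc
  · exact fun a ha => (hm a (by omega)).trans (h.low a ha)
  · rw [Problem.key_congr hm', Problem.pred_congr hm']; exact h.first
  · rw [Problem.key_congr hm', Problem.pred_congr hm', hq]; exact h.chain
  · rw [Problem.key_congr hm', hq]; exact h.reach
  · rw [Problem.key_congr hm', hq, hf]; exact h.found

theorem Search.frame {s' : HS} (h : Search K m₀ s) {c : Cmd} (F : c.Frame s s')
    (hv : ∀ x ∈ .cnt :: .qc :: .found :: envVars, x ∉ c.writes)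
    (hm : Cmd.OnlyArr K s s') (hr : c.noRStore = true) : Search K m₀ s' :=
  h.congr (fun x hx => F.var x (hv x (by simp [hx]))) (F.var _ (hv _ (by simp)))
    (F.var _ (hv _ (by simp))) (F.var _ (hv _ (by simp))) hm (F.rmem hr)

theorem Progress.of_onlyArr {s' : HS} (hm : Cmd.OnlyArr K s s') (hq : s'.v .qc = s.v .qc)
    (hf : s'.v .found = s.v .found) : Progress K s s' where
  qc := hq.ge
  key q _ _ := by rw [Problem.key_congr (fun a ha => hm a (by omega))]
  found h := by rwa [hf]

namespace Cmd

open Ex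

/-- The address of the record of the placement `q`. -/
def recQ : Ex := add (var .Bs) (mul (add (mul (lit 2) (var .q)) (lit 1)) (var .S))

/-- Load the placement `q` into the work array. -/
def loadC : Cmd := loop .j .n1 (store (add (var .X) (var .j)) (get (add recQ (var .j))))

/-- Explore the step `p` from the placement `q`. -/
def exploreC : Cmd :=
  loadC ;; stepC ;;
  ifEq (var .flag) (lit 1)
    (ifEq (var .lvl) (var .n1) (assign .found (var .q))
      (aliveC ;; ifEq (var .g) (lit 1) insertC skip)) skip

/-- Explore all steps from the placement `q`. -/
def visitC : Cmd := loop .p .n exploreC ;; assign .q (add (var .q) (lit 1))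

theorem recQ_val (hBs : s.v .Bs = 2 * K.m + 3 * K.n + 2) (hS : s.v .S = K.n + 2) (d : ℕ) :
    recQ.val s + d = K.cell (2 * s.v .q + 1) d := by
  simp [recQ, hBs, hS, Problem.cell]

theorem recQ_safe (hBs : s.v .Bs = 2 * K.m + 3 * K.n + 2) (hS : s.v .S = K.n + 2)
    (hW : L ≤ W) {M : ℕ} (hM : Room K L M) (hq : s.v .q ≤ M) :
    recQ.Safe L W s := by
  have h := K.cell_lt (r := 2 * s.v .q + 1) (d := 0) (by omega) (by omega) hM
  have hn : 2 * s.v .q + 1 ≤ (2 * s.v .q + 1) * (K.n + 2) := Nat.le_mul_of_pos_right _ (by omega)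
  simp only [recQ, Ex.Safe, Ex.val, hBs, hS, true_and]
  unfold Problem.cell at h
  omega

theorem loadC_spec (E : Env K s) (H : K.Fits L W B) {M : ℕ} (hM : Room K L M) (hq : s.v .q ≤ M) :
    loadC.wp L W B (fun s' => K.arr s' = K.key s.mem (s.v .q) ∧ OnlyArr K s s') s := by
  have hB := H.loop
  have hW := H.word; have hL := H.mem
  refine wp_loop (fun j s' => (∀ i < j, K.arr s' i = K.key s.mem (s.v .q) i) ∧ OnlyArr K s s')
    (by simp [E.n1]; omega) ?_ ?_ ?_ ?_
  · intro j s' k h; exact h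
  · exact ⟨by simp, OnlyArr.refl _⟩
  · rintro j s' hj ⟨hI, hO⟩ hjv hF
    have E₁ := Env.onlyArr E hF (by decide) hO (by decide)
    have hj' : j ≤ K.n := by rw [E.n1] at hj; omega
    have hqv : s'.v .q = s.v .q := hF.var _ (by decide)
    have hlt := K.cell_lt (r := 2 * s.v .q + 1) (d := j) (by omega) (by omega) hM
    have hrec := recQ_val E₁.Bs E₁.S j
    rw [hqv] at hrec
    simp only [wp]
    simp only [Ex.val, Ex.Safe, hjv, hrec, E₁.X, true_and]
    refine ⟨by omega, ⟨⟨recQ_safe E₁.Bs E₁.S hW hM (by omega), by omega⟩, hlt⟩, by omega, ?_,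
      hO.trans (.setMem _ hj' _)⟩
    intro i hi
    rw [K.arr_setMem hj']
    rcases Nat.lt_succ_iff_lt_or_eq.1 hi with h | rfl
    · rw [Function.update_of_ne h.ne]; exact hI i h
    · rw [Function.update_self, hO _ (by unfold Problem.cell; omega), Problem.key, if_pos hj']
  · rintro s' ⟨hI, hO⟩ _
    refine ⟨?_, hO⟩
    funext i
    by_cases h : i ≤ K.n
    · exact hI i (by rw [E.n1]; omega)
    · simp [Problem.arr, Problem.key, h]

/-- A successor is stored only under the conditions in `Reach.next`. Everything stored is therefore
reachable, and `Bounded` guarantees that the memory suffices. An accepting step is merely noted in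
`found`; the search continues. -/
theorem exploreC_spec {t t' : ℕ} (G : K.STGraph t t') (S : Search K m₀ s) (H : K.Fits L W B) {M N : ℕ}
    (hM : Room K L M)
    (hN : K.Bounded N) (hNM : 1 + K.n * (N + 1) ≤ M) (h₁ : 1 ≤ s.v .q) (h₂ : s.v .q < s.v .qc)
    (hp : s.v .p < K.n) :
    exploreC.wp L W B (fun s' => Search K m₀ s' ∧ Progress K s s' ∧
      Explored K s' (s.v .q) (s.v .p)) s := by
  have hpos := H.pos
  have hnN : N + 1 ≤ K.n * (N + 1) := Nat.le_mul_of_pos_left _ hpos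
  have hqc := S.qc_le hN
  have hr := S.reach _ h₁ h₂
  set x := K.key s.mem (s.v .q) with hx
  obtain ⟨Ix, hlx, -⟩ := hr.inv G
  have hW := H.word; have hL := H.mem
  refine wp_seq (loadC_spec S.env H hM (by omega)) ?_
  rintro s₁ ⟨a₁, O₁⟩ F₁
  have S₁ := S.frame F₁ (by decide) O₁ (by decide)
  have P₁ : Progress K s s₁ := .of_onlyArr O₁ (F₁.var _ (by decide)) (F₁.var _ (by decide))
  have q₁ : s₁.v .q = s.v .q := F₁.var _ (by decide)
  have p₁ : s₁.v .p = s.v .p := F₁.var _ (by decide)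
  refine wp_seq (stepC_spec S₁.env H (by rw [a₁]; exact hlx) (by rwa [p₁])) ?_
  rintro s₂ ⟨a₂, l₂, O₂, f₂⟩ F₂
  rw [a₁, p₁] at a₂ f₂
  have S₂ := S₁.frame F₂ (by decide) O₂ (by decide)
  have P₂ := P₁.trans (.of_onlyArr O₂ (F₂.var _ (by decide)) (F₂.var _ (by decide)))
  have q₂ : s₂.v .q = s.v .q := (F₂.var _ (by decide)).trans q₁
  have hx₂ : K.key s₂.mem (s.v .q) = x := P₂.key _ h₁ h₂
  have hqc₂ : s₂.v .qc = s.v .qc := (F₂.var _ (by decide)).trans (F₁.var _ (by decide))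
  have hl₂ : s₂.v .lvl = K.next x (s.v .p) K.n := by rw [l₂, a₂]
  refine ⟨trivial, show 1 ≤ W by omega, fun hf => ?_, fun hf => ?_⟩ <;> simp only [Ex.val] at hf
  · have hg := f₂.1 hf
    refine ⟨trivial, trivial, fun hv => ?_, fun hv => ?_⟩ <;>
    simp only [Ex.val, S₂.env.n1, hl₂] at hv
    · refine ⟨trivial, ?_⟩
      simp only [Ex.val, q₂]
      have hacc : K.Accept x (s.v .p) := ⟨hp, hg, hv⟩
      have P₃ : Progress K s₂ (s₂.set .found (s.v .q)) := ⟨by simp, fun _ _ _ => rfl, fun _ => by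
        simp; omega⟩
      refine ⟨?_, P₂.trans P₃, ?_⟩
      · refine ⟨S₂.env.set (by decide), by simpa using S₂.trie, by simpa using S₂.count,
          by simpa using S₂.qc, S₂.low, S₂.first, by simpa using S₂.chain, by simpa using S₂.reach, ?_⟩
        simp only [HS.set_v, HS.set_mem, if_true, hx₂]
        exact ⟨by simpa [hqc₂] using h₂, fun _ => ⟨_, hacc⟩⟩
      · unfold Explored
        simp only [HS.set_v, HS.set_mem, hx₂]
        exact ⟨fun _ h => absurd hv h, fun _ => by simp; omega⟩
    · refine wp_seq (aliveC_spec S₂.env H l₂) ?_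
      intro s₃ g₃ F₃
      rw [a₂] at g₃
      have O₃ : OnlyArr K s₂ s₃ := .of_mem (F₃.mem (by decide))
      have S₃ := S₂.frame F₃ (by decide) O₃ (by decide)
      have P₃ := P₂.trans (.of_onlyArr O₃ (F₃.var _ (by decide)) (F₃.var _ (by decide)))
      have q₃ : s₃.v .q = s.v .q := (F₃.var _ (by decide)).trans q₂
      have hqc₃ : s₃.v .qc = s.v .qc := (F₃.var _ (by decide)).trans hqc₂
      have hx₃ : K.key s₃.mem (s.v .q) = x := P₃.key _ h₁ h₂
      have a₃ : K.arr s₃ = K.next x (s.v .p) := (K.arr_congr (F₃.mem (by decide))).trans a₂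
      refine ⟨trivial, show 1 ≤ W by omega, fun hA => ?_, fun hA => ?_⟩ <;>
      simp only [Ex.val] at hA
      · have hA' := g₃.1 hA
        have hr' : K.Reach (K.next x (s.v .p)) := hr.next hp hg hv hA'
        have hmul : K.n * s₃.v .qc ≤ K.n * (N + 1) := Nat.mul_le_mul_left _ (by omega)
        have hc3 := S₃.count
        refine wp_conseq (insertC_spec S₃.env H hM S₃.trie (by omega) (by omega) (by omega)
          (by rw [a₃]; exact (hr'.inv G).1.le)) ?_
        intro s₄ I F₄
        have I' := I
        obtain ⟨T, c, l, k, cs⟩ := I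
        rw [a₃] at cs
        have f₄ : s₄.v .found = s₃.v .found := F₄.var _ (by decide)
        have hqle : s₃.v .qc ≤ s₄.v .qc := by rcases cs with cs | cs <;> omega
        have P₄ : Progress K s₃ s₄ := ⟨hqle, fun q e₁ e₂ => (k q e₁ e₂).1, fun h => by rwa [f₄]⟩
        have hfd := S₃.found
        have hq2 := S₃.qc
        have hfnd : s₃.v .found ≠ 0 → K.key s₄.mem (s₃.v .found) = K.key s₃.mem (s₃.v .found) :=
          fun h => (k _ (by omega) hfd.1).1
        refine ⟨⟨S₃.env.congr (fun x hx => F₄.var x ?_) (fun a ha => l a (by omega))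
          (F₄.rmem (by decide)), T, ?_, by omega, fun a ha => (l a (by omega)).trans (S₃.low a ha),
          ?_, ?_, ?_, ?_⟩, P₃.trans P₄, ?_⟩
        · revert x
          decide
        · have := S₃.count; omega
        · rw [(k 1 le_rfl (by omega)).1, (k 1 le_rfl (by omega)).2]; exact S₃.first
        · intro q e₁ e₂
          by_cases e : q < s₃.v .qc
          · obtain ⟨b₁, b₂, p, b₃, b₄, b₅⟩ := S₃.chain q e₁ e
            rw [(k q (by omega) e).1, (k q (by omega) e).2, (k _ b₁ (b₂.trans e)).1]
            exact ⟨b₁, b₂, p, b₃, b₄, b₅⟩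
          · rcases cs with cs | cs
            · omega
            · have : q = s₃.v .qc := by omega
              rw [this, cs.2.1, cs.2.2, q₃, (k _ h₁ (by omega)).1, hx₃]
              exact ⟨h₁, by omega, s.v .p, hp, hg, rfl⟩
        · intro q e₁ e₂
          by_cases e : q < s₃.v .qc
          · rw [(k q e₁ e).1]; exact S₃.reach q e₁ e
          · rcases cs with cs | cs
            · omega
            · have : q = s₃.v .qc := by omega
              rw [this, cs.2.1]; exact hr'
        · rw [f₄]
          refine ⟨by omega, fun h => ?_⟩
          rw [hfnd h]
          exact hfd.2 h
        · unfold Explored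
          rw [(P₃.trans P₄).key _ h₁ h₂, ← hx]
          refine ⟨fun _ _ _ => ?_, fun h => absurd h.2.2 hv⟩
          rcases cs with ⟨_, q', e₁, e₂, e₃⟩ | cs
          · exact ⟨q', e₁, by omega, by rw [(k q' e₁ e₂).1, e₃]⟩
          · exact ⟨s₃.v .qc, by omega, by omega, cs.2.1⟩
      · refine ⟨S₃, P₃, ?_⟩
        unfold Explored
        rw [hx₃]
        exact ⟨fun _ _ h => absurd (g₃.2 h) hA, fun h => absurd h.2.2 hv⟩
  · refine ⟨S₂, P₂, ?_⟩
    unfold Explored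
    rw [hx₂]
    exact ⟨fun h => absurd (f₂.2 h) hf, fun h => absurd (f₂.2 h.2.1) hf⟩

theorem visitC_spec {t t' : ℕ} (G : K.STGraph t t') (S : Search K m₀ s) (H : K.Fits L W B)
    {M N : ℕ} (hM : Room K L M) (hN : K.Bounded N) (hNM : 1 + K.n * (N + 1) ≤ M) (h₁ : 1 ≤ s.v .q)
    (h₂ : s.v .q < s.v .qc)
    (hE : ∀ q, 1 ≤ q → q < s.v .q → ∀ p < K.n, Explored K s q p) :
    visitC.wp L W B (fun s' => Search K m₀ s' ∧ s'.v .q = s.v .q + 1 ∧ s.v .q < s'.v .qc ∧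
      ∀ q, 1 ≤ q → q < s'.v .q → ∀ p < K.n, Explored K s' q p) s := by
  have hB := H.loop
  have hpos := H.pos
  have hnN : N + 1 ≤ K.n * (N + 1) := Nat.le_mul_of_pos_left _ hpos
  have hqc := S.qc_le hN
  have hW := H.word; have hL := H.mem
  refine wp_seq (R := fun s' => Search K m₀ s' ∧ Progress K s s' ∧
    ∀ p < K.n, Explored K s' (s.v .q) p) ?_ ?_
  · refine wp_loop (fun i s' => Search K m₀ s' ∧ Progress K s s' ∧
      ∀ p < i, Explored K s' (s.v .q) p) (by simp [S.env.n]; omega) ?_ ?_ ?_ ?_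
    · rintro i s' k ⟨S', P', E'⟩
      refine ⟨S'.congr (fun x hx => ?_) rfl rfl rfl (.of_mem rfl) rfl,
        P'.trans (.of_onlyArr (.of_mem rfl) rfl rfl), E'⟩
      have : x ≠ .p := by rintro rfl; revert hx; decide
      simp [this]
    · exact ⟨S, .refl s, by simp⟩
    · rintro i s' hi ⟨S', P', E'⟩ hiv F'
      have q' : s'.v .q = s.v .q := F'.var _ (by decide)
      rw [S.env.n] at hi
      have hle := P'.qc
      refine wp_conseq (exploreC_spec G S' H hM hN hNM (by omega) (by omega) (by omega)) ?_
      rintro s'' ⟨S'', P'', E''⟩ _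
      refine ⟨S'', P'.trans P'', fun p hp => ?_⟩
      rcases Nat.lt_succ_iff_lt_or_eq.1 hp with h | rfl
      · exact (E' p h).mono P'' h₁ (by omega)
      · rw [q', hiv] at E''; exact E''
    · rintro s' ⟨S', P', E'⟩ _
      exact ⟨S', P', by rwa [S.env.n] at E'⟩
  · rintro s' ⟨S', P', E'⟩ F'
    have q' : s'.v .q = s.v .q := F'.var _ (by decide)
    have hle := P'.qc
    have hM' : 2 * M + 2 ≤ (2 * M + 2) * (K.n + 2) := Nat.le_mul_of_pos_right _ (by omega)
    unfold Room at hM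
    simp only [wp]
    simp only [Ex.val, Ex.Safe, q', true_and]
    refine ⟨by omega, ?_, by simp, by simp; omega, ?_⟩
    · exact S'.congr (fun x hx => by
        have : x ≠ .q := by rintro rfl; revert hx; decide
        simp [this]) (by simp) (by simp) (by simp) (.of_mem rfl) rfl
    · intro q e₁ e₂ p hp
      have hex : Explored K s' q p := by
        simp only [HS.set_v, if_true] at e₂
        rcases Nat.lt_succ_iff_lt_or_eq.1 e₂ with h | rfl
        · exact (hE q e₁ h p hp).mono P' e₁ (by omega)
        · exact E' p hp
      exact hex

end Cmd

namespace Cmd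

open Ex

/-! ### The output -/

/-- Write the points of the vertices that have a rank in the placement `q`, and go on to the
placement from which `q` was reached. -/
def outC : Cmd :=
  loop .v .n (
    assign .a (get (add recQ (var .v))) ;;
    ifLt (var .a) (var .n1)
      (ifLt (var .zero) (var .a) (store (var .v) (get (add (var .A) (var .a)))) skip) skip) ;;
  assign .q (get (add recQ (var .n1)))

variable {K : Problem} {L W B : ℕ} {s s₀ : HS}

/-- The states differ at most in the cells of the output and in variables that are not parameters. -/
structure OnlyOut (K : Problem) (s₀ s : HS) : Prop where
  var : ∀ x ∈ envVars, s.v x = s₀.v x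
  mem : ∀ a, K.n ≤ a → s.mem a = s₀.mem a

/-- The output destroys cells below n, possibly part of the edge list. What is still read, namely
the point indices by rank and the stored records, lies at addresses from n on. -/
theorem outC_spec (E : Env K s₀) (H : K.Fits L W B) (O : OnlyOut K s₀ s) {M : ℕ}
    (hM : Room K L M) (hq : s.v .q ≤ M) :
    outC.wp L W B (fun s' => OnlyOut K s₀ s' ∧ s'.v .q = K.pred s₀.mem (s.v .q) ∧
      ∀ v < K.n, s'.mem v =
        if 1 ≤ K.key s₀.mem (s.v .q) v ∧ K.key s₀.mem (s.v .q) v ≤ K.n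
        then s₀.mem (2 * K.m + K.n + K.key s₀.mem (s.v .q) v) else s.mem v) s := by
  have hB := H.loop
  have hW := H.word; have hL := H.mem
  have val : ∀ s' : HS, OnlyOut K s₀ s' → s'.v .q = s.v .q → ∀ d < K.n + 2, ∀ e : Ex,
      e.Safe L W s' → e.val s' = d → (get (add recQ e)).Safe L W s' ∧
      (get (add recQ e)).val s' = s₀.mem (K.cell (2 * s.v .q + 1) d) := by
    intro s' O' hq' d hd e he hed
    have hlt := K.cell_lt (r := 2 * s.v .q + 1) (d := d) (by omega) hd hM
    have hBs := (O'.var .Bs (by decide)).trans E.Bs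
    have hS := (O'.var .S (by decide)).trans E.S
    have hrec := recQ_val hBs hS d
    rw [hq'] at hrec
    simp only [Ex.Safe, Ex.val, hed, hrec]
    refine ⟨⟨⟨recQ_safe hBs hS hW hM (by omega), he, by omega⟩, hlt⟩, O'.mem _ ?_⟩
    unfold Problem.cell; omega
  refine wp_seq (R := fun s' => OnlyOut K s₀ s' ∧ ∀ v < K.n, s'.mem v =
      if 1 ≤ K.key s₀.mem (s.v .q) v ∧ K.key s₀.mem (s.v .q) v ≤ K.n
      then s₀.mem (2 * K.m + K.n + K.key s₀.mem (s.v .q) v) else s.mem v) ?_ ?_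
  · have hn : s.v .n = K.n := (O.var .n (by decide)).trans E.n
    refine wp_loop (fun i s' => OnlyOut K s₀ s' ∧ (∀ v < i, s'.mem v =
      if 1 ≤ K.key s₀.mem (s.v .q) v ∧ K.key s₀.mem (s.v .q) v ≤ K.n
      then s₀.mem (2 * K.m + K.n + K.key s₀.mem (s.v .q) v) else s.mem v) ∧
      ∀ v, i ≤ v → v < K.n → s'.mem v = s.mem v) (by omega) ?_ ?_ ?_ ?_
    · rintro i s' k ⟨O', h₁, h₂⟩
      refine ⟨⟨fun x hx => ?_, O'.mem⟩, h₁, h₂⟩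
      have : x ≠ .v := by rintro rfl; revert hx; decide
      simp [this, O'.var x hx]
    · exact ⟨O, by simp, fun _ _ _ => rfl⟩
    · rintro i s' hi ⟨O', h₁, h₂⟩ hv F
      rw [hn] at hi
      obtain ⟨hs, hval⟩ := val s' O' (F.var _ (by decide)) i (by omega) (var .v) trivial hv
      have hk : s₀.mem (K.cell (2 * s.v .q + 1) i) = K.key s₀.mem (s.v .q) i := by
        rw [Problem.key, if_pos (by omega)]
      have hn1 := (O'.var .n1 (by decide)).trans E.n1
      have hz := (O'.var .zero (by decide)).trans E.zero
      have hA := (O'.var .A (by decide)).trans E.A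
      refine ⟨hs, ?_⟩
      rw [hval, hk]
      set k := K.key s₀.mem (s.v .q) i with hkd
      have O'' : OnlyOut K s₀ (s'.set .a k) := ⟨fun x hx => by
        have : x ≠ .a := by rintro rfl; revert hx; decide
        simp [this, O'.var x hx], O'.mem⟩
      have done : ¬ (1 ≤ k ∧ k ≤ K.n) → OnlyOut K s₀ (s'.set .a k) ∧ (∀ v < i + 1, s'.mem v =
          if 1 ≤ K.key s₀.mem (s.v .q) v ∧ K.key s₀.mem (s.v .q) v ≤ K.n
          then s₀.mem (2 * K.m + K.n + K.key s₀.mem (s.v .q) v) else s.mem v) ∧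
          ∀ v, i + 1 ≤ v → v < K.n → s'.mem v = s.mem v := by
        intro hk'
        refine ⟨O'', fun v hv' => ?_, fun v h₃ h₄ => h₂ v (by omega) h₄⟩
        rcases Nat.lt_succ_iff_lt_or_eq.1 hv' with h | rfl
        · exact h₁ v h
        · rw [if_neg hk', h₂ v le_rfl hi]
      refine ⟨trivial, trivial, fun hlt => ⟨trivial, trivial, fun hpos => ?_, fun hpos => ?_⟩,
        fun hlt => ?_⟩
      · simp [hn1] at hlt
        simp [hz] at hpos
        simp only [wp]
        simp only [Ex.val, Ex.Safe, HS.set_v, HS.set_mem, if_true, if_false, hA, hv, reduceCtorEq, true_and]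
        rw [O'.mem _ (by omega)]
        refine ⟨⟨by omega, by omega⟩, by omega, ⟨O''.var, fun a ha => ?_⟩, fun v hv' => ?_,
          fun v h₃ h₄ => ?_⟩
        · simp [show a ≠ i by omega, O'.mem a ha]
        · rcases Nat.lt_succ_iff_lt_or_eq.1 hv' with h | rfl
          · simp only [HS.setMem_mem, HS.set_mem, if_neg h.ne, h₁ v h]
          · simp only [HS.setMem_mem, if_true, ← hkd]
            rw [if_pos (by omega)]
        · simp [show v ≠ i by omega, h₂ v (by omega) h₄]
      · exact done (by simp [hz] at hpos; omega)
      · exact done (by simp [hn1] at hlt; omega)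
    · rintro s' ⟨O', h₁, h₂⟩ _
      exact ⟨O', by rwa [hn] at h₁⟩
  · rintro s' ⟨O', h₁⟩ F
    obtain ⟨hs, hval⟩ := val s' O' (F.var _ (by decide)) (K.n + 1) (by omega) (var .n1) trivial
      ((O'.var .n1 (by decide)).trans E.n1)
    refine ⟨hs, ⟨fun x hx => ?_, O'.mem⟩, ?_, h₁⟩
    · have : x ≠ .q := by rintro rfl; revert hx; decide
      simp [this, O'.var x hx]
    · simp only [HS.set_v, if_true]
      exact hval

/-! ### Unbounded loops -/

/-- The rule for unbounded loops, with a bound `k` on the number of iterations. -/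
theorem exec_while {c : Cmd} {x y : Var} (I : ℕ → HS → Prop) (hwf : c.Wf) (hW : 1 ≤ W)
    (h : ∀ k s, I k s → s.v x < s.v y → c.wp L W B (fun s' => ∃ k' < k, I k' s') s) :
    ∀ k σ s, Rep W σ s → I k s → ∃ t σ' s' k', Exec L W (.while (.lt x.idx y.idx) c.code) σ t σ' ∧
      Rep W σ' s' ∧ I k' s' ∧ ¬ s'.v x < s'.v y ∧ t ≤ k * (c.time B + 1) + 1 := by
  intro k
  induction k using Nat.strong_induction_on with
  | _ k ih =>
    intro σ s hr hI
    by_cases hb : s.v x < s.v y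
    · obtain ⟨t₁, σ₁, ht₁, x₁, s₁, r₁, k₁, hk₁, I₁⟩ := Cmd.exec hwf (h k s hI hb) hr hW
      obtain ⟨t₂, σ₂, s₂, k₂, x₂, r₂, I₂, hb₂, ht₂⟩ := ih k₁ hk₁ σ₁ s₁ r₁ I₁
      refine ⟨_, σ₂, s₂, k₂, .while_true (by simpa [Test.holds, hr.reg] using hb) x₁ x₂, r₂, I₂,
        hb₂, ?_⟩
      have : (k₁ + 1) * (c.time B + 1) ≤ k * (c.time B + 1) := Nat.mul_le_mul_right _ hk₁
      rw [Nat.add_mul, Nat.one_mul] at this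
      omega
    · exact ⟨1, σ, s, k, .while_false (by simpa [Test.holds, hr.reg] using hb), hr, hI, hb,
        by omega⟩

end Cmd

/-! ### Ranks of points, sorting, and the initialization of the search -/

open Finset in
/-- The rank of the `i`-th point among `n` points with the `y`-coordinates `Y`. -/
noncomputable def rank (n : ℕ) (Y : ℕ → ℝ) (i : ℕ) : ℕ :=
  open Classical in 1 + ((range n).filter fun j => Y j < Y i).card

theorem rank_le {n : ℕ} {Y : ℕ → ℝ} {i : ℕ} (hi : i < n) : rank n Y i ≤ n := by
  classical
  have : ((Finset.range n).filter fun j => Y j < Y i) ⊂ Finset.range n := by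
    refine Finset.filter_ssubset.2 ⟨i, by simpa using hi, lt_irrefl _⟩
  have := Finset.card_lt_card this
  rw [Finset.card_range] at this
  unfold rank
  rw [add_comm, Nat.succ_le_iff]
  convert this

theorem rank_lt {n : ℕ} {Y : ℕ → ℝ} {i j : ℕ} (hi : i < n) (h : Y i < Y j) :
    rank n Y i < rank n Y j := by
  classical
  refine Nat.add_lt_add_left (Finset.card_lt_card ?_) 1
  refine ⟨fun l hl => ?_, fun hs => ?_⟩
  · rw [Finset.mem_filter] at hl ⊢
    exact ⟨hl.1, hl.2.trans h⟩
  · have := @hs i (by simp [hi, h])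
    simp at this

theorem rank_lt_iff {n : ℕ} {Y : ℕ → ℝ} {i j : ℕ} (hi : i < n) (hj : j < n) :
    rank n Y i < rank n Y j ↔ Y i < Y j := by
  refine ⟨fun h => ?_, rank_lt hi⟩
  by_contra h'
  rcases (not_lt.1 h').lt_or_eq with h'' | h''
  · exact (rank_lt hj h'').not_gt h
  · simp [rank, h''] at h

theorem rank_inj {n : ℕ} {Y : ℕ → ℝ} (hY : Set.InjOn Y (Set.Iio n)) {i j : ℕ} (hi : i < n)
    (hj : j < n) (h : rank n Y i = rank n Y j) : i = j := by
  refine hY hi hj ?_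
  by_contra hne
  rcases lt_or_gt_of_ne hne with h' | h'
  · exact (rank_lt hi h').ne h
  · exact (rank_lt hj h').ne' h

theorem exists_rank_eq {n : ℕ} {Y : ℕ → ℝ} (hY : Set.InjOn Y (Set.Iio n)) {r : ℕ} (h₁ : 1 ≤ r)
    (h₂ : r ≤ n) : ∃ i < n, rank n Y i = r := by
  have := Finset.surj_on_of_inj_on_of_card_le (s := Finset.range n) (t := Finset.Icc 1 n)
    (fun i _ => rank n Y i) (fun i hi => by
      rw [Finset.mem_Icc]
      exact ⟨Nat.le_add_right _ _, rank_le (by simpa using hi)⟩)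
    (fun i j hi hj h => rank_inj hY (by simpa using hi) (by simpa using hj) h) (by simp) r
    (by simp [h₁, h₂])
  obtain ⟨i, hi, h⟩ := this
  exact ⟨i, by simpa using hi, h.symm⟩

/-- The index of the point of rank `r`. -/
noncomputable def atRank (n : ℕ) (Y : ℕ → ℝ) (r : ℕ) : ℕ :=
  open Classical in if h : ∃ i < n, rank n Y i = r then h.choose else 0

theorem atRank_spec {n : ℕ} {Y : ℕ → ℝ} (hY : Set.InjOn Y (Set.Iio n)) {r : ℕ} (h₁ : 1 ≤ r)
    (h₂ : r ≤ n) : atRank n Y r < n ∧ rank n Y (atRank n Y r) = r := by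
  have h := exists_rank_eq hY h₁ h₂
  rw [atRank, dif_pos h]
  exact h.choose_spec

/-- The instance with sorted points. -/
noncomputable def sorted (n m : ℕ) (tl hd : ℕ → ℕ) (X Y : ℕ → ℝ) : Problem where
  n := n
  m := m
  tl := tl
  hd := hd
  -- Rank 0 is not a point. Its cells keep their initial zeros, so that the arithmetic of the
  -- crossing test is specified even for an entry 0.
  px r := if r = 0 then 0 else X (atRank n Y r)
  py r := if r = 0 then 0 else Y (atRank n Y r)

/-- The machine holds the input. -/
structure Input (n m : ℕ) (tl hd : ℕ → ℕ) (X Y : ℕ → ℝ) (s : HS) : Prop where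
  var : ∀ x, x ≠ .n → x ≠ .m → s.v x = 0
  vn : s.v .n = n
  vm : s.v .m = m
  etl : ∀ j < m, s.mem (2 * j) = tl j
  ehd : ∀ j < m, s.mem (2 * j + 1) = hd j
  mem : ∀ a, 2 * m ≤ a → s.mem a = 0
  x : ∀ i < n, s.rmem (2 * i) = X i
  y : ∀ i < n, s.rmem (2 * i + 1) = Y i
  rmem : ∀ a, 2 * n ≤ a → s.rmem a = 0

namespace Cmd

open Ex

/-- Compute the parameters. -/
def paramC : Cmd :=
  assign .n1 (add (var .n) (lit 1)) ;;
  assign .A (add (mul (lit 2) (var .m)) (var .n)) ;;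
  assign .X (add (var .A) (var .n1)) ;;
  assign .Bs (add (var .X) (var .n1)) ;;
  assign .S (add (var .n1) (lit 1))

/-- Compute the rank of the point `i`. -/
def rankC : Cmd :=
  assign .r (lit 1) ;;
  loop .j .n (ifR (.real (add (mul (lit 2) (var .j)) (lit 1)))
    (.real (add (mul (lit 2) (var .i)) (lit 1))) (assign .r (add (var .r) (lit 1))) skip)

/-- Sort the points. -/
def sortC : Cmd :=
  loop .i .n (
    rankC ;;
    store (add (var .A) (var .r)) (var .i) ;;
    rstore (mul (lit 2) (add (var .n) (var .r))) (.real (mul (lit 2) (var .i))) ;;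
    rstore (add (mul (lit 2) (add (var .n) (var .r))) (lit 1))
      (.real (add (mul (lit 2) (var .i)) (lit 1))))

/-- Set up the first placement in the work array. -/
def startC : Cmd :=
  loop .v .n1 (store (add (var .X) (var .v)) (lit 1)) ;;
  loop .j .m (store (add (var .X) (hdE .j)) (var .n1))

/-- All that comes before the search. -/
def preludeC : Cmd :=
  paramC ;; sortC ;; startC ;;
  assign .cnt (lit 1) ;; assign .qc (lit 1) ;; insertC ;; assign .q (lit 1)

variable {n m : ℕ} {tl hd : ℕ → ℕ} {X Y : ℕ → ℝ} {L W B : ℕ} {s : HS}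

theorem rankC_spec (hn : s.v .n = n) (hy : ∀ i < n, s.rmem (2 * i + 1) = Y i) (hi : s.v .i < n)
    (hB : n ≤ B) (hL : 2 * n ≤ L) (hW : L ≤ W) :
    rankC.wp L W B (fun s' => s'.v .r = rank n Y (s.v .i)) s := by
  classical
  refine wp_seq (R := fun s' => s' = s.set .r 1) ⟨show 1 ≤ W by omega, rfl⟩ ?_
  rintro s₁ rfl -
  refine wp_loop (fun i s' => s'.v .r = 1 + ((Finset.range i).filter fun j => Y j < Y (s.v .i)).card)
    (by simp; omega) ?_ (by simp) ?_ ?_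
  · intro i s' k h; simpa using h
  · intro j s' hj hI hjv F
    have hj' : j < n := by simpa [hn] using hj
    have hiv : s'.v .i = s.v .i := by rw [F.var _ (by decide)]; simp
    have hr : s'.rmem = s.rmem := by rw [F.rmem (by decide)]; simp
    have hc := Finset.card_filter_le (Finset.range j) fun j => Y j < Y (s.v .i)
    rw [Finset.card_range] at hc
    simp only [wp]
    simp only [RE.Safe, RE.val, Ex.val, Ex.Safe, hjv, hiv, hr, hy _ hj', hy _ hi, true_and,
      Finset.range_add_one, Finset.filter_insert]
    refine ⟨by omega, by omega, fun h => ?_, fun h => ?_⟩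
    · rw [if_pos h, Finset.card_insert_of_notMem (by simp)]
      simp only [HS.set_v, if_true]
      omega
    · rw [if_neg h]; exact hI
  · intro s' hI _
    simp only [HS.set_v, reduceCtorEq, if_false, hn] at hI
    exact hI

/-- The state after sorting the first `i` points. -/
structure Sorted (n m : ℕ) (X Y : ℕ → ℝ) (s : HS) (i : ℕ) (s' : HS) : Prop where
  low : ∀ a < 2 * n + 2, s'.rmem a = s.rmem a
  mem : ∀ a, (a ≤ 2 * m + n ∨ 2 * m + 2 * n < a) → s'.mem a = s.mem a
  ord : ∀ j < i, s'.mem (2 * m + n + rank n Y j) = j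
  x : ∀ j < i, s'.rmem (2 * (n + rank n Y j)) = X j
  y : ∀ j < i, s'.rmem (2 * (n + rank n Y j) + 1) = Y j

/-- Points with distinct heights have distinct ranks, so no target cell is written twice; the
unsorted points below address 2n stay available throughout. -/
theorem sortC_spec (hn : s.v .n = n) (hA : s.v .A = 2 * m + n) (hx : ∀ i < n, s.rmem (2 * i) = X i)
    (hy : ∀ i < n, s.rmem (2 * i + 1) = Y i) (hY : Set.InjOn Y (Set.Iio n))
    (hB : n ≤ B) (hL : 2 * m + 4 * n + 4 ≤ L) (hW : L ≤ W) :
    sortC.wp L W B (fun s' => Sorted n m X Y s n s') s := by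
  refine wp_loop (fun i s' => Sorted n m X Y s i s') (by omega) ?_ ?_ ?_ ?_
  · rintro i s' k ⟨h₁, h₂, h₃, h₄, h₅⟩
    exact ⟨h₁, h₂, h₃, h₄, h₅⟩
  · exact ⟨fun _ _ => rfl, fun _ _ => rfl, by simp, by simp, by simp⟩
  · rintro i s' hi ⟨h₁, h₂, h₃, h₄, h₅⟩ hiv F
    rw [hn] at hi
    have hn' : s'.v .n = n := (F.var _ (by decide)).trans hn
    have hA' : s'.v .A = 2 * m + n := (F.var _ (by decide)).trans hA
    have hx' : ∀ i < n, s'.rmem (2 * i) = X i := fun i hi => by rw [h₁ _ (by omega), hx i hi]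
    have hy' : ∀ i < n, s'.rmem (2 * i + 1) = Y i := fun i hi => by rw [h₁ _ (by omega), hy i hi]
    refine wp_seq (rankC_spec hn' hy' (by omega) hB (by omega) hW) ?_
    intro s₁ hr F₁
    rw [hiv] at hr
    have hi₁ : s₁.v .i = i := (F₁.var _ (by decide)).trans hiv
    have hn₁ : s₁.v .n = n := (F₁.var _ (by decide)).trans hn'
    have hA₁ : s₁.v .A = 2 * m + n := (F₁.var _ (by decide)).trans hA'
    have hle := rank_le (Y := Y) hi
    have hpos : 1 ≤ rank n Y i := Nat.le_add_right _ _
    have hne : ∀ j < i, rank n Y j ≠ rank n Y i := fun j hj e =>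
      hj.ne (rank_inj hY (hj.trans hi) hi e)
    have hm₁ := F₁.mem (by decide)
    have hr₁ := F₁.rmem (by decide)
    simp only [wp]
    simp only [RE.Safe, RE.val, Ex.val, Ex.Safe, HS.setMem_v, HS.setRMem_v, hi₁, hn₁, hA₁, hr,
      true_and, HS.setMem_rmem]
    refine ⟨by omega, by omega, by omega, by omega, by omega, by omega, by omega, by omega, ?_⟩
    refine ⟨fun a ha => ?_, fun a ha => ?_, fun j hj => ?_, fun j hj => ?_, fun j hj => ?_⟩
    · simp only [HS.setRMem_rmem, HS.setMem_rmem]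
      rw [if_neg (by omega), if_neg (by omega), hr₁, h₁ a ha]
    · simp only [HS.setRMem_mem, HS.setMem_mem]
      rw [if_neg (by omega), hm₁, h₂ a ha]
    · simp only [HS.setRMem_mem, HS.setMem_mem]
      rcases Nat.lt_succ_iff_lt_or_eq.1 hj with h | rfl
      · rw [if_neg (by have := hne j h; omega), hm₁, h₃ j h]
      · simp
    · simp only [HS.setRMem_rmem, HS.setMem_rmem]
      rw [if_neg (by omega)]
      rcases Nat.lt_succ_iff_lt_or_eq.1 hj with h | rfl
      · rw [if_neg (by have := hne j h; omega), hr₁, h₄ j h]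
      · simp [hr₁, hx' _ hi]
    · simp only [HS.setRMem_rmem, HS.setMem_rmem]
      rcases Nat.lt_succ_iff_lt_or_eq.1 hj with h | rfl
      · rw [if_neg (by have := hne j h; omega), if_neg (by omega), hr₁, h₅ j h]
      · rw [if_pos rfl, if_neg (by omega), hr₁, hy' _ hi]
  · intro s' h _
    rwa [hn] at h

/-- First every entry, the level included, becomes 1; then every head of an edge becomes n + 1. The
source is the vertex that keeps its 1. -/
theorem startC_spec {K : Problem} (E : Env K s) (H : K.Fits L W B) :
    startC.wp L W B (fun s' => K.arr s' = K.start ∧ OnlyArr K s s') s := by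
  have hB := H.loop
  have hW := H.word; have hL := H.mem
  refine wp_seq (R := fun s' => (∀ v ≤ K.n, K.arr s' v = 1) ∧ OnlyArr K s s') ?_ ?_
  · refine wp_loop (fun i s' => (∀ v < i, K.arr s' v = 1) ∧ OnlyArr K s s')
      (by simp [E.n1]; omega) ?_ ?_ ?_ ?_
    · intro j s' k h; exact h
    · exact ⟨by simp, OnlyArr.refl _⟩
    · rintro j s' hj ⟨hI, hO⟩ hjv hF
      have E₁ := Env.onlyArr E hF (by decide) hO (by decide)
      have hj' : j ≤ K.n := by rw [E.n1] at hj; omega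
      simp only [wp]
      simp only [Ex.val, Ex.Safe, hjv, E₁.X, true_and]
      refine ⟨by omega, by omega, by omega, ?_, hO.trans (.setMem _ hj' _)⟩
      intro i hi
      rw [K.arr_setMem hj']
      rcases Nat.lt_succ_iff_lt_or_eq.1 hi with h | rfl
      · rw [Function.update_of_ne h.ne]; exact hI i h
      · rw [Function.update_self]
    · rintro s' ⟨hI, hO⟩ _
      exact ⟨fun v hv => hI v (by rw [E.n1]; omega), hO⟩
  · rintro s₁ ⟨h₁, O₁⟩ F₁
    have E₁ := Env.onlyArr E F₁ (by decide) O₁ (by decide)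
    classical
    refine wp_loop (fun i s' => (∀ v ≤ K.n, K.arr s' v = if ∃ j < i, K.hd j = v then K.n + 1 else 1) ∧
      OnlyArr K s s') (by simp [E₁.m]; omega) ?_ ?_ ?_ ?_
    · intro j s' k h; exact h
    · exact ⟨by simpa using h₁, O₁⟩
    · rintro j s' hj ⟨hI, hO⟩ hjv hF
      have E₂ := Env.onlyArr E₁ hF (by decide) (c := loop .j .m (store (add (var .X) (hdE .j)) (var .n1)))
        (fun a ha => (hO a ha).trans (O₁ a ha).symm) (by decide)
      rw [E₁.m] at hj
      have hv := hdE_val E₂ (y := .j) (by omega)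
      have hs := hdE_safe (s := s') H (y := .j) (by omega)
      have hlt := H.hd j hj
      rw [hjv] at hv
      simp only [wp]
      simp only [Ex.val, Ex.Safe, hv, hs, E₂.X, E₂.n1, true_and]
      refine ⟨by omega, by omega, fun v hv => ?_, hO.trans (.setMem _ hlt.le _)⟩
      rw [K.arr_setMem hlt.le]
      by_cases e : v = K.hd j
      · subst e
        rw [Function.update_self, if_pos ⟨j, by omega, rfl⟩]
      · rw [Function.update_of_ne e, hI v hv]
        congr 1
        simp only [eq_iff_iff]
        constructor
        · rintro ⟨j', h₁, h₂⟩
          exact ⟨j', by omega, h₂⟩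
        · rintro ⟨j', h₁, h₂⟩
          rcases Nat.lt_succ_iff_lt_or_eq.1 h₁ with h | rfl
          · exact ⟨j', h, h₂⟩
          · exact absurd h₂.symm e
    · rintro s' ⟨hI, hO⟩ _
      refine ⟨?_, hO⟩
      rw [E₁.m] at hI
      funext v
      unfold Problem.start
      split_ifs with h₁ h₂ h₃
      · rw [hI v h₁.le, if_pos h₂]
      · rw [hI v h₁.le, if_neg h₂]
      · rw [hI v h₃.le, if_neg]
        rintro ⟨j, hj, h₄⟩
        exact (H.hd j hj).ne (h₄.trans h₃)
      · simp [Problem.arr, show ¬ v ≤ K.n by omega]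

theorem preludeC_spec {s₀ t₀ : ℕ} (I : Input n m tl hd X Y s) (hY : Set.InjOn Y (Set.Iio n))
    (G : (sorted n m tl hd X Y).STGraph s₀ t₀)
    (H : (sorted n m tl hd X Y).Fits L W B) {M : ℕ} (hM : Room (sorted n m tl hd X Y) L M)
    (hnM : n + 1 ≤ M) :
    preludeC.wp L W B (fun s' => ∃ m₀, Search (sorted n m tl hd X Y) m₀ s' ∧ s'.v .q = 1 ∧
      s'.v .found = 0 ∧ ∀ r, 1 ≤ r → r ≤ n → m₀ (2 * m + n + r) = atRank n Y r) s := by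
  set K := sorted n m tl hd X Y with hK
  have hB := H.loop
  have hW := H.word; have hL := H.mem
  change m + n + 1 ≤ B at hB
  change 2 * m + 4 * n + 4 ≤ L at hL
  have hpos : 1 ≤ n := H.pos
  refine wp_seq (R := fun s' => (∀ x ∉ [.n1, .A, .X, .Bs, .S], s'.v x = s.v x) ∧ s'.mem = s.mem ∧
    s'.rmem = s.rmem ∧ s'.v .n1 = n + 1 ∧ s'.v .A = 2 * m + n ∧ s'.v .X = 2 * m + 2 * n + 1 ∧
    s'.v .Bs = 2 * m + 3 * n + 2 ∧ s'.v .S = n + 2) ?_ ?_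
  · simp only [paramC, wp]
    simp only [Ex.val, Ex.Safe, HS.set_v, HS.set_mem, HS.set_rmem, if_true, if_false, reduceCtorEq,
      I.vn, I.vm, true_and]
    constructorm* _ ∧ _
    all_goals first | omega | trivial | skip
    intro x hx
    simp only [List.mem_cons, List.not_mem_nil, or_false, not_or] at hx
    simp [hx]
  rintro s₁ ⟨v₁, m₁, r₁, n1, A1, X1, B1, S1⟩ -
  have n₁ : s₁.v .n = n := (v₁ _ (by decide)).trans I.vn
  refine wp_seq (sortC_spec (X := X) n₁ A1 (by rw [r₁]; exact I.x) (by rw [r₁]; exact I.y) hY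
    (by omega) (by omega) hW) ?_
  rintro s₂ ⟨h₁, h₂, h₃, h₄, h₅⟩ F₂
  have E₂ : Env K s₂ := by
    have e : ∀ x ∉ sortC.writes, s₂.v x = s₁.v x := F₂.var
    refine ⟨?_, ?_, ?_, ?_, ?_, ?_, ?_, ?_, ?_, ?_, ?_, ?_⟩
    · rw [e _ (by decide), n₁]; rfl
    · rw [e _ (by decide), v₁ _ (by decide), I.vm]; rfl
    · rw [e _ (by decide), n1]; rfl
    · rw [e _ (by decide), A1]; rfl
    · rw [e _ (by decide), X1]; rfl
    · rw [e _ (by decide), B1]; rfl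
    · rw [e _ (by decide), S1]; rfl
    · rw [e _ (by decide), v₁ _ (by decide), I.var _ (by decide) (by decide)]
    · intro j (hj : j < m)
      rw [h₂ _ (by omega), m₁, I.etl j hj]; rfl
    · intro j (hj : j < m)
      rw [h₂ _ (by omega), m₁, I.ehd j hj]; rfl
    · intro r (hr : r ≤ n)
      change s₂.rmem (2 * n + 2 * r) = if r = 0 then 0 else X (atRank n Y r)
      split_ifs with h
      · rw [h₁ _ (by omega), r₁, I.rmem _ (by omega)]
      · obtain ⟨a, b⟩ := atRank_spec hY (by omega) hr
        rw [← h₄ _ a, b, Nat.mul_add]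
    · intro r (hr : r ≤ n)
      change s₂.rmem (2 * n + 2 * r + 1) = if r = 0 then 0 else Y (atRank n Y r)
      split_ifs with h
      · rw [h₁ _ (by omega), r₁, I.rmem _ (by omega)]
      · obtain ⟨a, b⟩ := atRank_spec hY (by omega) hr
        rw [← h₅ _ a, b, Nat.mul_add]
  have O₂ : ∀ r, 1 ≤ r → r ≤ n → s₂.mem (2 * m + n + r) = atRank n Y r := fun r a b => by
    obtain ⟨c, d⟩ := atRank_spec hY a b
    rw [← d, h₃ _ c, d]
  have Z₂ : ∀ a, 2 * m + 2 * n + 1 ≤ a → s₂.mem a = 0 := fun a ha => by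
    rw [h₂ _ (by omega), m₁, I.mem _ (by omega)]
  refine wp_seq (startC_spec E₂ H) ?_
  rintro s₃ ⟨a₃, O₃⟩ F₃
  have E₃ := Env.onlyArr E₂ F₃ (by decide) O₃ (by decide)
  have Z₃ : ∀ a, 2 * m + 3 * n + 2 ≤ a → s₃.mem a = 0 := fun a ha => by
    rw [O₃ a (.inr (show 2 * m + 3 * n + 1 < a by omega)), Z₂ _ (by omega)]
  have z₃ : ∀ x ∈ [Var.q, .found], s₃.v x = 0 := by
    intro x hx
    rw [F₃.var x (by revert x; decide), F₂.var x (by revert x; decide),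
      v₁ x (by revert x; decide), I.var x (by revert x; decide) (by revert x; decide)]
  refine ⟨show 1 ≤ W by omega, show 1 ≤ W by omega, ?_⟩
  change (insertC ;; assign .q (lit 1)).wp L W B _ ((s₃.set .cnt 1).set .qc 1)
  set s₄ := (s₃.set .cnt 1).set .qc 1 with hs₄
  have E₄ : Env K s₄ := (E₃.set (by decide)).set (by decide)
  have a₄ : K.arr s₄ = K.start := a₃
  -- Untouched memory is zero and thus represents the empty trie, consisting of the root alone.
  have ch : ∀ r d, K.child s₄.mem r d = 0 := fun r d => Z₃ _ (by
    change _ ≤ 2 * m + 3 * n + 2 + _ + _; omega)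
  refine wp_seq (insertC_spec E₄ H hM ⟨fun _ => 0, fun _ _ => 0, ?_⟩ ?_ ?_ ?_ ?_) ?_
  · refine ⟨by simp [hs₄], rfl, ?_, ?_, ?_, ?_, ?_, ?_⟩
    · intro r _ _ d _ h; exact absurd (ch r d) h
    · intro r _ _ d _ h; exact absurd (ch r d) h
    · intro r _ d _; exact ch r d
    · intro q a b; simp [hs₄] at b; omega
    · intro q a b; simp [hs₄] at b; omega
    · intro q q' a b; simp [hs₄] at b; omega
  · simp only [hs₄, HS.set_v, if_true, reduceCtorEq, if_false]
    change 1 + n ≤ M; omega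
  · simp [hs₄]; omega
  · simp [hs₄]
  · rw [a₄]; exact (Problem.inv_start G).le
  rintro s₅ ⟨T, c, l, k, cs⟩ F₅
  have q₄ : s₄.v .qc = 1 := by simp [hs₄]
  have c₄ : s₄.v .cnt = 1 := by simp [hs₄]
  have f₄ : s₄.v .found = 0 := by simp [hs₄, z₃]
  have p₄ : s₄.v .q = 0 := by simp [hs₄, z₃]
  rw [q₄] at c cs
  rw [c₄] at c
  rw [a₄, p₄] at cs
  rcases cs with ⟨-, q, e₁, e₂, -⟩ | ⟨cq, ck, cp⟩
  · omega
  have q₅ : s₅.v .qc = 2 := cq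
  have f₅ : s₅.v .found = 0 := (F₅.var _ (by decide)).trans f₄
  rw [q₅] at c
  refine ⟨show 1 ≤ W by omega, s₅.mem, ⟨?_, by simpa using T, ?_, ?_, fun _ _ => rfl, ⟨ck, cp⟩,
    ?_, ?_, ?_⟩, by simp, by simp [f₅], ?_⟩
  · exact Env.set (E₄.congr (fun x hx => F₅.var x (by revert x; decide))
      (fun a ha => l a (by omega)) (F₅.rmem (by decide))) (by decide)
  · simp [q₅]; omega
  · simp [q₅]
  · intro q a b; simp [q₅] at b; omega
  · intro q a b
    have : q = 1 := by simp [q₅] at b; omega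
    rw [this]
    change K.Reach (K.key s₅.mem 1)
    rw [ck]; exact .start
  · simp [f₅, q₅]
  · intro r a b
    rw [l _ (by change _ < 2 * m + 3 * n + 2; omega)]
    rw [← O₂ r a b]
    exact O₃ _ (.inl (show 2 * m + n + r < 2 * m + 2 * n + 1 by omega))

end Cmd

/-! ### The exhausted search, the backtracking output and the whole program -/

variable {K : Problem} {s : HS} {m₀ : ℕ → ℕ}

/-- When all placements have been explored, every reachable placement has been visited. -/
theorem Search.visited (S : Search K m₀ s)
    (hE : ∀ q, 1 ≤ q → q < s.v .qc → ∀ p < K.n, Explored K s q p) {x : ℕ → ℕ} (hx : K.Reach x) :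
    ∃ q, 1 ≤ q ∧ q < s.v .qc ∧ K.key s.mem q = x := by
  induction hx with
  | start => exact ⟨1, le_rfl, S.qc, S.first.1⟩
  | next hx hp hg hn hA ih =>
    obtain ⟨q, h₁, h₂, rfl⟩ := ih
    exact (hE q h₁ h₂ _ hp).1 hg hn hA

/-- A solution would yield an accepting step from a reachable placement. That placement has been
visited and the step explored, so `found` would have been set. -/
theorem Search.not_solution {t t' : ℕ} (G : K.STGraph t t') (S : Search K m₀ s)
    (hE : ∀ q, 1 ≤ q → q < s.v .qc → ∀ p < K.n, Explored K s q p) (hf : s.v .found = 0)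
    (ψ : ℕ → ℕ) : ¬ K.Solution ψ := by
  intro hs
  obtain ⟨x, p, hx, ha⟩ := Problem.exists_accept G hs
  obtain ⟨q, h₁, h₂, rfl⟩ := S.visited hE hx
  exact (hE q h₁ h₂ p ha.1).2 ha hf

namespace Cmd

open Ex

/-- The program. -/
def program : Prog :=
  .seq preludeC.code (.seq (.while (.lt Var.q.idx Var.qc.idx) visitC.code)
    (.ite (.lt Var.zero.idx Var.found.idx)
      (.seq (assign .q (var .found)).code (.seq (.while (.lt Var.zero.idx Var.q.idx) outC.code)
        (assign .n (lit 1)).code))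
      (assign .n (lit 0)).code))

variable {L W B : ℕ}

/-- The invariant of the output; `s₀` is the state after the search. -/
structure Writing (K : Problem) (m₀ : ℕ → ℕ) (s₀ : HS) (k : ℕ) (s : HS) : Prop where
  rest : s.v .q = k
  only : OnlyOut K s₀ s
  lt : s.v .q < s₀.v .qc
  ranks : ∃ ψ : ℕ → ℕ, (∀ v < K.n, 1 ≤ ψ v → ψ v ≤ K.n → s.mem v = m₀ (2 * K.m + K.n + ψ v)) ∧
    (s.v .q = 0 → K.Completes K.start ψ) ∧
    (s.v .q ≠ 0 → K.Completes (K.key s₀.mem (s.v .q)) (K.override (K.key s₀.mem (s.v .q)) ψ))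

/-- The assignment in the invariant describes the output cells before the record of `q` is written;
writing it amounts to `override`. Moving to the predecessor is the backward step `Reach.completes`,
and the links decrease until they reach 0 behind the start. -/
theorem Writing.step {t t' : ℕ} (G : K.STGraph t t') {s₀ : HS} (S : Search K m₀ s₀)
    (H : K.Fits L W B) {M : ℕ} (hM : Room K L M) {k : ℕ} (h : Writing K m₀ s₀ k s)
    (hqM : s₀.v .qc ≤ M) (hq : 0 < s.v .q) :
    outC.wp L W B (fun s' => ∃ k' < k, Writing K m₀ s₀ k' s') s := by
  obtain ⟨h₁, O, h₂, ψ, hψ, -, hc⟩ := h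
  refine wp_conseq (outC_spec S.env H O hM (by omega)) ?_
  rintro s' ⟨O', hq', hm⟩ -
  specialize hc hq.ne'
  set x := K.key s₀.mem (s.v .q) with hx
  have hlt : s'.v .q < s.v .q ∧ (s'.v .q = 0 → x = K.start) ∧ (s'.v .q ≠ 0 →
      ∃ p < K.n, K.Good (K.key s₀.mem (s'.v .q)) p ∧ x = K.next (K.key s₀.mem (s'.v .q)) p) := by
    rcases Nat.lt_or_ge (s.v .q) 2 with h | h
    · have h1 : s.v .q = 1 := by omega
      rw [h1, S.first.2] at hq'
      refine ⟨by omega, fun _ => by rw [hx, h1, S.first.1], fun h => absurd hq' h⟩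
    · obtain ⟨a, b, c⟩ := S.chain _ h h₂
      rw [hq']
      exact ⟨b, fun e => by omega, fun _ => c⟩
  refine ⟨s'.v .q, by omega, rfl, O', by omega, K.override x ψ, ?_, ?_, ?_⟩
  · intro v hv a b
    rw [hm v hv]
    unfold Problem.override at a b ⊢
    by_cases h : 1 ≤ x v ∧ x v ≤ K.n
    · rw [if_pos h, if_pos h]
      exact S.low _ (by omega)
    · rw [if_neg h] at a b ⊢
      rw [if_neg h]
      exact hψ v hv a b
  · intro e
    rw [← hlt.2.1 e]
    exact hc
  · intro e
    obtain ⟨p, hp, hg, hn⟩ := hlt.2.2 e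
    rw [hn] at hc ⊢
    exact (S.reach _ (by omega) (by omega)).completes G hg hc

/-- The program solves the instance. -/
theorem program_exec {n m : ℕ} {tl hd : ℕ → ℕ} {X Y : ℕ → ℝ} {s₀ t₀ M N : ℕ} {σ : State}
    (I : Input n m tl hd X Y s) (hr : Rep W σ s) (hY : Set.InjOn Y (Set.Iio n))
    (G : (sorted n m tl hd X Y).STGraph s₀ t₀)
    (H : (sorted n m tl hd X Y).Fits L W B) (hM : Room (sorted n m tl hd X Y) L M)
    (hN : (sorted n m tl hd X Y).Bounded N) (hNM : 1 + n * (N + 1) ≤ M) :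
    ∃ T σ', T ≤ preludeC.time B + (N + 1) * (visitC.time B + outC.time B + 2) + 10 ∧
      Exec L W program σ T σ' ∧ (σ'.reg 0 = 0 ∨ σ'.reg 0 = 1) ∧
      (σ'.reg 0 = 1 ↔ ∃ ψ, (sorted n m tl hd X Y).Solution ψ) ∧
      (σ'.reg 0 = 1 → ∃ ψ, (sorted n m tl hd X Y).Solution ψ ∧
        ∀ v < n, σ'.mem v = atRank n Y (ψ v)) := by
  set K := sorted n m tl hd X Y with hK
  have hW := H.word; have hL := H.mem
  have hpos : 1 ≤ n := H.pos
  have hW1 : 1 ≤ W := by omega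
  have hnN : N + 1 ≤ n * (N + 1) := Nat.le_mul_of_pos_left _ hpos
  have hnN' : n ≤ n * (N + 1) := Nat.le_mul_of_pos_right _ (by omega)
  obtain ⟨T₁, σ₁, hT₁, x₁, s₁, r₁, m₀, S₁, q₁, f₁, ord⟩ :=
    Cmd.exec (c := preludeC) (by decide) (preludeC_spec I hY G H hM (by omega)) hr hW1
  -- The index `q` starts at 1, grows by one per iteration and never passes `qc`, which is at most N
  -- + 1; hence at most N iterations.
  obtain ⟨T₂, σ₂, s₂, k₂, x₂, r₂, ⟨S₂, q₂, le₂, -, E₂⟩, b₂, hT₂⟩ :=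
    exec_while (c := visitC) (x := .q) (y := .qc) (L := L) (B := B)
      (fun k s => Search K m₀ s ∧ 1 ≤ s.v .q ∧ s.v .q ≤ s.v .qc ∧ k + s.v .q = N + 1 ∧
        ∀ q, 1 ≤ q → q < s.v .q → ∀ p < K.n, Explored K s q p) (by decide) hW1
      (by
        rintro k s ⟨S, h₁, h₂, h₃, h₄⟩ hlt
        refine wp_conseq (visitC_spec G S H hM hN hNM h₁ hlt h₄) ?_
        rintro s' ⟨S', h₅, h₆, h₇⟩ -
        have := S'.qc_le hN
        exact ⟨N + 1 - s'.v .q, by omega, S', by omega, by omega, by omega, h₇⟩)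
      N σ₁ s₁ r₁ ⟨S₁, q₁.ge, by have := S₁.qc; omega, by omega, fun q _ _ => by omega⟩
  have hqc : s₂.v .qc ≤ N + 1 := S₂.qc_le hN
  have hE : ∀ q, 1 ≤ q → q < s₂.v .qc → ∀ p < K.n, Explored K s₂ q p :=
    fun q h₁ h₂ => E₂ q h₁ (by omega)
  have hz : s₂.v .zero = 0 := S₂.env.zero
  have e₁ : N * (visitC.time B + 1) ≤ (N + 1) * (visitC.time B + 1) :=
    Nat.mul_le_mul_right _ (by omega)
  have e₂ : (N + 1) * (visitC.time B + outC.time B + 2) =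
    (N + 1) * (visitC.time B + 1) + (N + 1) * (outC.time B + 1) := by ring
  have ht : ∀ x y, (assign x (var y)).time B = 2 := fun _ _ => rfl
  have ht' : ∀ x k, (assign x (lit k)).time B = 2 := fun _ _ => rfl
  by_cases hf : s₂.v .found = 0
  · obtain ⟨T₃, σ₃, hT₃, x₃, s₃, r₃, h₃⟩ := Cmd.exec (c := assign .n (lit 0)) (L := L) (B := B)
      (Q := fun s' => s'.v .n = 0) trivial ⟨Nat.zero_le W, by simp⟩ r₂ hW1
    have hreg : σ₃.reg 0 = 0 := (r₃.reg .n).trans h₃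
    rw [ht'] at hT₃
    refine ⟨_, σ₃, ?_, .seq x₁ (.seq x₂ (.ite_false ?_ x₃)), .inl hreg, ?_, ?_⟩
    · omega
    · simp [Test.holds, r₂.reg, hf]
    · rw [hreg]
      refine ⟨by simp, fun ⟨ψ, h⟩ => absurd h (S₂.not_solution G hE hf ψ)⟩
    · rw [hreg]; simp
  · have hfl := S₂.found
    obtain ⟨p, hacc⟩ := hfl.2 hf
    obtain ⟨T₃, σ₃, hT₃, x₃, s₃, r₃, h₃⟩ := Cmd.exec (c := assign .q (var .found)) (L := L) (B := B)
      (Q := fun s' => s' = s₂.set .q (s₂.v .found)) trivial ⟨trivial, rfl⟩ r₂ hW1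
    -- The zero assignment constrains no output cell yet, and after an accepting step any assignment
    -- will do.
    have w₃ : Writing K m₀ s₂ (s₂.v .found) s₃ := by
      subst h₃
      refine ⟨by simp, ⟨fun x hx => ?_, fun _ _ => rfl⟩, by simpa using hfl.1, fun _ => 0,
        fun _ _ h => absurd h (by simp), fun h => ?_, fun _ => ?_⟩
      · have : x ≠ .q := by rintro rfl; revert hx; decide
        simp [this]
      · simp [hf] at h
      · have := (S₂.reach (s₂.v .found) (by omega) hfl.1).completes_of_accept G hacc (fun _ => 0)
        simpa using this
    obtain ⟨T₄, σ₄, s₄, k₄, x₄, r₄, w₄, b₄, hT₄⟩ :=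
      exec_while (c := outC) (x := .zero) (y := .q) (L := L) (B := B)
        (Writing K m₀ s₂) (by decide) hW1
        (fun k s w hlt => w.step G S₂ H hM (by omega) (by omega)) _ σ₃ s₃ r₃ w₃
    obtain ⟨T₅, σ₅, hT₅, x₅, s₅, r₅, h₅⟩ := Cmd.exec (c := assign .n (lit 1)) (L := L) (B := B)
      (Q := fun s' => s' = s₄.set .n 1) trivial ⟨hW1, rfl⟩ r₄ hW1
    rw [ht] at hT₃
    rw [ht'] at hT₅
    subst h₅
    have hreg : σ₅.reg 0 = 1 := (r₅.reg .n).trans (by simp)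
    have hz₄ : s₄.v .zero = 0 := (w₄.only.var _ (by decide)).trans hz
    obtain ⟨-, -, -, ψ, hψ, hc, -⟩ := w₄
    have hs : K.Solution ψ := Problem.Completes.solution G (hc (by omega))
    have e₃ : s₂.v .found * (outC.time B + 1) ≤ (N + 1) * (outC.time B + 1) :=
      Nat.mul_le_mul_right _ (by omega)
    refine ⟨_, σ₅, ?_, .seq x₁ (.seq x₂ (.ite_true ?_ (.seq x₃ (.seq x₄ x₅)))), .inr hreg, ?_, ?_⟩
    · omega
    · simp only [Test.holds, r₂.reg]; omega
    · exact ⟨fun _ => ⟨ψ, hs⟩, fun _ => hreg⟩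
    · intro _
      refine ⟨ψ, hs, fun v hv => ?_⟩
      have := hs.range v hv
      rw [r₅.mem, HS.set_mem, hψ v hv this.1 this.2]
      exact ord _ this.1 this.2

end Cmd

/-! ### The number of reachable placements -/

open Finset in
-- A union bound over the coordinate that takes its value in `B`.
theorem card_pi_exists_le {k : ℕ} (A B : Finset ℕ) :
    ((Fintype.piFinset fun _ : Fin k => A).filter fun f => ∃ i, f i ∈ B).card ≤
      k * (B.card * A.card ^ (k - 1)) := by
  have hsub : ((Fintype.piFinset fun _ : Fin k => A).filter fun f => ∃ i, f i ∈ B) ⊆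
      univ.biUnion fun i => Fintype.piFinset (Function.update (fun _ : Fin k => A) i B) := by
    intro f hf
    rw [mem_filter, Fintype.mem_piFinset] at hf
    obtain ⟨hA, i, hi⟩ := hf
    rw [mem_biUnion]
    refine ⟨i, mem_univ _, Fintype.mem_piFinset.2 fun j => ?_⟩
    by_cases h : j = i
    · subst h; simpa using hi
    · simpa [h] using hA j
  refine (card_le_card hsub).trans (card_biUnion_le.trans ?_)
  refine (sum_le_card_nsmul univ _ (B.card * A.card ^ (k - 1)) fun i _ => ?_).trans_eq (by simp)
  rw [Fintype.card_piFinset]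
  have : ∀ j, (Function.update (fun _ : Fin k => A) i B j).card =
      Function.update (fun _ : Fin k => A.card) i B.card j := fun j => by
    by_cases h : j = i
    · subst h; simp
    · simp [h]
  simp_rw [this]
  rw [prod_update_of_mem (mem_univ i)]
  simp [card_sdiff]

/-- A left inverse of an embedding of `C` into `Fin k`. Surplus indices repeat elements of `C`,
which is why `C` must not be empty. -/
theorem exists_enum {C : Finset ℕ} {k : ℕ} (h : C.Nonempty) (hk : C.card ≤ k) :
    ∃ e : Fin k → ℕ, (∀ i, e i ∈ C) ∧ ∀ j ∈ C, ∃ i, e i = j := by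
  obtain ⟨f⟩ : Nonempty (C ↪ Fin k) := Function.Embedding.nonempty_of_card_le (by simpa using hk)
  have : Nonempty C := h.to_subtype
  refine ⟨fun i => (Function.invFun f i : C), fun i => Subtype.coe_prop _, fun j hj => ?_⟩
  obtain ⟨i, hi⟩ := Function.invFun_surjective f.injective ⟨j, hj⟩
  exact ⟨i, congrArg Subtype.val hi⟩

/-- An enumeration of a set of at most `k` numbers. -/
noncomputable def enum (k : ℕ) (C : Finset ℕ) : Fin k → ℕ :=
  open Classical in
  if h : ∃ e : Fin k → ℕ, (∀ i, e i ∈ C) ∧ ∀ j ∈ C, ∃ i, e i = j then h.choose else fun _ => 0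

theorem enum_spec {C : Finset ℕ} {k : ℕ} (h : C.Nonempty) (hk : C.card ≤ k) :
    (∀ i, enum k C i ∈ C) ∧ ∀ j ∈ C, ∃ i, enum k C i = j := by
  have := exists_enum h hk
  rw [enum, dif_pos this]
  exact this.choose_spec

namespace Problem

variable {K : Problem} {s t k : ℕ} {x y : ℕ → ℕ}

/-- The edges that leave a set of vertices. -/
noncomputable def outEdges (K : Problem) (D : Set ℕ) : Finset ℕ :=
  open Classical in (Finset.range K.m).filter fun j => K.tl j ∈ D ∧ K.hd j ∉ D

theorem mem_outEdges {D : Set ℕ} {j : ℕ} :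
    j ∈ K.outEdges D ↔ j < K.m ∧ K.tl j ∈ D ∧ K.hd j ∉ D := by
  simp [outEdges]

/-- Every down-closed set of vertices is left by at most `k` edges. -/
def Narrow (K : Problem) (k : ℕ) : Prop :=
  ∀ D : Set ℕ, (∀ j < K.m, K.hd j ∈ D → K.tl j ∈ D) → (K.outEdges D).card ≤ k

/-- The placed vertices. -/
def placed (K : Problem) (x : ℕ → ℕ) : Set ℕ := {v | v < K.n ∧ x v < x K.n}

/-- The properties of the reachable placements with at least one placed vertex. -/
structure Active (K : Problem) (s : ℕ) (x : ℕ → ℕ) : Prop where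
  inv : K.Inv s x
  two_le : 2 ≤ x K.n
  le : x K.n ≤ K.n
  alive : K.Alive x

theorem mem_outEdges_placed (G : K.STGraph s t) {j : ℕ} :
    j ∈ K.outEdges (K.placed x) ↔ j < K.m ∧ x (K.tl j) < x K.n ∧ x K.n ≤ x (K.hd j) := by
  rw [mem_outEdges]
  refine and_congr_right fun hj => ?_
  simp [placed, G.tl_lt j hj, G.hd_lt j hj]

theorem Active.enum (A : K.Active s x) (G : K.STGraph s t) (hN : K.Narrow k) :
    (∀ i, enum k (K.outEdges (K.placed x)) i ∈ K.outEdges (K.placed x)) ∧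
      ∀ j ∈ K.outEdges (K.placed x), ∃ i, enum k (K.outEdges (K.placed x)) i = j := by
  refine enum_spec ?_ (hN _ ?_)
  · obtain ⟨j, hj, h₁, h₂⟩ := A.inv.recent A.two_le A.le
    exact ⟨j, (mem_outEdges_placed G).2 ⟨hj, by omega, h₂⟩⟩
  · intro j hj h
    exact ⟨G.tl_lt j hj, A.inv.down j hj h.2⟩

/-- The placed vertices are determined by the tails of the edges that leave them. -/
theorem Active.placed_subset (A : K.Active s x) (A' : K.Active s y) (G : K.STGraph s t)
    (h : ∀ j ∈ K.outEdges (K.placed x), ∃ j' ∈ K.outEdges (K.placed y), K.tl j' = K.tl j) :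
    K.placed x ⊆ K.placed y := by
  have ht : t ∉ K.placed x := fun ht => by
    obtain ⟨j, hj, -, h₂⟩ := A.inv.recent A.two_le A.le
    have := G.top (K.placed x) (fun j hj h => ⟨G.tl_lt j hj, A.inv.down j hj h.2⟩) ht _
      (G.hd_lt j hj)
    exact absurd this.2 (not_lt.2 h₂)
  intro v hv
  by_contra hv'
  -- The difference of the two sets is closed under out-neighbours: an edge leaving the first set
  -- has the same tail as an edge leaving the second, so its tail is in both. A nonempty difference
  -- would therefore contain the sink, which the first set does not.
  have := G.top {v | ¬ (v ∈ K.placed x ∧ v ∉ K.placed y)} (fun j hj h₁ h₂ => ?_)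
    (fun h => ht h.1) v hv.1
  · exact this ⟨hv, hv'⟩
  · by_cases h₃ : K.hd j ∈ K.placed x
    · by_cases h₄ : K.hd j ∈ K.placed y
      · exact h₂.2 ⟨G.tl_lt j hj, A'.inv.down j hj h₄.2⟩
      · exact h₁ ⟨h₃, h₄⟩
    · obtain ⟨j', h₅, h₆⟩ := h j (mem_outEdges.2 ⟨hj, h₂.1, h₃⟩)
      rw [← h₆] at h₂
      exact h₂.2 (mem_outEdges.1 h₅).2.1

/-- The tails of the edges that leave the placed vertices. -/
noncomputable def tails (K : Problem) (k : ℕ) (x : ℕ → ℕ) (i : Fin k) : ℕ :=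
  K.tl (enum k (K.outEdges (K.placed x)) i)

/-- The heads of the edges that leave the placed vertices. -/
noncomputable def heads (K : Problem) (k : ℕ) (x : ℕ → ℕ) (i : Fin k) : ℕ :=
  K.hd (enum k (K.outEdges (K.placed x)) i)

theorem Active.placed_eq (A : K.Active s x) (A' : K.Active s y) (G : K.STGraph s t)
    (hN : K.Narrow k) (h : K.tails k x = K.tails k y) : K.placed x = K.placed y := by
  refine Set.Subset.antisymm (A.placed_subset A' G fun j hj => ?_)
    (A'.placed_subset A G fun j hj => ?_)
  · obtain ⟨i, rfl⟩ := (A.enum G hN).2 j hj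
    exact ⟨_, (A'.enum G hN).1 i, (congrFun h i).symm⟩
  · obtain ⟨i, rfl⟩ := (A'.enum G hN).2 j hj
    exact ⟨_, (A.enum G hN).1 i, congrFun h i⟩

theorem Inv.card_placed (I : K.Inv s x) : (K.placed x).ncard + 1 = x K.n := by
  rw [← I.card, ← Set.ncard_coe_finset]
  congr 2
  ext v
  simp [placed]

theorem Active.level_eq (A : K.Active s x) (A' : K.Active s y)
    (h : K.placed x = K.placed y) : x K.n = y K.n := by
  rw [← A.inv.card_placed, ← A'.inv.card_placed, h]

/-- Away from the ends of cut edges the entries are forced: 0 for placed vertices, n + 1 for the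
others. -/
theorem Active.eq (A : K.Active s x) (A' : K.Active s y) (G : K.STGraph s t) (hN : K.Narrow k)
    (h : K.placed x = K.placed y) (h₁ : ∀ i, x (K.tails k x i) = y (K.tails k y i))
    (h₂ : ∀ i, x (K.heads k x i) = y (K.heads k y i)) : x = y := by
  have hl := A.level_eq A' h
  have e := (A.enum G hN).2
  simp only [tails, heads, ← h] at h₁ h₂
  funext v
  rcases lt_trichotomy v K.n with hv | rfl | hv
  · by_cases hp : v ∈ K.placed x
    · have hp' : v ∈ K.placed y := h ▸ hp
      by_cases hT : ∃ j ∈ K.outEdges (K.placed x), K.tl j = v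
      · obtain ⟨j, hj, rfl⟩ := hT
        obtain ⟨i, rfl⟩ := e j hj
        exact h₁ i
      · have z : x v = 0 := by
          by_contra h₃
          obtain ⟨j, hj, h₄, h₅⟩ := A.inv.tail v hv hp.2 h₃
          exact hT ⟨j, (mem_outEdges_placed G).2 ⟨hj, h₄ ▸ hp.2, h₅⟩, h₄⟩
        have z' : y v = 0 := by
          by_contra h₃
          obtain ⟨j, hj, h₄, h₅⟩ := A'.inv.tail v hv hp'.2 h₃
          refine hT ⟨j, ?_, h₄⟩
          rw [h]
          exact (mem_outEdges_placed G).2 ⟨hj, h₄ ▸ hp'.2, h₅⟩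
        rw [z, z']
    · have hp' : v ∉ K.placed y := h ▸ hp
      have l : x K.n ≤ x v := not_lt.1 fun h => hp ⟨hv, h⟩
      have l' : y K.n ≤ y v := not_lt.1 fun h => hp' ⟨hv, h⟩
      by_cases hT : ∃ j ∈ K.outEdges (K.placed x), K.hd j = v
      · obtain ⟨j, hj, rfl⟩ := hT
        obtain ⟨i, rfl⟩ := e j hj
        exact h₂ i
      · have z : x v = K.n + 1 := by
          by_contra h₃
          obtain ⟨j, hj, h₄, h₅⟩ := A.inv.head v hv l (by have := A.inv.le v; omega) A.two_le
          exact hT ⟨j, (mem_outEdges_placed G).2 ⟨hj, h₅, h₄ ▸ l⟩, h₄⟩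
        have z' : y v = K.n + 1 := by
          by_contra h₃
          obtain ⟨j, hj, h₄, h₅⟩ := A'.inv.head v hv l' (by have := A'.inv.le v; omega) A'.two_le
          refine hT ⟨j, ?_, h₄⟩
          rw [h]
          exact (mem_outEdges_placed G).2 ⟨hj, h₅, h₄ ▸ l'⟩
        rw [z, z']
  · exact hl
  · rw [A.inv.zero v hv, A'.inv.zero v hv]

/-- The pinned coordinate is the tail of an edge from the vertex placed last, supplied by `recent`.
-/
theorem Active.ranks_mem (A : K.Active s x) (G : K.STGraph s t) (hN : K.Narrow k) :
    (fun i => x (K.tails k x i)) ∈ (Fintype.piFinset fun _ : Fin k => Finset.Icc 1 (x K.n - 1)).filter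
      fun f => ∃ i, f i ∈ ({x K.n - 1} : Finset ℕ) := by
  obtain ⟨e₁, e₂⟩ := A.enum G hN
  rw [Finset.mem_filter, Fintype.mem_piFinset]
  refine ⟨fun i => ?_, ?_⟩
  · obtain ⟨hj, h₁, h₂⟩ := (mem_outEdges_placed G).1 (e₁ i)
    have : x (K.tails k x i) ≠ 0 := fun h => by
      have := A.inv.done _ hj h
      omega
    rw [Finset.mem_Icc]
    change x (K.tails k x i) < _ at h₁
    omega
  · obtain ⟨j, hj, h₁, h₂⟩ := A.inv.recent A.two_le A.le
    obtain ⟨i, hi⟩ := e₂ j ((mem_outEdges_placed G).2 ⟨hj, by omega, h₂⟩)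
    refine ⟨i, ?_⟩
    have e : K.tails k x i = K.tl j := congrArg K.tl hi
    simp only [Finset.mem_singleton, e]
    omega

/-- Here the test `Alive` pays off: one head is restricted to two values, where a general head could
have up to n. -/
theorem Active.guesses_mem (A : K.Active s x) (G : K.STGraph s t) (hN : K.Narrow k) :
    (fun i => x (K.heads k x i)) ∈ (Fintype.piFinset fun _ : Fin k => Finset.Icc (x K.n) (K.n + 1)).filter
      fun f => ∃ i, f i ∈ ({x K.n, K.n + 1} : Finset ℕ) := by
  obtain ⟨e₁, e₂⟩ := A.enum G hN
  rw [Finset.mem_filter, Fintype.mem_piFinset]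
  refine ⟨fun i => ?_, ?_⟩
  · obtain ⟨hj, h₁, h₂⟩ := (mem_outEdges_placed G).1 (e₁ i)
    exact Finset.mem_Icc.2 ⟨h₂, A.inv.le _⟩
  · obtain ⟨j, hj, h₁, h₂⟩ := A.alive
    have hle := A.le
    obtain ⟨i, hi⟩ := e₂ j ((mem_outEdges_placed G).2 ⟨hj, h₁, by omega⟩)
    refine ⟨i, ?_⟩
    have e : K.heads k x i = K.hd j := congrArg K.hd hi
    simp only [Finset.mem_insert, Finset.mem_singleton, e]
    omega

theorem sq_le_two_pow {k : ℕ} : (k + 1) ^ 2 ≤ 5 * 2 ^ k := by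
  rcases Nat.lt_or_ge k 3 with h | h
  · interval_cases k <;> norm_num
  · induction k, h using Nat.le_induction with
    | base => norm_num
    | succ k hk ih => rw [pow_succ 2]; nlinarith

/-- Ranks of tails and of heads come from complementary ranges, so the product of the two sizes is
at most n²/2. The factor 2^(-k) gained in this way absorbs (k+1)², the price of choosing the pinned
coordinates. -/
theorem product_bound {n i k : ℕ} (h₂ : i + 1 ≤ n) :
    (k + 1) * (1 * i ^ k) * ((k + 1) * (2 * (n + 1 - i) ^ k)) ≤ 10 * n ^ (2 * k) := by
  have h : 2 * (i * (n + 1 - i)) ≤ n ^ 2 := by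
    obtain ⟨d, rfl⟩ := Nat.exists_eq_add_of_le h₂
    rw [show i + 1 + d + 1 - i = d + 2 by omega]
    nlinarith [sq_nonneg ((i : ℤ) - 1), Nat.zero_le (d * d)]
  calc (k + 1) * (1 * i ^ k) * ((k + 1) * (2 * (n + 1 - i) ^ k))
      = 2 * ((k + 1) ^ 2 * (i * (n + 1 - i)) ^ k) := by rw [mul_pow]; ring
    _ ≤ 2 * (5 * 2 ^ k * (i * (n + 1 - i)) ^ k) := by gcongr; exact sq_le_two_pow
    _ = 10 * (2 * (i * (n + 1 - i))) ^ k := by rw [mul_pow]; ring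
    _ ≤ 10 * (n ^ 2) ^ k := by gcongr
    _ = 10 * n ^ (2 * k) := by rw [pow_mul]

/-- Fibre the placements over the tuple of tails. In a fibre the placed set and the level are
constant, and a placement is determined by the ranks along the tails and the heads, one coordinate
of each tuple being pinned. -/
theorem Active.card_le (G : K.STGraph s t) (hN : K.Narrow (k + 1)) {F : Finset (ℕ → ℕ)}
    (hF : ∀ x ∈ F, K.Active s x) : F.card ≤ 10 * K.n ^ (2 * k) * K.n ^ (k + 1) := by
  classical
  have himg : (F.image (K.tails (k + 1))).card ≤ K.n ^ (k + 1) := by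
    have : F.image (K.tails (k + 1)) ⊆ Fintype.piFinset fun _ : Fin (k + 1) => Finset.range K.n := by
      intro f hf
      obtain ⟨x, hx, rfl⟩ := Finset.mem_image.1 hf
      refine Fintype.mem_piFinset.2 fun i => Finset.mem_range.2 ?_
      exact G.tl_lt _ (mem_outEdges.1 (((hF x hx).enum G hN).1 i)).1
    refine (Finset.card_le_card this).trans ?_
    simp
  refine (Finset.card_le_mul_card_image F (10 * K.n ^ (2 * k)) (f := K.tails (k + 1)) ?_).trans
    (Nat.mul_le_mul_left _ himg)
  intro c hc
  obtain ⟨x, hx, rfl⟩ := Finset.mem_image.1 hc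
  have A := hF x hx
  set P := (Fintype.piFinset fun _ : Fin (k + 1) => Finset.Icc 1 (x K.n - 1)).filter
      fun f => ∃ i, f i ∈ ({x K.n - 1} : Finset ℕ) with hP
  set Q := (Fintype.piFinset fun _ : Fin (k + 1) => Finset.Icc (x K.n) (K.n + 1)).filter
      fun f => ∃ i, f i ∈ ({x K.n, K.n + 1} : Finset ℕ) with hQ
  have hle : (F.filter fun y => K.tails (k + 1) y = K.tails (k + 1) x).card ≤ (P ×ˢ Q).card := by
    refine Finset.card_le_card_of_injOn (fun y => (fun i => y (K.tails (k + 1) y i),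
      fun i => y (K.heads (k + 1) y i))) ?_ ?_
    · intro y hy
      rw [Finset.mem_coe, Finset.mem_filter] at hy
      have A' := hF y hy.1
      have hl := A'.level_eq A (A'.placed_eq A G hN hy.2)
      have p := A'.ranks_mem G hN
      have q := A'.guesses_mem G hN
      rw [hl] at p q
      exact Finset.mem_product.2 ⟨p, q⟩
    · intro y hy z hz hyz
      rw [Finset.mem_coe, Finset.mem_filter] at hy hz
      have A' := hF y hy.1
      have A'' := hF z hz.1
      rw [Prod.mk.injEq] at hyz
      exact A'.eq A'' G hN (A'.placed_eq A'' G hN (hy.2.trans hz.2.symm)) (congrFun hyz.1)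
        (congrFun hyz.2)
  refine hle.trans ?_
  rw [Finset.card_product]
  have h₁ := card_pi_exists_le (k := k + 1) (Finset.Icc 1 (x K.n - 1)) {x K.n - 1}
  have h₂ := card_pi_exists_le (k := k + 1) (Finset.Icc (x K.n) (K.n + 1)) {x K.n, K.n + 1}
  have h₃ : ({x K.n, K.n + 1} : Finset ℕ).card ≤ 2 := Finset.card_le_two
  have hl := A.le
  have hl2 := A.two_le
  rw [Finset.card_singleton, Nat.card_Icc] at h₁
  rw [Nat.card_Icc] at h₂
  simp only [Nat.add_sub_cancel] at h₁ h₂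
  refine (Nat.mul_le_mul h₁ (h₂.trans (Nat.mul_le_mul_left _ (Nat.mul_le_mul_right _ h₃)))).trans ?_
  have := product_bound (n := K.n) (i := x K.n - 1) (k := k) (by omega)
  rwa [show K.n + 1 - (x K.n - 1) = K.n + 1 + 1 - x K.n by omega] at this

/-- There are `O(n ^ (3 k - 2))` reachable placements. -/
theorem bounded (G : K.STGraph s t) (hN : K.Narrow (k + 1)) : K.Bounded (11 * K.n ^ (3 * k + 1)) := by
  classical
  intro F hF
  -- The only placement at level 1 is the start, which accounts for 11 instead of 10.
  have hsub : F ⊆ insert K.start (F.filter fun x => 2 ≤ x K.n) := by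
    intro x hx
    rw [Finset.mem_insert, Finset.mem_filter]
    obtain ⟨I, -, -⟩ := (hF x hx).inv G
    have := I.one_le
    by_cases h : 2 ≤ x K.n
    · exact .inr ⟨hx, h⟩
    · exact .inl (I.first (by omega))
  have h₁ := (Finset.card_le_card hsub).trans (Finset.card_insert_le _ _)
  have h₂ : (F.filter fun x => 2 ≤ x K.n).card ≤ _ := Active.card_le G hN fun x hx => by
    rw [Finset.mem_filter] at hx
    obtain ⟨I, a, b⟩ := (hF x hx.1).inv G
    exact ⟨I, hx.2, a, b.resolve_left (by omega)⟩
  have h₃ : 10 * K.n ^ (2 * k) * K.n ^ (k + 1) = 10 * K.n ^ (3 * k + 1) := by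
    rw [mul_assoc, ← pow_add]; congr 2; ring
  have h₄ : 1 ≤ K.n ^ (3 * k + 1) := Nat.one_le_pow _ _ (by have := G.s_lt; omega)
  omega

end Problem

/-! ### Planar `st`-graphs -/

section Graph

variable {V : Type*} {G : Digraph V} {s t : V}

theorem IsPlanarSTGraph.wellFounded [Finite V] (h : IsPlanarSTGraph G s t) :
    WellFounded (Relation.TransGen G.Adj) :=
  have : Std.Irrefl (Relation.TransGen G.Adj) := ⟨h.acyclic⟩
  Finite.wellFounded_of_trans_of_irrefl _

theorem IsPlanarSTGraph.wellFounded_swap [Finite V] (h : IsPlanarSTGraph G s t) :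
    WellFounded (Function.swap (Relation.TransGen G.Adj)) :=
  have : Std.Irrefl (Function.swap (Relation.TransGen G.Adj)) := ⟨h.acyclic⟩
  have : IsTrans V (Function.swap (Relation.TransGen G.Adj)) := ⟨fun _ _ _ a b => b.trans a⟩
  Finite.wellFounded_of_trans_of_irrefl _

theorem IsPlanarSTGraph.exists_in (h : IsPlanarSTGraph G s t) {v : V} (hv : v ≠ s) :
    ∃ u, G.Adj u v := by
  by_contra! h'
  exact hv ((h.source v).1 h')

theorem IsPlanarSTGraph.exists_out (h : IsPlanarSTGraph G s t) {v : V} (hv : v ≠ t) :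
    ∃ u, G.Adj v u := by
  by_contra! h'
  exact hv ((h.sink v).1 h')

theorem IsPlanarSTGraph.mem_of_sink_mem [Finite V] (h : IsPlanarSTGraph G s t) {D : Set V}
    (hD : ∀ u v, G.Adj u v → v ∈ D → u ∈ D) (ht : t ∈ D) (v : V) : v ∈ D := by
  induction v using h.wellFounded_swap.induction with
  | _ v ih =>
    by_cases hv : v = t
    · exact hv ▸ ht
    · obtain ⟨u, hu⟩ := h.exists_out hv
      exact hD v u hu (ih u (.single hu))

theorem IsPlanarSTGraph.source_mem [Finite V] (h : IsPlanarSTGraph G s t) {D : Set V}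
    (hD : ∀ u v, G.Adj u v → v ∈ D → u ∈ D) (v : V) : v ∈ D → s ∈ D := by
  induction v using h.wellFounded.induction with
  | _ v ih =>
    intro hv
    by_cases hvs : v = s
    · exact hvs ▸ hv
    · obtain ⟨u, hu⟩ := h.exists_in hvs
      exact ih u (.single hu) (hD u v hu hv)

/-- The edges that leave a down-closed set with the source and without the sink are a cutset. -/
theorem IsPlanarSTGraph.isSTCutset [Finite V] (h : IsPlanarSTGraph G s t) {D : Set V}
    (hD : ∀ u v, G.Adj u v → v ∈ D → u ∈ D) (hs : s ∈ D) (ht : t ∉ D) :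
    IsSTCutset G s t {a | G.Adj a.1 a.2 ∧ a.1 ∈ D ∧ a.2 ∉ D} := by
  set W : Set (V × V) := {a | G.Adj a.1 a.2 ∧ a.1 ∈ D ∧ a.2 ∉ D} with hW
  have ne : ∀ {u v}, G.Adj u v → u ≠ v := fun {u v} huv e => by
    subst e; exact h.acyclic u (.single huv)
  have adj : ∀ {u v}, G.Adj u v → (u ∈ D → v ∈ D) → (removeEdges G W).Adj u v :=
    fun {u v} huv hi => ⟨ne huv, .inl ⟨huv, fun hw => hw.2.2 (hi hw.2.1)⟩⟩
  have fwd : ∀ v, v ∈ D → (removeEdges G W).Reachable s v := by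
    intro v
    induction v using h.wellFounded.induction with
    | _ v ih =>
      intro hv
      by_cases hvs : v = s
      · exact hvs ▸ .refl _
      · obtain ⟨u, hu⟩ := h.exists_in hvs
        exact (ih u (.single hu) (hD u v hu hv)).trans (adj hu fun _ => hv).reachable
  have bwd : ∀ v, v ∉ D → (removeEdges G W).Reachable t v := by
    intro v
    induction v using h.wellFounded_swap.induction with
    | _ v ih =>
      intro hv
      by_cases hvt : v = t
      · exact hvt ▸ .refl _
      · obtain ⟨u, hu⟩ := h.exists_out hvt
        exact (ih u (.single hu) fun hu' => hv (hD v u hu hu')).trans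
          (adj hu fun hv' => absurd hv' hv).symm.reachable
  refine ⟨fun a ha => ha.1, fun hr => ht ?_, fun v => ?_, fun a ha => ⟨fwd _ ha.2.1, bwd _ ha.2.2⟩⟩
  · obtain ⟨w⟩ := hr
    have : ∀ {u v} (_ : (removeEdges G W).Walk u v), u ∈ D → v ∈ D := by
      intro u v w
      induction w with
      | nil => exact id
      | cons hadj _ ih =>
        intro hu
        apply ih
        rcases hadj.2 with ⟨h₁, h₂⟩ | ⟨h₁, h₂⟩
        · by_contra h₃
          exact h₂ ⟨h₁, hu, h₃⟩
        · exact hD _ _ h₁ hu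
    exact this w hs
  · by_cases hv : v ∈ D
    · exact .inl (fwd v hv)
    · exact .inr (bwd v hv)

theorem MaxSTCutset.source_ne_sink {k : ℕ} (hk : MaxSTCutset G s t k) : s ≠ t := by
  obtain ⟨⟨W, hW, -⟩, -⟩ := hk
  rintro rfl
  exact hW.separates (.refl _)

/-- A down-closed set that contains the sink is everything, and one without the source is empty;
neither is left by an edge. All others give cutsets. -/
theorem MaxSTCutset.ncard_le [Finite V] {k : ℕ} (hk : MaxSTCutset G s t k)
    (h : IsPlanarSTGraph G s t) {D : Set V} (hD : ∀ u v, G.Adj u v → v ∈ D → u ∈ D) :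
    {a : V × V | G.Adj a.1 a.2 ∧ a.1 ∈ D ∧ a.2 ∉ D}.ncard ≤ k := by
  by_cases ht : t ∈ D
  · have : {a : V × V | G.Adj a.1 a.2 ∧ a.1 ∈ D ∧ a.2 ∉ D} = ∅ :=
      Set.eq_empty_of_forall_notMem fun a ha => ha.2.2 (h.mem_of_sink_mem hD ht _)
    simp [this]
  by_cases hs : s ∈ D
  · exact hk.2 ⟨_, h.isSTCutset hD hs ht, rfl⟩
  · have : {a : V × V | G.Adj a.1 a.2 ∧ a.1 ∈ D ∧ a.2 ∉ D} = ∅ :=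
      Set.eq_empty_of_forall_notMem fun a ha => hs (h.source_mem hD _ ha.2.1)
    simp [this]

/-- The source alone is a down-closed set, and some edge leaves it. -/
theorem MaxSTCutset.one_le [Finite V] {k : ℕ} (hk : MaxSTCutset G s t k)
    (h : IsPlanarSTGraph G s t) : 1 ≤ k := by
  have hs : ∀ u v, G.Adj u v → v ∈ ({s} : Set V) → u ∈ ({s} : Set V) := by
    rintro u v huv rfl
    exact absurd huv ((h.source v).2 rfl u)
  obtain ⟨u, hu⟩ := h.exists_out hk.source_ne_sink
  refine le_trans ?_ (hk.ncard_le h hs)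
  refine Nat.one_le_iff_ne_zero.2 (Set.ncard_ne_zero_of_mem (a := (s, u)) ⟨hu, rfl, fun e => ?_⟩)
  have e' : u = s := e
  exact (h.source s).2 rfl s (e' ▸ hu)

-- From instances to problems

end Graph

namespace PointsetInstance

variable {n m : ℕ} (I : PointsetInstance n m)

/-- The tail of the `j`-th edge. -/
def tl (j : ℕ) : ℕ := if h : j < m then (I.e ⟨j, h⟩).1 else 0

/-- The head of the `j`-th edge. -/
def hd (j : ℕ) : ℕ := if h : j < m then (I.e ⟨j, h⟩).2 else 0

/-- The `x`-coordinate of the `i`-th point. -/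
noncomputable def X (i : ℕ) : ℝ := if h : i < n then (I.p ⟨i, h⟩).1 else 0

/-- The `y`-coordinate of the `i`-th point. -/
noncomputable def Y (i : ℕ) : ℝ := if h : i < n then (I.p ⟨i, h⟩).2 else 0

/-- The instance with sorted points. -/
noncomputable def problem : Problem := sorted n m I.tl I.hd I.X I.Y

variable {I} {G : Digraph (Fin n)} {s t : Fin n}

theorem Lists.adj (hI : I.Lists G) {j : ℕ} (hj : j < m) :
    G.Adj (I.e ⟨j, hj⟩).1 (I.e ⟨j, hj⟩).2 := by
  have : I.e ⟨j, hj⟩ ∈ edges G := hI.2 ▸ Set.mem_range_self _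
  exact this

theorem Lists.exists_edge (hI : I.Lists G) {u v : Fin n} (h : G.Adj u v) :
    ∃ j, ∃ h : j < m, I.e ⟨j, h⟩ = (u, v) := by
  have : (u, v) ∈ Set.range I.e := by rw [hI.2]; exact h
  obtain ⟨j, hj⟩ := this
  exact ⟨j, j.2, hj⟩

theorem tl_eq {j : ℕ} (hj : j < m) : I.tl j = (I.e ⟨j, hj⟩).1 := dif_pos hj

theorem hd_eq {j : ℕ} (hj : j < m) : I.hd j = (I.e ⟨j, hj⟩).2 := dif_pos hj

theorem Lists.adj_iff (hI : I.Lists G) {u v : Fin n} :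
    G.Adj u v ↔ ∃ j < m, I.tl j = u ∧ I.hd j = v := by
  constructor
  · intro h
    obtain ⟨j, hj, he⟩ := hI.exists_edge h
    exact ⟨j, hj, by rw [tl_eq hj, he], by rw [hd_eq hj, he]⟩
  · rintro ⟨j, hj, h₁, h₂⟩
    rw [tl_eq hj] at h₁
    rw [hd_eq hj] at h₂
    rw [← Fin.ext h₁, ← Fin.ext h₂]
    exact hI.adj hj

theorem Lists.down (hI : I.Lists G) {D : Set ℕ}
    (hD : ∀ j < m, I.hd j ∈ D → I.tl j ∈ D) (u v : Fin n) (h : G.Adj u v)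
    (hv : v ∈ {v : Fin n | (v : ℕ) ∈ D}) : u ∈ {v : Fin n | (v : ℕ) ∈ D} := by
  obtain ⟨j, hj, h₁, h₂⟩ := hI.adj_iff.1 h
  have := hD j hj (by rw [h₂]; exact hv)
  rwa [h₁] at this

theorem stGraph (hI : I.Lists G) (h : IsPlanarSTGraph G s t) : I.problem.STGraph s t where
  tl_lt j (hj : j < m) := show I.tl j < n by rw [tl_eq hj]; exact Fin.is_lt _
  hd_lt j (hj : j < m) := show I.hd j < n by rw [hd_eq hj]; exact Fin.is_lt _
  noLoop j (hj : j < m) (e : I.tl j = I.hd j) := by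
    rw [tl_eq hj, hd_eq hj] at e
    have := hI.adj hj
    rw [Fin.ext e] at this
    exact h.acyclic _ (.single this)
  s_lt := s.2
  source v (hv : v < n) := by
    have := h.source ⟨v, hv⟩
    rw [Fin.ext_iff] at this
    rw [← this]
    constructor
    · intro h₁ u hu
      obtain ⟨j, hj, -, h₂⟩ := hI.adj_iff.1 hu
      exact h₁ j hj h₂
    · intro h₁ j (hj : j < m) (h₂ : I.hd j = v)
      rw [hd_eq hj] at h₂
      have := hI.adj hj
      rw [show (I.e ⟨j, hj⟩).2 = ⟨v, hv⟩ from Fin.ext h₂] at this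
      exact h₁ _ this
  sink v (hv : v < n) hvt := by
    obtain ⟨u, hu⟩ := h.exists_out (v := ⟨v, hv⟩) (fun e => hvt (congrArg Fin.val e))
    obtain ⟨j, hj, h₁, -⟩ := hI.adj_iff.1 hu
    exact ⟨j, hj, h₁⟩
  top D hD ht v (hv : v < n) :=
    h.mem_of_sink_mem (D := {v : Fin n | (v : ℕ) ∈ D}) (hI.down hD) ht ⟨v, hv⟩

theorem narrow (hI : I.Lists G) (h : IsPlanarSTGraph G s t) {k : ℕ} (hk : MaxSTCutset G s t k) :
    I.problem.Narrow k := by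
  intro D hD
  refine le_trans ?_ (hk.ncard_le h (hI.down hD))
  rw [← Set.ncard_coe_finset]
  refine Set.ncard_le_ncard_of_injOn
    (fun j => if hj : j < m then I.e ⟨j, hj⟩ else (s, s)) ?_ ?_ (Set.toFinite _)
  · intro j hj
    obtain ⟨hj, h₁, h₂⟩ := Problem.mem_outEdges.1 hj
    change j < m at hj
    change I.tl j ∈ D at h₁
    change I.hd j ∉ D at h₂
    rw [tl_eq hj] at h₁
    rw [hd_eq hj] at h₂
    simp only [hj, dite_true]
    exact ⟨hI.adj hj, h₁, h₂⟩
  · intro j hj j' hj' e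
    obtain ⟨hj, -, -⟩ := Problem.mem_outEdges.1 hj
    obtain ⟨hj', -, -⟩ := Problem.mem_outEdges.1 hj'
    change j < m at hj
    change j' < m at hj'
    simp only [hj, hj', dite_true] at e
    simpa using hI.1 e

/-- By acyclicity all edges out of a vertex leave the set of its ancestors, itself included. This
set is down-closed, so every out-degree is at most k. -/
theorem card_edges_le (hI : I.Lists G) (h : IsPlanarSTGraph G s t) {k : ℕ}
    (hk : MaxSTCutset G s t k) : m ≤ k * n := by
  classical
  have himg : ((Finset.range m).image I.tl).card ≤ n := by
    have : (Finset.range m).image I.tl ⊆ Finset.range n := by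
      intro v hv
      obtain ⟨j, hj, rfl⟩ := Finset.mem_image.1 hv
      exact Finset.mem_range.2 ((stGraph hI h).tl_lt j (Finset.mem_range.1 hj))
    simpa using Finset.card_le_card this
  have := Finset.card_le_mul_card_image (Finset.range m) k (f := I.tl) ?_
  · rw [Finset.card_range] at this
    exact this.trans (Nat.mul_le_mul_left _ himg)
  · intro v hv
    obtain ⟨j₀, hj₀, rfl⟩ := Finset.mem_image.1 hv
    rw [Finset.mem_range] at hj₀
    rw [tl_eq hj₀]
    set u := (I.e ⟨j₀, hj₀⟩).1
    refine le_trans ?_ (narrow hI h hk {v | ∃ w : Fin n, Relation.ReflTransGen G.Adj w u ∧ w = v} ?_)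
    · refine Finset.card_le_card fun j hj => ?_
      rw [Finset.mem_filter, Finset.mem_range] at hj
      refine Problem.mem_outEdges.2 ⟨hj.1, ⟨u, .refl, hj.2.symm⟩, ?_⟩
      rintro ⟨w, hw, e⟩
      have hadj : G.Adj u w := hI.adj_iff.2 ⟨j, hj.1, hj.2, e.symm⟩
      exact h.acyclic u (.head' hadj hw)
    · rintro j (hj : j < m) ⟨w, hw, e⟩
      have hadj : G.Adj (I.e ⟨j, hj⟩).1 w := by
        rw [hI.adj_iff]
        exact ⟨j, hj, tl_eq hj, e.symm⟩
      exact ⟨_, .head hadj hw, (tl_eq hj).symm⟩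

end PointsetInstance

/-! ### Crossings of segments -/

section Segment

variable {A B C D P : Plane}

/-- A segment that is not horizontal is parametrized by height. -/
theorem mem_openSegment_iff (h : A.2 < B.2) :
    P ∈ openSegment ℝ A B ↔ A.2 < P.2 ∧ P.2 < B.2 ∧
      (P.1 - A.1) * (B.2 - A.2) = (P.2 - A.2) * (B.1 - A.1) := by
  have hpos : 0 < B.2 - A.2 := sub_pos.2 h
  constructor
  · rintro ⟨a, b, ha, hb, hab, rfl⟩
    obtain rfl : a = 1 - b := by linarith
    simp only [Prod.fst_add, Prod.snd_add, Prod.smul_fst, Prod.smul_snd, smul_eq_mul]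
    refine ⟨by nlinarith, by nlinarith, by ring⟩
  · rintro ⟨h₁, h₂, h₃⟩
    refine ⟨(B.2 - P.2) / (B.2 - A.2), (P.2 - A.2) / (B.2 - A.2), div_pos (by linarith) hpos,
      div_pos (by linarith) hpos, by field_simp; ring, ?_⟩
    ext
    · simp only [Prod.fst_add, Prod.smul_fst, smul_eq_mul]
      field_simp
      linear_combination -h₃
    · simp only [Prod.snd_add, Prod.smul_snd, smul_eq_mul]
      field_simp
      ring

/-- The horizontal distance between the segments `A B` and `C D` at the height `y`, multiplied by
the heights of both segments. -/
def distAt (A B C D : Plane) (y : ℝ) : ℝ :=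
  (A.1 * (B.2 - A.2) + (y - A.2) * (B.1 - A.1)) * (D.2 - C.2) -
    (C.1 * (D.2 - C.2) + (y - C.2) * (D.1 - C.1)) * (B.2 - A.2)

theorem distAt_swap (y : ℝ) : distAt C D A B y = -distAt A B C D y := by
  unfold distAt; ring

/-- Affinity in the height: the reason why the signs at two heights decide about zeros in between.
-/
theorem distAt_combine (l y z : ℝ) : distAt A B C D ((1 - l) * y + l * z) =
    (1 - l) * distAt A B C D y + l * distAt A B C D z := by
  unfold distAt; ring

theorem distAt_eq_zero (h : A.2 < B.2) (h' : C.2 < D.2) (hP : P ∈ openSegment ℝ A B)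
    (hP' : P ∈ openSegment ℝ C D) : distAt A B C D P.2 = 0 := by
  obtain ⟨-, -, e⟩ := (mem_openSegment_iff h).1 hP
  obtain ⟨-, -, e'⟩ := (mem_openSegment_iff h').1 hP'
  unfold distAt
  linear_combination (C.2 - D.2) * e + (B.2 - A.2) * e'

theorem distAt_bottom (h : A.2 < B.2) (hP : C ∈ openSegment ℝ A B) : distAt A B C D C.2 = 0 := by
  obtain ⟨-, -, e⟩ := (mem_openSegment_iff h).1 hP
  unfold distAt
  linear_combination (C.2 - D.2) * e

theorem distAt_top (h : A.2 < B.2) (hP : D ∈ openSegment ℝ A B) : distAt A B C D D.2 = 0 := by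
  obtain ⟨-, -, e⟩ := (mem_openSegment_iff h).1 hP
  unfold distAt
  linear_combination (C.2 - D.2) * e

theorem bottom_mem_openSegment (h' : C.2 < D.2) (h₁ : A.2 < C.2) (h₂ : C.2 < B.2)
    (e : distAt A B C D C.2 = 0) : C ∈ openSegment ℝ A B := by
  refine (mem_openSegment_iff (h₁.trans h₂)).2 ⟨h₁, h₂, ?_⟩
  have : D.2 - C.2 ≠ 0 := (sub_pos.2 h').ne'
  refine mul_right_cancel₀ this ?_
  unfold distAt at e
  linear_combination -e

theorem top_mem_openSegment (h' : C.2 < D.2) (h₁ : A.2 < D.2) (h₂ : D.2 < B.2)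
    (e : distAt A B C D D.2 = 0) : D ∈ openSegment ℝ A B := by
  refine (mem_openSegment_iff (h₁.trans h₂)).2 ⟨h₁, h₂, ?_⟩
  have : D.2 - C.2 ≠ 0 := (sub_pos.2 h').ne'
  refine mul_right_cancel₀ this ?_
  unfold distAt at e
  linear_combination -e

theorem not_disjoint_openSegment {y : ℝ} (h₁ : A.2 < y) (h₂ : y < B.2) (h₃ : C.2 < y) (h₄ : y < D.2)
    (e : distAt A B C D y = 0) : ¬ Disjoint (openSegment ℝ A B) (openSegment ℝ C D) := by
  have p : 0 < B.2 - A.2 := by linarith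
  have p' : 0 < D.2 - C.2 := by linarith
  refine Set.not_disjoint_iff.2 ⟨(A.1 + (y - A.2) * (B.1 - A.1) / (B.2 - A.2), y),
    (mem_openSegment_iff (h₁.trans h₂)).2 ⟨h₁, h₂, ?_⟩,
    (mem_openSegment_iff (h₃.trans h₄)).2 ⟨h₃, h₄, ?_⟩⟩
  · field_simp
    ring
  · refine mul_right_cancel₀ p.ne' ?_
    unfold distAt at e
    have : (A.1 + (y - A.2) * (B.1 - A.1) / (B.2 - A.2)) * (B.2 - A.2) =
      A.1 * (B.2 - A.2) + (y - A.2) * (B.1 - A.1) := by field_simp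
    dsimp only
    linear_combination e + (D.2 - C.2) * this

end Segment

namespace Problem

variable {K : Problem}

/-- The point of rank `r`. -/
def pt (K : Problem) (r : ℕ) : Plane := (K.px r, K.py r)

/-- The points are sorted by their `y`-coordinates. -/
def Increasing (K : Problem) : Prop :=
  ∀ r r', 1 ≤ r → r ≤ K.n → 1 ≤ r' → r' ≤ K.n → (K.py r < K.py r' ↔ r < r')

theorem gap_eq (a b c d z : ℕ) :
    K.gap a b c d z = distAt (K.pt a) (K.pt b) (K.pt c) (K.pt d) (K.py z) := rfl

variable {a b c d : ℕ}

/-- Segments without a point in common, apart from end points of both, do not cross. -/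
theorem ok_of_disjoint (hK : K.Increasing) (ha : 1 ≤ a) (hc : 1 ≤ c) (hb : b ≤ K.n) (hd : d ≤ K.n)
    (hab : a < b) (hcd : c < d) (hov : max a c < min b d) (hne : ¬ (a = c ∧ b = d))
    (h₁ : Disjoint (openSegment ℝ (K.pt a) (K.pt b)) (openSegment ℝ (K.pt c) (K.pt d)))
    (h₂ : K.pt a ∉ openSegment ℝ (K.pt c) (K.pt d)) (h₃ : K.pt b ∉ openSegment ℝ (K.pt c) (K.pt d))
    (h₄ : K.pt c ∉ openSegment ℝ (K.pt a) (K.pt b)) (h₅ : K.pt d ∉ openSegment ℝ (K.pt a) (K.pt b)) :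
    K.Ok a b c d := by
  have lt : ∀ r r', 1 ≤ r → r' ≤ K.n → r < r' → (K.pt r).2 < (K.pt r').2 := fun r r' a b h =>
    (hK r r' a (by omega) (by omega) b).2 h
  have hlo : a ≠ c → K.gap a b c d (max a c) ≠ 0 := by
    intro hac e
    rw [gap_eq] at e
    rcases lt_or_gt_of_ne hac with h | h
    · rw [max_eq_right h.le] at e
      exact h₄ (bottom_mem_openSegment (lt c d hc hd hcd) (lt a c ha (by omega) h)
        (lt c b hc hb (by omega)) e)
    · rw [max_eq_left h.le] at e
      exact h₂ (bottom_mem_openSegment (lt a b ha hb hab) (lt c a hc (by omega) h)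
        (lt a d ha hd (by omega)) (by rw [distAt_swap]; exact neg_eq_zero.2 e))
  have hhi : b ≠ d → K.gap a b c d (min b d) ≠ 0 := by
    intro hbd e
    rw [gap_eq] at e
    rcases lt_or_gt_of_ne hbd with h | h
    · rw [min_eq_left h.le] at e
      exact h₃ (top_mem_openSegment (lt a b ha hb hab) (lt c b hc hb (by omega))
        (lt b d (by omega) hd h) (by rw [distAt_swap]; exact neg_eq_zero.2 e))
    · rw [min_eq_right h.le] at e
      exact h₅ (top_mem_openSegment (lt c d hc hd hcd) (lt a d ha hd (by omega))
        (lt d b (by omega) hb h) e)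
  unfold Ok
  by_cases hac : a = c
  · have hbd : b ≠ d := fun h => hne ⟨hac, h⟩
    rw [if_pos hac, if_neg hbd]
    exact mul_self_pos.2 (hhi hbd)
  · by_cases hbd : b = d
    · rw [if_neg hac, if_pos hbd]
      exact mul_self_pos.2 (hlo hac)
    · rw [if_neg hac, if_neg hbd]
      have g₁ := hlo hac
      have g₂ := hhi hbd
      by_contra hn
      have hn' : K.gap a b c d (max a c) * K.gap a b c d (min b d) < 0 :=
        lt_of_le_of_ne (not_lt.1 hn) (mul_ne_zero g₁ g₂)
      set g := K.gap a b c d (max a c) with hg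
      set g' := K.gap a b c d (min b d) with hg'
      have hlt := lt (max a c) (min b d) (by omega) (by omega) hov
      have hlt' : K.py (max a c) < K.py (min b d) := hlt
      have hgg : g - g' ≠ 0 := fun h => by
        have : g = g' := by linarith
        rw [this] at hn'
        nlinarith [mul_self_nonneg g']
      have hl : 0 < g / (g - g') ∧ g / (g - g') < 1 := by
        rcases lt_or_gt_of_ne hgg with h | h
        · have : g < 0 := by nlinarith
          have : 0 < g' := by nlinarith
          exact ⟨div_pos_of_neg_of_neg (by assumption) h, by rw [div_lt_one_of_neg h]; linarith⟩
        · have : 0 < g := by nlinarith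
          have : g' < 0 := by nlinarith
          exact ⟨div_pos (by assumption) h, by rw [div_lt_one h]; linarith⟩
      -- The parameter at which the affine function with end values `g` and `g'` of opposite signs
      -- vanishes; at that height the segments meet.
      set l := g / (g - g') with hldef
      have e : distAt (K.pt a) (K.pt b) (K.pt c) (K.pt d)
          ((1 - l) * K.py (max a c) + l * K.py (min b d)) = 0 := by
        rw [distAt_combine, ← gap_eq, ← gap_eq, ← hg, ← hg', hldef]
        field_simp
        ring
      have y₁ : K.py (max a c) < (1 - l) * K.py (max a c) + l * K.py (min b d) := by nlinarith
      have y₂ : (1 - l) * K.py (max a c) + l * K.py (min b d) < K.py (min b d) := by nlinarith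
      have le : ∀ r r', 1 ≤ r → r ≤ r' → r' ≤ K.n → K.py r ≤ K.py r' := fun r r' h h' h'' => by
        rcases h'.eq_or_lt with rfl | h'
        exacts [le_rfl, (lt r r' h h'' h').le]
      refine not_disjoint_openSegment (lt_of_le_of_lt (le a _ ha (le_max_left _ _) (by omega)) y₁)
        (lt_of_lt_of_le y₂ (le _ b (by omega) (min_le_left _ _) hb))
        (lt_of_le_of_lt (le c _ hc (le_max_right _ _) (by omega)) y₁)
        (lt_of_lt_of_le y₂ (le _ d (by omega) (min_le_right _ _) hd)) e h₁

theorem Ok.bottom_ne (h : K.Ok a b c d) (hac : a ≠ c) : K.gap a b c d (max a c) ≠ 0 := by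
  unfold Ok at h
  rw [if_neg hac] at h
  exact left_ne_zero_of_mul h.ne'

theorem Ok.top_ne (h : K.Ok a b c d) (hbd : b ≠ d) : K.gap a b c d (min b d) ≠ 0 := by
  unfold Ok at h
  rw [if_neg hbd] at h
  exact right_ne_zero_of_mul h.ne'

/-- A common interior point lies strictly inside the overlap of heights and is a zero of the affine
gap. This is impossible if the gap has equal signs at the two ends, or vanishes at a shared end
point and not at the other end. -/
theorem Ok.disjoint (hK : K.Increasing) (ha : 1 ≤ a) (hc : 1 ≤ c) (hb : b ≤ K.n) (hd : d ≤ K.n)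
    (hab : a < b) (hcd : c < d) (h : max a c < min b d → K.Ok a b c d) :
    Disjoint (openSegment ℝ (K.pt a) (K.pt b)) (openSegment ℝ (K.pt c) (K.pt d)) := by
  have lt : ∀ r r', 1 ≤ r → r' ≤ K.n → r < r' → (K.pt r).2 < (K.pt r').2 := fun r r' a b h =>
    (hK r r' a (by omega) (by omega) b).2 h
  rw [Set.disjoint_left]
  intro P hP hP'
  have e := distAt_eq_zero (lt a b ha hb hab) (lt c d hc hd hcd) hP hP'
  obtain ⟨p₁, p₂, -⟩ := (mem_openSegment_iff (lt a b ha hb hab)).1 hP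
  obtain ⟨p₃, p₄, -⟩ := (mem_openSegment_iff (lt c d hc hd hcd)).1 hP'
  have y₁ : K.py (max a c) < P.2 := by rcases max_choice a c with h | h <;> rw [h] <;> assumption
  have y₂ : P.2 < K.py (min b d) := by rcases min_choice b d with h | h <;> rw [h] <;> assumption
  have hov : max a c < min b d :=
    (hK _ _ (by omega) (by omega) (by omega) (by omega)).1 (y₁.trans y₂)
  have hok := h hov
  have hpos : 0 < K.py (min b d) - K.py (max a c) := by linarith
  set l := (P.2 - K.py (max a c)) / (K.py (min b d) - K.py (max a c)) with hl
  have l₀ : 0 < l := div_pos (by linarith) hpos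
  have l₁ : l < 1 := by rw [hl, div_lt_one hpos]; linarith
  have hPl : P.2 = (1 - l) * K.py (max a c) + l * K.py (min b d) := by
    rw [hl]; field_simp; ring
  rw [hPl, distAt_combine, ← gap_eq, ← gap_eq] at e
  unfold Ok at hok
  have zero : ∀ r, K.gap r b r d r = 0 := fun r => by unfold gap; ring
  have zero' : ∀ r, K.gap a r c r r = 0 := fun r => by unfold gap; ring
  by_cases hac : a = c
  · subst hac
    have : K.gap a b a d (max a a) = 0 := by rw [max_self]; exact zero a
    rw [this, mul_zero, zero_add] at e
    have g := (mul_eq_zero.1 e).resolve_left l₀.ne'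
    rw [if_pos rfl, g, zero_mul] at hok
    exact lt_irrefl _ hok
  · by_cases hbd : b = d
    · subst hbd
      have : K.gap a b c b (min b b) = 0 := by rw [min_self]; exact zero' b
      rw [this, mul_zero, add_zero] at e
      have g := (mul_eq_zero.1 e).resolve_left (by linarith)
      rw [if_neg hac, g, zero_mul] at hok
      exact lt_irrefl _ hok
    · rw [if_neg hac, if_neg hbd] at hok
      rcases pos_and_pos_or_neg_and_neg_of_mul_pos hok with ⟨g₁, g₂⟩ | ⟨g₁, g₂⟩
      · nlinarith [mul_pos l₀ g₂, mul_pos (sub_pos.2 l₁) g₁]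
      · nlinarith [mul_neg_of_pos_of_neg l₀ g₂, mul_neg_of_pos_of_neg (sub_pos.2 l₁) g₁]

end Problem

/-! ### Solutions of the sorted problem are the upward pointset embeddings -/

namespace PointsetInstance

variable {n m : ℕ} {I : PointsetInstance n m} {G : Digraph (Fin n)} {s t : Fin n}

theorem Y_injOn (hY : Function.Injective fun i => (I.p i).2) : Set.InjOn I.Y (Set.Iio n) := by
  intro i (hi : i < n) j (hj : j < n) h
  simp only [Y, hi, hj, dite_true] at h
  simpa using hY h

theorem increasing (hY : Function.Injective fun i => (I.p i).2) : I.problem.Increasing := by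
  intro r r' h₁ (h₂ : r ≤ n) h₃ (h₄ : r' ≤ n)
  obtain ⟨a, b⟩ := atRank_spec (Y_injOn hY) h₁ h₂
  obtain ⟨c, d⟩ := atRank_spec (Y_injOn hY) h₃ h₄
  change (if r = 0 then 0 else I.Y (atRank n I.Y r)) < (if r' = 0 then 0 else I.Y (atRank n I.Y r')) ↔ _
  rw [if_neg (by omega), if_neg (by omega), ← rank_lt_iff a c, b, d]

theorem pt_eq (hY : Function.Injective fun i => (I.p i).2) {r : ℕ} (h₁ : 1 ≤ r) (h₂ : r ≤ n) :
    I.problem.pt r = I.p ⟨atRank n I.Y r, (atRank_spec (Y_injOn hY) h₁ h₂).1⟩ := by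
  have h := (atRank_spec (Y_injOn hY) h₁ h₂).1
  change (if r = 0 then 0 else I.X (atRank n I.Y r), if r = 0 then 0 else I.Y (atRank n I.Y r)) = _
  rw [if_neg (by omega), if_neg (by omega), X, Y, dif_pos h, dif_pos h]

/-- The assignments of ranks that solve the instance are the upward pointset embeddings. -/
theorem solution_iff (hI : I.Lists G) (h : IsPlanarSTGraph G s t) (hst : s ≠ t)
    (hY : Function.Injective fun i => (I.p i).2) {ψ : ℕ → ℕ}
    (hψ : ∀ v < n, 1 ≤ ψ v ∧ ψ v ≤ n) :
    I.problem.Solution ψ ↔ IsUPSE G I.pointset (fun v => I.problem.pt (ψ v)) := by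
  have hK := increasing hY
  have lt : ∀ u v : Fin n, (I.problem.pt (ψ u)).2 < (I.problem.pt (ψ v)).2 ↔ ψ u < ψ v := fun u v =>
    hK _ _ (hψ u u.2).1 (hψ u u.2).2 (hψ v v.2).1 (hψ v v.2).2
  have inj : (Function.Injective fun v : Fin n => I.problem.pt (ψ v)) ↔
      ∀ u < n, ∀ v < n, ψ u = ψ v → u = v := by
    constructor
    · intro hi u hu v hv e
      exact congrArg Fin.val (@hi ⟨u, hu⟩ ⟨v, hv⟩ (congrArg I.problem.pt e))
    · intro hi u v e
      refine Fin.ext (hi u u.2 v v.2 ?_)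
      have e' : (I.problem.pt (ψ u)).2 = (I.problem.pt (ψ v)).2 := congrArg Prod.snd e
      have h₁ := (lt u v).not.1 e'.not_lt
      have h₂ := (lt v u).not.1 e'.symm.not_lt
      omega
  constructor
  · intro hs
    have up : ∀ u v : Fin n, G.Adj u v → ψ u < ψ v := fun u v huv => by
      obtain ⟨j, hj, h₁, h₂⟩ := hI.adj_iff.1 huv
      rw [← h₁, ← h₂]
      exact hs.up j hj
    have ok : ∀ u v u' v' : Fin n, G.Adj u v → G.Adj u' v' → (u, v) ≠ (u', v') →
        max (ψ u) (ψ u') < min (ψ v) (ψ v') → I.problem.Ok (ψ u) (ψ v) (ψ u') (ψ v') := by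
      intro u v u' v' huv huv' hne hov
      obtain ⟨j, hj, h₁, h₂⟩ := hI.adj_iff.1 huv
      obtain ⟨j', hj', h₃, h₄⟩ := hI.adj_iff.1 huv'
      have := hs.ok j hj j' hj' (by
        rintro rfl
        exact hne (Prod.ext (Fin.ext (h₁.symm.trans h₃)) (Fin.ext (h₂.symm.trans h₄))))
      change max (ψ (I.tl j)) (ψ (I.tl j')) < min (ψ (I.hd j)) (ψ (I.hd j')) →
        I.problem.Ok (ψ (I.tl j)) (ψ (I.hd j)) (ψ (I.tl j')) (ψ (I.hd j')) at this
      rw [h₁, h₂, h₃, h₄] at this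
      exact this hov
    refine ⟨inj.2 hs.inj, fun v => ?_, fun u v huv => (lt u v).2 (up u v huv), ?_, ?_⟩
    · rw [pt_eq hY (hψ v v.2).1 (hψ v v.2).2]
      exact Set.mem_range_self _
    · intro u v w huv hw
      have huv' := (lt u v).2 (up u v huv)
      obtain ⟨p₁, p₂, -⟩ := (mem_openSegment_iff huv').1 hw
      have l₁ := (lt u w).1 p₁
      have l₂ := (lt w v).1 p₂
      -- A vertex inside an edge is excluded through an edge at that vertex, an outgoing one for the
      -- source and an incoming one otherwise: the gap to it would vanish at the height of the
      -- vertex, which `Ok` forbids.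
      by_cases hws : w = s
      · obtain ⟨w', hw'⟩ := h.exists_out (v := w) (hws ▸ hst)
        have l₃ := up w w' hw'
        refine (ok u v w w' huv hw' (fun e => ?_) (by omega)).bottom_ne (by omega) ?_
        · rw [(Prod.mk.inj e).1] at l₁
          exact lt_irrefl _ l₁
        · rw [max_eq_right l₁.le]
          exact (Problem.gap_eq ..).trans (distAt_bottom huv' hw)
      · obtain ⟨w', hw'⟩ := h.exists_in hws
        have l₃ := up w' w hw'
        refine (ok u v w' w huv hw' (fun e => ?_) (by omega)).top_ne (by omega) ?_
        · rw [(Prod.mk.inj e).2] at l₂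
          exact lt_irrefl _ l₂
        · rw [min_eq_right l₂.le]
          exact (Problem.gap_eq ..).trans (distAt_top huv' hw)
    · intro u v u' v' huv huv' hne
      exact Problem.Ok.disjoint hK (hψ u u.2).1 (hψ u' u'.2).1 (hψ v v.2).2 (hψ v' v'.2).2
        (up u v huv) (up u' v' huv') (ok u v u' v' huv huv' hne)
  · intro hu
    refine ⟨hψ, inj.1 hu.injective, fun j (hj : j < m) => ?_,
      fun j (hj : j < m) j' (hj' : j' < m) hne hov => ?_⟩
    · change ψ (I.tl j) < ψ (I.hd j)
      rw [tl_eq hj, hd_eq hj]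
      exact (lt _ _).1 (hu.upward _ _ (hI.adj hj))
    · change max (ψ (I.tl j)) (ψ (I.tl j')) < min (ψ (I.hd j)) (ψ (I.hd j')) at hov
      change I.problem.Ok (ψ (I.tl j)) (ψ (I.hd j)) (ψ (I.tl j')) (ψ (I.hd j'))
      rw [tl_eq hj, hd_eq hj, tl_eq hj', hd_eq hj'] at hov ⊢
      have e := hI.adj hj
      have e' := hI.adj hj'
      have hne' : ((I.e ⟨j, hj⟩).1, (I.e ⟨j, hj⟩).2) ≠ ((I.e ⟨j', hj'⟩).1, (I.e ⟨j', hj'⟩).2) :=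
        fun he => hne (by simpa using hI.1 he)
      refine Problem.ok_of_disjoint hK (hψ _ (Fin.is_lt _)).1 (hψ _ (Fin.is_lt _)).1
        (hψ _ (Fin.is_lt _)).2 (hψ _ (Fin.is_lt _)).2
        ((lt _ _).1 (hu.upward _ _ e)) ((lt _ _).1 (hu.upward _ _ e')) hov ?_
        (hu.edge_edge _ _ _ _ e e' hne') (hu.vertex_edge _ _ _ e') (hu.vertex_edge _ _ _ e')
        (hu.vertex_edge _ _ _ e) (hu.vertex_edge _ _ _ e)
      rintro ⟨h₁, h₂⟩
      refine hne' (Prod.ext (hu.injective ?_) (hu.injective ?_))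
      exacts [congrArg I.problem.pt h₁, congrArg I.problem.pt h₂]

theorem exists_solution_iff (hI : I.Lists G) (h : IsPlanarSTGraph G s t) (hst : s ≠ t)
    (hY : Function.Injective fun i => (I.p i).2) :
    (∃ ψ, I.problem.Solution ψ) ↔ ∃ φ, IsUPSE G I.pointset φ := by
  constructor
  · rintro ⟨ψ, hs⟩
    exact ⟨_, (solution_iff hI h hst hY hs.range).1 hs⟩
  · rintro ⟨φ, hφ⟩
    choose f hf using hφ.mem
    have hr : ∀ i : Fin n, 1 ≤ rank n I.Y i ∧ rank n I.Y i ≤ n := fun i =>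
      ⟨Nat.le_add_right _ _, rank_le i.2⟩
    have hpt : ∀ i : Fin n, I.problem.pt (rank n I.Y i) = I.p i := fun i => by
      rw [pt_eq hY (hr i).1 (hr i).2]
      congr 1
      obtain ⟨a, b⟩ := atRank_spec (Y_injOn hY) (hr i).1 (hr i).2
      exact Fin.ext (rank_inj (Y_injOn hY) a i.2 b)
    refine ⟨fun v => if hv : v < n then rank n I.Y (f ⟨v, hv⟩) else 0,
      (solution_iff hI h hst hY ?_).2 ?_⟩
    · intro v hv
      simp only [hv, dite_true]
      exact hr _
    · convert hφ using 1
      funext v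
      simp only [Fin.is_lt, dite_true, Fin.eta, hpt, hf]

end PointsetInstance

/-! ### Time and space -/

namespace Cmd

/-- The nesting depth of the loops. -/
def depth : Cmd → ℕ
  | skip => 0
  | assign _ _ => 0
  | store _ _ => 0
  | rstore _ _ => 0
  | seq c d => max c.depth d.depth
  | ifLt _ _ c d => max c.depth d.depth
  | ifEq _ _ c d => max c.depth d.depth
  | ifR _ _ c d => max c.depth d.depth
  | loop _ _ c => c.depth + 1

/-- Each level of loop nesting costs at most one factor `B`; all the rest is independent of `B` and
is collected by evaluating the bound at 1. -/
theorem time_le {B : ℕ} (hB : 1 ≤ B) : ∀ c : Cmd, ∀ e, c.depth ≤ e → c.time B ≤ c.time 1 * B ^ e := by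
  have pos : ∀ e, 1 ≤ B ^ e := fun e => Nat.one_le_pow _ _ hB
  have const : ∀ k e, k ≤ k * B ^ e := fun k e => Nat.le_mul_of_pos_right _ (pos e)
  have branch : ∀ k e x y x' y', x ≤ x' * B ^ e → y ≤ y' * B ^ e →
      k + x + y ≤ (k + x' + y') * B ^ e := by
    intro k e x y x' y' h₁ h₂
    rw [Nat.add_mul, Nat.add_mul]
    exact Nat.add_le_add (Nat.add_le_add (const k e) h₁) h₂
  intro c
  induction c with
  | skip => intro e _; exact Nat.zero_le _
  | assign x f => intro e _; exact const _ e
  | store f g => intro e _; exact const _ e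
  | rstore f g => intro e _; exact const _ e
  | seq c d ihc ihd =>
    intro e h
    have := branch 0 e _ _ _ _ (ihc e ((le_max_left _ _).trans h)) (ihd e ((le_max_right _ _).trans h))
    simpa only [time, Nat.zero_add] using this
  | ifLt f g c d ihc ihd =>
    intro e h
    exact branch _ e _ _ _ _ (ihc e ((le_max_left _ _).trans h)) (ihd e ((le_max_right _ _).trans h))
  | ifEq f g c d ihc ihd =>
    intro e h
    exact branch _ e _ _ _ _ (ihc e ((le_max_left _ _).trans h)) (ihd e ((le_max_right _ _).trans h))
  | ifR f g c d ihc ihd =>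
    intro e h
    exact branch _ e _ _ _ _ (ihc e ((le_max_left _ _).trans h)) (ihd e ((le_max_right _ _).trans h))
  | loop x y c ih =>
    intro e h
    obtain ⟨e, rfl⟩ : ∃ e', e = e' + 1 := ⟨e - 1, by simp only [depth] at h; omega⟩
    have h₁ := ih e (by simp only [depth] at h; omega)
    have h₂ := pos (e + 1)
    simp only [time, one_mul]
    calc B * (c.time B + 3) + 2 ≤ B * (c.time 1 * B ^ e + 3 * B ^ e) + 2 * B ^ (e + 1) := by
          gcongr
          · exact const 3 e
          · exact const 2 (e + 1)
      _ = (c.time 1 + 3 + 2) * B ^ (e + 1) := by ring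

/-- The constant in the bounds on time and space. -/
def bound : ℕ := 64 + 32 * (preludeC.time 1 + 12 * (visitC.time 1 + outC.time 1 + 2) + 10)

end Cmd

section Bounds

variable {n m k : ℕ}

theorem succ_le_pow (hn : 2 ≤ n) : k + 1 ≤ n ^ k :=
  (Nat.lt_two_pow_self (n := k)).trans_le (Nat.pow_le_pow_left hn k)

/-- The edge bound m ≤ (k+1) n brings powers of k into the running time; as n is at least 2, a
factor n^k swallows them. -/
theorem cube_le_pow (hn : 2 ≤ n) : (k + 3) ^ 3 ≤ 32 * n ^ k := by
  refine le_trans ?_ (Nat.mul_le_mul_left 32 (Nat.pow_le_pow_left hn k))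
  rcases Nat.lt_or_ge k 3 with h | h
  · interval_cases k <;> norm_num
  · induction k, h using Nat.le_induction with
    | base => norm_num
    | succ k hk ih =>
      rw [pow_succ 2]
      have : (k + 1 + 3) ^ 3 ≤ 2 * (k + 3) ^ 3 := by nlinarith [Nat.mul_le_mul hk hk]
      omega

/-- With N = 11 n^(3k+1) placements there are at most 1 + n (N + 1) nodes and as many placement
records, of n + 2 cells each. The leading term is 22 n^(3k+3), and 64 leaves room for the rest. -/
theorem space_bound (hn : 2 ≤ n) (hm : m ≤ (k + 1) * n) :
    2 * m + 3 * n + 2 + (2 * (1 + n * (11 * n ^ (3 * k + 1) + 1)) + 2) * (n + 2) ≤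
      Cmd.bound * n ^ (3 * (k + 1)) := by
  have h₀ : 1 ≤ n ^ (3 * k) := Nat.one_le_pow _ _ (by omega)
  have h₁ : k + 1 ≤ n ^ (3 * k) :=
    (succ_le_pow hn).trans (Nat.pow_le_pow_right (by omega) (by omega))
  have e₁ : n ^ (3 * (k + 1)) = n ^ (3 * k) * n ^ 3 := by rw [← pow_add]; congr 1
  have e₂ : n ^ (3 * k + 1) = n ^ (3 * k) * n := pow_succ _ _
  rw [e₁, e₂]
  set Z := n ^ (3 * k)
  have hm' : m ≤ Z * n ^ 3 := by
    refine hm.trans (Nat.mul_le_mul h₁ ?_)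
    exact Nat.le_self_pow (by norm_num) n
  have a₁ : n ≤ Z * n ^ 3 := (Nat.le_self_pow (by norm_num) n).trans (Nat.le_mul_of_pos_left _ h₀)
  have a₂ : n ^ 2 ≤ Z * n ^ 3 :=
    (Nat.pow_le_pow_right (by omega) (by norm_num)).trans (Nat.le_mul_of_pos_left _ h₀)
  have a₃ : Z * n ^ 2 ≤ Z * n ^ 3 :=
    Nat.mul_le_mul_left _ (Nat.pow_le_pow_right (by omega) (by norm_num))
  have a₄ : 64 * (Z * n ^ 3) ≤ Cmd.bound * (Z * n ^ 3) :=
    Nat.mul_le_mul_right _ (Nat.le_add_right _ _)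
  have e₃ : (2 * (1 + n * (11 * (Z * n) + 1)) + 2) * (n + 2) =
      22 * (Z * n ^ 3) + 44 * (Z * n ^ 2) + 2 * n ^ 2 + 8 * n + 8 := by ring
  have a₅ : 4 * (Z * n ^ 2) ≤ 2 * (Z * n ^ 3) := by
    have : Z * n ^ 3 = Z * n ^ 2 * n := by ring
    rw [this]; nlinarith [Nat.mul_le_mul_left (Z * n ^ 2) hn]
  rw [e₃]
  omega

/-- Exploring one placement nests three loops: over the steps, and over pairs of edges. Its cost
(m+n+1)³ is at most 32 n^(k+3), to be multiplied by O(n^(3k+1)) placements; 12 comes from 11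
n^(3k+1) + 1. -/
theorem time_bound (hn : 2 ≤ n) (hm : m ≤ (k + 1) * n) :
    Cmd.preludeC.time (m + n + 1) + (11 * n ^ (3 * k + 1) + 1) *
      (Cmd.visitC.time (m + n + 1) + Cmd.outC.time (m + n + 1) + 2) + 10 ≤
      Cmd.bound * n ^ (4 * (k + 1)) := by
  set B := m + n + 1 with hB
  have p := Cmd.time_le (B := B) (by omega) Cmd.preludeC 3 (by decide)
  have v := Cmd.time_le (B := B) (by omega) Cmd.visitC 3 (by decide)
  have o := Cmd.time_le (B := B) (by omega) Cmd.outC 3 (by decide)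
  have hBk : B ≤ (k + 3) * n := by
    have : (k + 3) * n = (k + 1) * n + 2 * n := by ring
    omega
  have hB3 : B ^ 3 ≤ 32 * n ^ (k + 3) := by
    calc B ^ 3 ≤ ((k + 3) * n) ^ 3 := Nat.pow_le_pow_left hBk 3
      _ = (k + 3) ^ 3 * n ^ 3 := mul_pow _ _ _
      _ ≤ 32 * n ^ k * n ^ 3 := Nat.mul_le_mul_right _ (cube_le_pow hn)
      _ = 32 * n ^ (k + 3) := by ring
  have h1 : 1 ≤ B ^ 3 := Nat.one_le_pow _ _ (by omega)
  have hpos : 1 ≤ n ^ (3 * k + 1) := Nat.one_le_pow _ _ (by omega)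
  set p₁ := Cmd.preludeC.time 1
  set v₁ := Cmd.visitC.time 1
  set o₁ := Cmd.outC.time 1
  calc Cmd.preludeC.time B + (11 * n ^ (3 * k + 1) + 1) *
        (Cmd.visitC.time B + Cmd.outC.time B + 2) + 10
      ≤ p₁ * B ^ 3 * n ^ (3 * k + 1) + (12 * n ^ (3 * k + 1)) *
        (v₁ * B ^ 3 + o₁ * B ^ 3 + 2 * B ^ 3) + 10 * B ^ 3 * n ^ (3 * k + 1) := by
        have h₂ : 11 * n ^ (3 * k + 1) + 1 ≤ 12 * n ^ (3 * k + 1) := by omega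
        have h₃ : 10 ≤ 10 * B ^ 3 * n ^ (3 * k + 1) := by
          rw [mul_assoc]
          exact Nat.le_mul_of_pos_right _ (Nat.mul_pos h1 hpos)
        have h₄ : Cmd.preludeC.time B ≤ p₁ * B ^ 3 * n ^ (3 * k + 1) :=
          p.trans (Nat.le_mul_of_pos_right _ hpos)
        have h₅ : Cmd.visitC.time B + Cmd.outC.time B + 2 ≤ v₁ * B ^ 3 + o₁ * B ^ 3 + 2 * B ^ 3 := by
          omega
        exact Nat.add_le_add (Nat.add_le_add h₄ (Nat.mul_le_mul h₂ h₅)) h₃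
    _ = (p₁ + 12 * (v₁ + o₁ + 2) + 10) * (B ^ 3 * n ^ (3 * k + 1)) := by ring
    _ ≤ (p₁ + 12 * (v₁ + o₁ + 2) + 10) * (32 * n ^ (k + 3) * n ^ (3 * k + 1)) := by gcongr
    _ = 32 * (p₁ + 12 * (v₁ + o₁ + 2) + 10) * n ^ (4 * (k + 1)) := by ring
    _ ≤ Cmd.bound * n ^ (4 * (k + 1)) := Nat.mul_le_mul_right _ (Nat.le_add_left _ _)

end Bounds

namespace PointsetInstance

variable {n m : ℕ} {I : PointsetInstance n m}

/-- The initial state. -/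
noncomputable def start (I : PointsetInstance n m) : HS :=
  ⟨fun x => I.initial.reg x.idx, I.initial.mem, I.initial.rmem⟩

theorem input : Input n m I.tl I.hd I.X I.Y I.start where
  var x h₁ h₂ := by
    have h₃ : x.idx ≠ 0 := fun e => h₁ (Var.idx_inj.1 e)
    have h₄ : x.idx ≠ 1 := fun e => h₂ (Var.idx_inj.1 e)
    simp [start, initial, h₃, h₄]
  vn := rfl
  vm := rfl
  etl j hj := by simp [start, initial, tl, hj]
  ehd j hj := by
    have : (2 * j + 1) / 2 = j := by omega
    have h' : (2 * j + 1) % 2 = 1 := by omega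
    simp [start, initial, hd, hj, this, h']
  mem a ha := by simp [start, initial, show ¬ a / 2 < m by omega]
  x i hi := by simp [start, initial, X, hi]
  y i hi := by
    have : (2 * i + 1) / 2 = i := by omega
    have h' : (2 * i + 1) % 2 = 1 := by omega
    simp [start, initial, Y, hi, this, h']
  rmem a ha := by simp [start, initial, show ¬ a / 2 < n by omega]

theorem rep {W : ℕ} (hn : n ≤ W) (hm : m ≤ W) : Rep W I.initial I.start where
  reg _ := rfl
  mem := rfl
  rmem := rfl
  regLe r := by
    simp only [initial]
    split_ifs <;> omega
  memLe a := by
    simp only [initial]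
    split_ifs with h₁ h₂
    · have := (I.e ⟨a / 2, h₁⟩).1.is_lt; omega
    · have := (I.e ⟨a / 2, h₁⟩).2.is_lt; omega
    · omega

end PointsetInstance

end UPSE

theorem theorem3 :
    ∃ (P : UPSE.Prog) (C : ℕ), ∀ (n m k : ℕ) (G : Digraph (Fin n)) (s t : Fin n)
      (I : UPSE.PointsetInstance n m),
      UPSE.IsPlanarSTGraph G s t →
      UPSE.MaxSTCutset G s t k →
      I.Lists G →
      Function.Injective (fun i => (I.p i).2) →
      ∃ (T : ℕ) (σ : UPSE.State),
        T ≤ C * n ^ (4 * k) ∧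
        UPSE.Exec (C * n ^ (3 * k)) (C * n ^ (4 * k)) P I.initial T σ ∧
        -- register 0 holds the answer to the decision problem
        (σ.reg 0 = 0 ∨ σ.reg 0 = 1) ∧
        (σ.reg 0 = 1 ↔ ∃ φ : Fin n → UPSE.Plane, UPSE.IsUPSE G I.pointset φ) ∧
        -- if the answer is yes, word cell `v` holds the index of the point on which `v` is placed
        (σ.reg 0 = 1 → ∃ f : Fin n → Fin n,
          (∀ v : Fin n, σ.mem v = f v) ∧ UPSE.IsUPSE G I.pointset (fun v => I.p (f v))) := by
  refine ⟨UPSE.Cmd.program, UPSE.Cmd.bound, fun n m k G s t I hG hk hI hY => ?_⟩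
  have hst := hk.source_ne_sink
  have hn : 2 ≤ n := by
    have h₁ := s.is_lt
    have h₂ := t.is_lt
    have h₃ : (s : ℕ) ≠ t := fun e => hst (Fin.ext e)
    omega
  -- A maximum cutset is not empty. Writing its size as k + 1 avoids truncated subtraction in the
  -- exponents.
  obtain ⟨k, rfl⟩ : ∃ k', k = k' + 1 := ⟨k - 1, by have := hk.one_le hG; omega⟩
  have hm := UPSE.PointsetInstance.card_edges_le hI hG hk
  have hST := UPSE.PointsetInstance.stGraph hI hG
  have hspace := UPSE.space_bound hn hm
  have htime := UPSE.time_bound hn hm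
  have hLW : UPSE.Cmd.bound * n ^ (3 * (k + 1)) ≤ UPSE.Cmd.bound * n ^ (4 * (k + 1)) :=
    Nat.mul_le_mul_left _ (Nat.pow_le_pow_right (by omega) (by omega))
  have hroom : 2 * n + 4 ≤ (2 * (1 + n * (11 * n ^ (3 * k + 1) + 1)) + 2) * (n + 2) := by
    have : 2 ≤ 2 * (1 + n * (11 * n ^ (3 * k + 1) + 1)) + 2 := by omega
    exact le_trans (by omega) (Nat.mul_le_mul_right (n + 2) this)
  -- `N` bounds the number of placements and `M` the number of trie nodes; `B` dominates all loop
  -- bounds, namely n, n + 1 and m.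
  obtain ⟨T, σ, hT, hx, h₀, h₁, h₂⟩ := UPSE.Cmd.program_exec
    (L := UPSE.Cmd.bound * n ^ (3 * (k + 1))) (W := UPSE.Cmd.bound * n ^ (4 * (k + 1)))
    (B := m + n + 1) (M := 1 + n * (11 * n ^ (3 * k + 1) + 1)) (N := 11 * n ^ (3 * k + 1))
    UPSE.PointsetInstance.input (UPSE.PointsetInstance.rep (I := I) (by omega) (by omega))
    (UPSE.PointsetInstance.Y_injOn hY) hST
    ⟨hST.tl_lt, hST.hd_lt, show 1 ≤ n by omega, show 2 * m + 4 * n + 4 ≤ _ by omega, hLW, le_rfl⟩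
    hspace (UPSE.Problem.bounded hST (UPSE.PointsetInstance.narrow hI hG hk)) le_rfl
  refine ⟨T, σ, hT.trans htime, hx, h₀,
    h₁.trans (UPSE.PointsetInstance.exists_solution_iff hI hG hst hY), fun h => ?_⟩
  obtain ⟨ψ, hψ, hmem⟩ := h₂ h
  refine ⟨fun v => ⟨UPSE.atRank n I.Y (ψ v), (UPSE.atRank_spec (UPSE.PointsetInstance.Y_injOn hY)
    (hψ.range v v.2).1 (hψ.range v v.2).2).1⟩, fun v => hmem v v.2, ?_⟩
  have := (UPSE.PointsetInstance.solution_iff hI hG hst hY hψ.range).1 hψ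
  convert this using 2 with v
  exact (UPSE.PointsetInstance.pt_eq hY (hψ.range v v.2).1 (hψ.range v v.2).2).symm
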